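/- Let $\Omega\subset\mathbb R^2$ be a bounded Lipschitz domain (open and connected) whose boundary properly contains $N\ge1$ pairwise disjoint simple $C^1$-curves $\Gamma_1,\dots,\Gamma_N$, where $\Gamma_i$ is parametrized by arc length by $r_i\in C^1([0,L_i],\mathbb R^2)$, $|r_i'|=1$, $L_i>0$; a curve may be closed, $r_i(0)=r_i(L_i)$, and then $r_i'(0)=r_i'(L_i)$ is required and $r_i$ is extended periodically. Let $\Gamma_i^\circ=\Gamma_i$ if $\Gamma_i$ is closed and $\Gamma_i^\circ=\Gamma_i\setminus\{r_i(0),r_i(L_i)\}$ otherwise, $\Gamma_\nu=\bigcup_i\Gamma_i^\circ$, and suppose that $\Gamma_D=\partial\Omega\setminus\Gamma_\nu$ has positive length. Write $\nu$ for the outward unit normal on $\Gamma_\nu$, $\nabla_\tau$ for the derivative with respect to the arc length $s$ and $\Delta_\tau u=\frac{d^2}{ds^2}u(r_i(s))$. Consider the Ventcel problem $$-\Delta u=f\ \text{ in }\Omega,\qquad u=\varphi\ \text{ on }\Gamma_D,\qquad u_\nu-a_2\,\Delta_\tau u+a_0u=g\ \text{ on }\Gamma_\nu.\tag{P}$$ Let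 $V=\{v\in H^1(\Omega): v|_{\Gamma_\nu}\in H^1(\Gamma_\nu)\}$ and $V_0=\{v\in H^1(\Omega): v|_{\Gamma_\nu}\in H^1_0(\Gamma_\nu),\ v|_{\Gamma_D}=0\}$ (restrictions in the sense of traces; $H^1_0(\Gamma_\nu)$ is the closure of $C^1_c(\Gamma_\nu)$ in $H^1(\Gamma_\nu)$). For $f\in L^2(\Omega)$, $g\in L^2(\Gamma_\nu)$, $a_2\in W^{1,\infty}(\Gamma_\nu)$, $a_0\in L^\infty(\Gamma_\nu)$, a weak solution of (P) is a function $u\in H^1(\Omega)$ such that $\varphi$ has a lifting $\tilde\varphi\in V$ (that is, $\tilde\varphi|_{\Gamma_D}=\varphi$) with $u-\tilde\varphi\in V_0$, and $$\int_\Omega Du\cdot Dw\,dx+\int_{\Gamma_\nu}\Big((a_2\nabla_\tau w+w\nabla_\tau a_2)\nabla_\tau u+a_0uw\Big)ds=\int_\Omega fw\,dx+\int_{\Gamma_\nu}gw\,ds\qquad\text{for all }w\in V_0.$$ **Proposition.** Let $f\in C^0(\Omega)$, $g\in C^0(\Gamma_\nu)\cap L^2(\Gamma_\nu)$, $a_2\in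 C^1(\Gamma_\nu)\cap W^{1,\infty}(\Gamma_\nu)$, $a_0\in C^0(\Gamma_\nu)\cap L^\infty(\Gamma_\nu)$, and let $\varphi$ be continuous on $\Gamma_D$ (in particular, $\varphi\in C^1(\Gamma_D)$ is allowed). Then a function $u\in C^2(\overline\Omega)$ is a weak solution of (P) (which includes $f\in L^2(\Omega)$) if and only if the three equalities in (P) hold pointwise. Here, since the curves are only of class $C^1$, the third equality is understood to mean that at every point of $\Gamma_\nu$ where $a_2\ne0$ the second derivative $\Delta_\tau u$ exists and the equality holds, and that at every point where $a_2=0$ the equality holds without the term $a_2\Delta_\tau u$. -/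

import Mathlib

open MeasureTheory Set Filter Topology
open scoped ENNReal NNReal

namespace Ventcel

/-- The Euclidean plane. -/
abbrev Plane : Type := EuclideanSpace ℝ (Fin 2)

/-- The boundary of `Ω` is locally, in suitable orthonormal coordinates, the graph of a Lipschitz
function, with `Ω` lying (locally) exactly on one side of the graph. -/
def HasLipschitzBoundary (Ω : Set Plane) : Prop :=
  ∀ p ∈ frontier Ω, ∃ (T : Plane ≃ₗᵢ[ℝ] Plane) (h : ℝ → ℝ) (K : ℝ≥0) (δ : ℝ),
    LipschitzWith K h ∧ 0 < δ ∧ ∀ x ∈ Metric.ball p δ, (x ∈ Ω ↔ h ((T x) 0) < (T x) 1)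

/-- A simple `C¹` curve in the plane parametrized by arc length on `[0, L]`. It may be closed
(`r 0 = r L`), in which case `r' 0 = r' L` is required. Only the values of `r` on `[0, L]` matter;
for a closed curve we fix the convention that `r` is extended to `ℝ` by `L`-periodicity. -/
structure PlaneCurve where
  L : ℝ
  r : ℝ → Plane
  L_pos : 0 < L
  contDiffOn : ContDiffOn ℝ 1 r (Icc 0 L)
  unit_speed : ∀ s ∈ Icc 0 L, ‖derivWithin r (Icc 0 L) s‖ = 1
  simple : ∀ s₁ ∈ Icc 0 L, ∀ s₂ ∈ Icc 0 L, s₁ < s₂ → r s₁ = r s₂ → s₁ = 0 ∧ s₂ = L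
  closed_deriv : r 0 = r L → derivWithin r (Icc 0 L) 0 = derivWithin r (Icc 0 L) L
  closed_periodic : r 0 = r L → Function.Periodic r L

namespace PlaneCurve

/-- The curve is closed. -/
def IsClosedCurve (γ : PlaneCurve) : Prop := γ.r 0 = γ.r γ.L

/-- The trace `Γ` of the curve. -/
def trace (γ : PlaneCurve) : Set Plane := γ.r '' Icc 0 γ.L

/-- The interior `Γ°` of the curve: the whole of `Γ` if it is closed, `Γ` without its two
end points otherwise. -/
def innerPart (γ : PlaneCurve) : Set Plane :=
  {x ∈ γ.trace | γ.IsClosedCurve ∨ (x ≠ γ.r 0 ∧ x ≠ γ.r γ.L)}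

/-- The open set of parameters describing `Γ°`: all of `ℝ` (periodically) if the curve is closed,
`(0, L)` otherwise. -/
def dom (γ : PlaneCurve) : Set ℝ := {s | γ.IsClosedCurve ∨ s ∈ Ioo 0 γ.L}

/-- Arc length measure, as a measure on the parameter interval. -/
noncomputable def ds (γ : PlaneCurve) : Measure ℝ := volume.restrict (Ioo 0 γ.L)

/-- Test functions: `C¹` functions compactly supported in `Γ°`, written in the arc length
parameter. On a closed curve these are all `L`-periodic `C¹` functions. -/
def IsTest (γ : PlaneCurve) (η : ℝ → ℝ) : Prop :=
  ContDiff ℝ 1 η ∧ (γ.IsClosedCurve → Function.Periodic η γ.L) ∧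
    (¬ γ.IsClosedCurve → HasCompactSupport η ∧ tsupport η ⊆ Ioo 0 γ.L)

/-- `p` (a function of arc length) is the weak tangential derivative on `Γ°` of the function `h`
(defined on the plane, used only on the curve). -/
def IsWeakTangentialDeriv (γ : PlaneCurve) (h : Plane → ℝ) (p : ℝ → ℝ) : Prop :=
  ∀ η : ℝ → ℝ, γ.IsTest η →
    ∫ s, h (γ.r s) * deriv η s ∂γ.ds = - ∫ s, p s * η s ∂γ.ds

/-- `h ∈ H¹(Γ°)`, with weak tangential derivative `p`. -/
def MemH1 (γ : PlaneCurve) (h : Plane → ℝ) (p : ℝ → ℝ) : Prop :=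
  MemLp (fun s => h (γ.r s)) 2 γ.ds ∧ MemLp p 2 γ.ds ∧ γ.IsWeakTangentialDeriv h p

/-- `h ∈ H¹₀(Γ°)`, the closure of the test functions in `H¹(Γ°)`, with weak tangential
derivative `p`. -/
def MemH10 (γ : PlaneCurve) (h : Plane → ℝ) (p : ℝ → ℝ) : Prop :=
  γ.MemH1 h p ∧ ∃ η : ℕ → ℝ → ℝ, (∀ n, γ.IsTest (η n)) ∧
    Tendsto (fun n => eLpNorm (fun s => η n s - h (γ.r s)) 2 γ.ds) atTop (𝓝 0) ∧
    Tendsto (fun n => eLpNorm (fun s => deriv (η n) s - p s) 2 γ.ds) atTop (𝓝 0)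

/-- `h ∈ W^{1,∞}(Γ°)`, with weak tangential derivative `p`. -/
def MemW1Infty (γ : PlaneCurve) (h : Plane → ℝ) (p : ℝ → ℝ) : Prop :=
  MemLp (fun s => h (γ.r s)) ∞ γ.ds ∧ MemLp p ∞ γ.ds ∧ γ.IsWeakTangentialDeriv h p

/-- `n` is the outward (with respect to `Ω`) unit normal to the curve at `γ.r s`, `s ∈ γ.dom`. -/
def IsOuterNormal (γ : PlaneCurve) (Ω : Set Plane) (s : ℝ) (n : Plane) : Prop :=
  ‖n‖ = 1 ∧ inner ℝ n (deriv γ.r s) = 0 ∧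
    ∀ᶠ t : ℝ in 𝓝[>] 0, γ.r s - t • n ∈ Ω ∧ γ.r s + t • n ∉ closure Ω

end PlaneCurve

variable {N : ℕ}

/-- `Γ_ν`, the union of the interiors of the curves. -/
def GammaNu (Γ : Fin N → PlaneCurve) : Set Plane := ⋃ i, (Γ i).innerPart

/-- `Γ_D = ∂Ω \ Γ_ν`. -/
def GammaD (Ω : Set Plane) (Γ : Fin N → PlaneCurve) : Set Plane := frontier Ω \ GammaNu Γ

/-- The geometric assumption: `Ω` is a bounded Lipschitz domain whose boundary properly contains
finitely many (at least one) pairwise disjoint simple `C¹` curves, and the rest `Γ_D` of the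
boundary has positive length. -/
structure IsAdmissible (Ω : Set Plane) (Γ : Fin N → PlaneCurve) : Prop where
  isOpen : IsOpen Ω
  isConnected : IsConnected Ω
  isBounded : Bornology.IsBounded Ω
  lipschitz : HasLipschitzBoundary Ω
  one_le : 1 ≤ N
  ssubset : (⋃ i, (Γ i).trace) ⊂ frontier Ω
  disjoint : ∀ i j, i ≠ j → Disjoint (Γ i).trace (Γ j).trace
  length_pos : 0 < μH[1] (GammaD Ω Γ)

/-- Length measure on the boundary. -/
noncomputable def bdry (Ω : Set Plane) : Measure Plane := μH[1].restrict (frontier Ω)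

/-- `v ∈ H¹(Ω)`, with weak gradient `Dv`. -/
def MemH1 (Ω : Set Plane) (v : Plane → ℝ) (Dv : Plane → Plane) : Prop :=
  MemLp v 2 (volume.restrict Ω) ∧ MemLp Dv 2 (volume.restrict Ω) ∧
    ∀ ψ : Plane → ℝ, ContDiff ℝ 1 ψ → HasCompactSupport ψ → tsupport ψ ⊆ Ω →
      ∫ x in Ω, v x • gradient ψ x = - ∫ x in Ω, ψ x • Dv x

/-- `t ∈ L²(∂Ω)` is the trace on `∂Ω` of the function `v ∈ H¹(Ω)` with weak gradient `Dv`: there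
are functions in `C¹(Ω̄)` which converge to `v` in `H¹(Ω)` and whose restrictions to `∂Ω` converge
to `t` in `L²(∂Ω)`. -/
def IsTrace (Ω : Set Plane) (v : Plane → ℝ) (Dv : Plane → Plane) (t : Plane → ℝ) : Prop :=
  MemLp t 2 (bdry Ω) ∧ ∃ ψ : ℕ → Plane → ℝ, (∀ n, ContDiffOn ℝ 1 (ψ n) (closure Ω)) ∧
    Tendsto (fun n => eLpNorm (fun x => ψ n x - v x) 2 (volume.restrict Ω)) atTop (𝓝 0) ∧
    Tendsto (fun n => eLpNorm (fun x => gradient (ψ n) x - Dv x) 2 (volume.restrict Ω))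
      atTop (𝓝 0) ∧
    Tendsto (fun n => eLpNorm (fun x => ψ n x - t x) 2 (bdry Ω)) atTop (𝓝 0)

/-- `v ∈ V`, i.e. `v ∈ H¹(Ω)` and `v|_{Γ_ν} ∈ H¹(Γ_ν)`. Here `Dv` is the weak gradient of `v`, `t`
its trace on `∂Ω`, and `p i` the tangential derivative of the trace along the `i`-th curve. -/
def MemV (Ω : Set Plane) (Γ : Fin N → PlaneCurve)
    (v : Plane → ℝ) (Dv : Plane → Plane) (t : Plane → ℝ) (p : Fin N → ℝ → ℝ) : Prop :=
  MemH1 Ω v Dv ∧ IsTrace Ω v Dv t ∧ ∀ i, (Γ i).MemH1 t (p i)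

/-- `v ∈ V₀`, i.e. `v ∈ H¹(Ω)`, `v|_{Γ_ν} ∈ H¹₀(Γ_ν)` and `v|_{Γ_D} = 0`; `Dv`, `t`, `p` as in
`MemV`. -/
def MemV0 (Ω : Set Plane) (Γ : Fin N → PlaneCurve)
    (v : Plane → ℝ) (Dv : Plane → Plane) (t : Plane → ℝ) (p : Fin N → ℝ → ℝ) : Prop :=
  MemH1 Ω v Dv ∧ IsTrace Ω v Dv t ∧ (∀ i, (Γ i).MemH10 t (p i)) ∧
    ∀ᵐ x ∂(μH[1].restrict (GammaD Ω Γ)), t x = 0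

/-- `v` belongs to `V` and is a lifting of `φ`: its trace on `Γ_D` is `φ`. -/
def IsLifting (Ω : Set Plane) (Γ : Fin N → PlaneCurve) (φ v : Plane → ℝ) : Prop :=
  ∃ Dv t p, MemV Ω Γ v Dv t p ∧ ∀ᵐ x ∂(μH[1].restrict (GammaD Ω Γ)), t x = φ x

/-- `u ∈ V_φ`: `φ` has a lifting `φ' ∈ V`, `u ∈ H¹(Ω)` and `u - φ' ∈ V₀`. -/
def MemVphi (Ω : Set Plane) (Γ : Fin N → PlaneCurve) (φ u : Plane → ℝ) : Prop :=
  (∃ Du, MemH1 Ω u Du) ∧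
    ∃ φ' : Plane → ℝ, IsLifting Ω Γ φ φ' ∧
      ∃ Dv t p, MemV0 Ω Γ (fun x => u x - φ' x) Dv t p

/-- `u` is a weak solution of the Ventcel problem
`-Δu = f₁ + div f₂` in `Ω`, `u = φ` on `Γ_D`, `u_ν - a₂ Δ_τ u + a₀ u = g₁ + ∇_τ g₂` on `Γ_ν`,
where `f₁, f₂, g₁, g₂` are square integrable, `a₂ ∈ W^{1,∞}(Γ_ν)` and `a₀ ∈ L^∞(Γ_ν)`.
In the variational equality `Du`, `tu`, `pu` are the weak gradient, the trace and the tangential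
derivative of the trace of `u` (similarly for `w`), and `q i` is the tangential derivative of `a₂`
on the `i`-th curve; all of them are unique almost everywhere. -/
def IsWeakSolution (Ω : Set Plane) (Γ : Fin N → PlaneCurve)
    (f₁ : Plane → ℝ) (f₂ : Plane → Plane) (φ g₁ g₂ a₂ a₀ u : Plane → ℝ) : Prop :=
  MemLp f₁ 2 (volume.restrict Ω) ∧ MemLp f₂ 2 (volume.restrict Ω) ∧
  (∀ i, MemLp (fun s => g₁ ((Γ i).r s)) 2 (Γ i).ds) ∧
  (∀ i, MemLp (fun s => g₂ ((Γ i).r s)) 2 (Γ i).ds) ∧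
  (∀ i, MemLp (fun s => a₀ ((Γ i).r s)) ∞ (Γ i).ds) ∧
  MemVphi Ω Γ φ u ∧
  ∃ (q : Fin N → ℝ → ℝ) (Du : Plane → Plane) (tu : Plane → ℝ) (pu : Fin N → ℝ → ℝ),
    (∀ i, (Γ i).MemW1Infty a₂ (q i)) ∧ MemV Ω Γ u Du tu pu ∧
    ∀ (w : Plane → ℝ) (Dw : Plane → Plane) (tw : Plane → ℝ) (pw : Fin N → ℝ → ℝ),
      MemV0 Ω Γ w Dw tw pw →
      (∫ x in Ω, inner ℝ (Du x) (Dw x)) +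
        ∑ i, ∫ s, ((a₂ ((Γ i).r s) * pw i s + tw ((Γ i).r s) * q i s) * pu i s
          + a₀ ((Γ i).r s) * tu ((Γ i).r s) * tw ((Γ i).r s)) ∂(Γ i).ds
      = (∫ x in Ω, (f₁ x * w x - inner ℝ (f₂ x) (Dw x))) +
        ∑ i, ∫ s, (g₁ ((Γ i).r s) * tw ((Γ i).r s) - g₂ ((Γ i).r s) * pw i s) ∂(Γ i).ds

/-- The three equalities `-Δu = f` in `Ω`, `u = φ` on `Γ_D`, `u_ν - a₂ Δ_τ u + a₀ u = g` on `Γ_ν`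
hold pointwise, for a function `u ∈ C²(Ω̄)`. The Laplace–Beltrami operator is the second derivative
of `u` with respect to arc length. Since the curves are only `C¹`, its existence is part of the
claim wherever `a₂ ≠ 0`; at points where `a₂ = 0` the term `a₂ Δ_τ u` is absent. -/
structure HoldsPointwise (Ω : Set Plane) (Γ : Fin N → PlaneCurve)
    (f φ g a₂ a₀ u : Plane → ℝ) : Prop where
  interior : ∀ x ∈ Ω, - Laplacian.laplacian u x = f x
  dirichlet : ∀ x ∈ GammaD Ω Γ, u x = φ x
  ventcel : ∀ i, ∀ s ∈ (Γ i).dom,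
    (a₂ ((Γ i).r s) ≠ 0 →
      (∀ᶠ s' in 𝓝 s, DifferentiableAt ℝ (fun s => u ((Γ i).r s)) s') ∧
      DifferentiableAt ℝ (deriv fun s => u ((Γ i).r s)) s) ∧
    ∃ n : Plane, (Γ i).IsOuterNormal Ω s n ∧
      fderivWithin ℝ u (closure Ω) ((Γ i).r s) n
        - a₂ ((Γ i).r s) * deriv (deriv fun s => u ((Γ i).r s)) s
        + a₀ ((Γ i).r s) * u ((Γ i).r s) = g ((Γ i).r s)

end Ventcel

/-! Everything rests on Green's formula: for w in V₀ with trace t, ∫ w Δu + ∫ Dw·Du is the integral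
of t u_ν over Γ_ν. It turns the variational equality into ∫_Ω w (Δu + f) = Σ ∫ (F ∇_τ w + c w) ds,
where F = a₂ ∇_τ u is `tangentialFlux` and c = ∇_τ a₂ ∇_τ u + u_ν + a₀ u − g is `fluxRate`
(`variational_iff`). The pointwise Ventcel condition is precisely F' = c (`ventcel_iff`): where a₂ ≠
0 one divides by a₂ and recovers the second derivative; where a₂ = 0 the product F has derivative
∇_τ a₂ ∇_τ u as soon as ∇_τ u is continuous, so no second derivative is needed.

From weak to pointwise: test functions supported in Ω give −Δu = f, and du Bois-Reymond's lemma
(`hasDerivAt_of_weak`) gives F' = c, once test functions of the arc length have been extended to the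
plane (`exists_extension`). The trace of u equals φ almost everywhere on Γ_D; both functions are
continuous there and every relatively open part of Γ_D has positive length
(`hausdorffMeasure_gammaD_inter_pos`), so they agree everywhere. Conversely, F' = c is integrated by
parts against test functions and the limit in H¹₀ is taken (`integral_mul_memH10`); u is its own
lifting, and f = −Δu is bounded.

The remaining work is Green's formula on a Lipschitz domain. Above a graph, shear coordinates reduce
the divergence theorem to Fubini and the fundamental theorem of calculus
(`integral_divergence_above_graph`). A partition of unity then gives `exists_flux_estimate`: the
total divergence differs from the flux through the curves by at most a constant times ∫_{Γ_D} |X|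
dH¹. This inequality suffices, without a normal on Γ_D or an area formula for H¹, since the fields
ψₙ Du, with ψₙ the C¹ functions approximating w, tend to zero in L¹ on Γ_D. The same chart formula
shows that traces are unique (`trace_eq_zero`). -/

namespace Ventcel

/-! ### The divergence theorem above a Lipschitz graph -/

/-- The divergence of a vector field. -/
noncomputable def divergence (X : Plane → Plane) (x : Plane) : ℝ :=
  LinearMap.trace ℝ Plane (fderiv ℝ X x : Plane →ₗ[ℝ] Plane)

/-- The point with coordinates `(x, h x + z)` in the orthonormal frame `T`. -/
noncomputable def shear (T : Plane ≃ₗᵢ[ℝ] Plane) (h : ℝ → ℝ) (p : ℝ × ℝ) : Plane :=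
  T.symm !₂[p.1, h p.1 + p.2]

/-- The `i`-th vector of the orthonormal frame `T`. -/
noncomputable def frame (T : Plane ≃ₗᵢ[ℝ] Plane) (i : Fin 2) : Plane :=
  T.symm (EuclideanSpace.single i 1)

@[simp] lemma shear_coord_zero (T : Plane ≃ₗᵢ[ℝ] Plane) (h : ℝ → ℝ) (p : ℝ × ℝ) :
    (T (shear T h p)) 0 = p.1 := by simp [shear]

@[simp] lemma shear_coord_one (T : Plane ≃ₗᵢ[ℝ] Plane) (h : ℝ → ℝ) (p : ℝ × ℝ) :
    (T (shear T h p)) 1 = h p.1 + p.2 := by simp [shear]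

lemma shear_coord (T : Plane ≃ₗᵢ[ℝ] Plane) (h : ℝ → ℝ) (x : Plane) :
    shear T h ((T x) 0, (T x) 1 - h ((T x) 0)) = x := by
  apply T.injective
  ext i
  fin_cases i <;> simp

lemma eq_frame_sum (T : Plane ≃ₗᵢ[ℝ] Plane) (x : Plane) :
    x = (T x) 0 • frame T 0 + (T x) 1 • frame T 1 := by
  apply T.injective
  ext i
  fin_cases i <;> simp [frame]

lemma shear_eq (T : Plane ≃ₗᵢ[ℝ] Plane) (h : ℝ → ℝ) (p : ℝ × ℝ) :
    shear T h p = p.1 • frame T 0 + (h p.1 + p.2) • frame T 1 := by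
  conv_lhs => rw [eq_frame_sum T (shear T h p)]
  simp

lemma continuous_shear (T : Plane ≃ₗᵢ[ℝ] Plane) {h : ℝ → ℝ} (hh : Continuous h) :
    Continuous (shear T h) := by
  have : shear T h = fun p => p.1 • frame T 0 + (h p.1 + p.2) • frame T 1 := by
    ext1 p; exact shear_eq T h p
  rw [this]; fun_prop

lemma continuous_coord (T : Plane ≃ₗᵢ[ℝ] Plane) (i : Fin 2) : Continuous fun x => (T x) i := by
  fun_prop

/-- The shear as a homeomorphism. -/
noncomputable def shearHomeo (T : Plane ≃ₗᵢ[ℝ] Plane) {h : ℝ → ℝ} (hh : Continuous h) :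
    (ℝ × ℝ) ≃ₜ Plane where
  toFun := shear T h
  invFun x := ((T x) 0, (T x) 1 - h ((T x) 0))
  left_inv p := by simp
  right_inv x := shear_coord T h x
  continuous_toFun := continuous_shear T hh
  continuous_invFun := by
    have h0 := continuous_coord T 0
    exact h0.prodMk ((continuous_coord T 1).sub (hh.comp h0))

/-- Each vertical line is merely translated, so this is a skew product of measure preserving maps
followed by isometries. No Jacobian appears, and continuity of `h` is enough. -/
lemma measurePreserving_shear (T : Plane ≃ₗᵢ[ℝ] Plane) {h : ℝ → ℝ} (hh : Continuous h) :
    MeasurePreserving (shear T h) volume volume := by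
  have h1 : MeasurePreserving (fun p : ℝ × ℝ => (p.1, h p.1 + p.2)) volume volume := by
    refine MeasurePreserving.skew_product (g := fun x y => h x + y) (MeasurePreserving.id volume)
      ?_ ?_
    · exact (by fun_prop : Continuous fun p : ℝ × ℝ => h p.1 + p.2).measurable
    · exact Eventually.of_forall fun x => (measurePreserving_add_left volume (h x)).map_eq
  have h2 := (volume_preserving_finTwoArrow ℝ).symm
  have h3 := PiLp.volume_preserving_toLp (Fin 2)
  have h4 := T.symm.measurePreserving
  have := h4.comp (h3.comp (h2.comp h1))
  convert this using 1
  ext1 p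
  simp only [shear]
  congr 2

lemma measurableEmbedding_shear (T : Plane ≃ₗᵢ[ℝ] Plane) {h : ℝ → ℝ} (hh : Continuous h) :
    MeasurableEmbedding (shear T h) :=
  (shearHomeo T hh).measurableEmbedding

lemma norm_coord_le (T : Plane ≃ₗᵢ[ℝ] Plane) (v : Plane) (i : Fin 2) : |(T v) i| ≤ ‖v‖ := by
  have := PiLp.norm_apply_le (T v) i
  rwa [T.norm_map, Real.norm_eq_abs] at this

lemma norm_frame (T : Plane ≃ₗᵢ[ℝ] Plane) (i : Fin 2) : ‖frame T i‖ = 1 := by simp [frame]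

lemma trace_eq_frame (T : Plane ≃ₗᵢ[ℝ] Plane) (A : Plane →L[ℝ] Plane) :
    LinearMap.trace ℝ Plane (A : Plane →ₗ[ℝ] Plane)
      = (T (A (frame T 0))) 0 + (T (A (frame T 1))) 1 := by
  have := LinearMap.trace_eq_sum_inner (A : Plane →ₗ[ℝ] Plane) (OrthonormalBasis.ofRepr T)
  rw [this, Fin.sum_univ_two, ← OrthonormalBasis.repr_apply_apply,
    ← OrthonormalBasis.repr_apply_apply]
  rw [← OrthonormalBasis.repr_symm_single, ← OrthonormalBasis.repr_symm_single]
  rfl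

lemma abs_trace_le (A : Plane →L[ℝ] Plane) :
    |LinearMap.trace ℝ Plane (A : Plane →ₗ[ℝ] Plane)| ≤ 2 * ‖A‖ := by
  rw [trace_eq_frame (LinearIsometryEquiv.refl ℝ Plane)]
  set T := LinearIsometryEquiv.refl ℝ Plane
  have key : ∀ i j, |(T (A (frame T i))) j| ≤ ‖A‖ := fun i j => by
    refine (norm_coord_le T _ j).trans ?_
    simpa [norm_frame] using A.le_opNorm (frame T i)
  have := abs_add_le ((T (A (frame T 0))) 0) ((T (A (frame T 1))) 1)
  linarith [key 0 0, key 1 1]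

lemma continuous_trace :
    Continuous fun A : Plane →L[ℝ] Plane =>
      LinearMap.trace ℝ Plane (A : Plane →ₗ[ℝ] Plane) := by
  have : (fun A : Plane →L[ℝ] Plane =>
      LinearMap.trace ℝ Plane (A : Plane →ₗ[ℝ] Plane)) = fun A =>
      ((LinearIsometryEquiv.refl ℝ Plane) (A (frame (LinearIsometryEquiv.refl ℝ Plane) 0))) 0 +
      ((LinearIsometryEquiv.refl ℝ Plane) (A (frame (LinearIsometryEquiv.refl ℝ Plane) 1))) 1 := by
    ext1 A; exact trace_eq_frame _ A
  rw [this]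
  exact ((continuous_coord _ 0).comp (by fun_prop)).add ((continuous_coord _ 1).comp (by fun_prop))

/-- A locally Lipschitz function on the line which vanishes outside `[-M, M]` has a derivative of
integral zero. -/
lemma integral_deriv_eq_zero_of_locallyLipschitz {a : ℝ → ℝ} {M : ℝ} (hM : 0 < M)
    (ha : LocallyLipschitz a) (h0 : ∀ x, M ≤ |x| → a x = 0) : ∫ x, deriv a x = 0 := by
  -- On the compact interval the function is Lipschitz, hence absolutely continuous, and the
  -- fundamental theorem of calculus applies.
  obtain ⟨K, hK⟩ := LocallyLipschitzOn.exists_lipschitzOnWith_of_compact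
    (isCompact_uIcc (a := -M) (b := M)) (ha.locallyLipschitzOn (s := uIcc (-M) M))
  have h1 := hK.absolutelyContinuousOnInterval.integral_deriv_eq_sub
  rw [h0 M (le_abs_self M), h0 (-M) (by simp [abs_of_pos hM]), sub_zero,
    intervalIntegral.integral_of_le (by linarith)] at h1
  rw [← h1]
  refine (setIntegral_eq_integral_of_ae_compl_eq_zero ?_).symm
  -- At ±M the derivative need not vanish; beyond these two points the function is locally zero.
  have hne : ∀ᵐ x : ℝ, x ≠ M ∧ x ≠ -M := by
    have h2 : ∀ᵐ x : ℝ, x ∉ ({M, -M} : Set ℝ) :=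
      measure_eq_zero_iff_ae_notMem.1 ((Set.toFinite {M, -M}).measure_zero volume)
    filter_upwards [h2] with x hx
    simpa [not_or] using hx
  filter_upwards [hne] with x hx hxM
  have hx' : M < |x| := by
    by_contra hcon
    push Not at hcon
    rw [abs_le] at hcon
    exact hxM ⟨lt_of_le_of_ne hcon.1 (Ne.symm hx.2), hcon.2⟩
  have : a =ᶠ[𝓝 x] fun _ => 0 := by
    have ho : IsOpen {y : ℝ | M < |y|} := isOpen_lt continuous_const continuous_abs
    filter_upwards [ho.mem_nhds hx'] with y hy using h0 y (le_of_lt hy)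
  rw [this.deriv_eq]; simp

end Ventcel

namespace Ventcel

lemma hasDerivAt_shear_snd (T : Plane ≃ₗᵢ[ℝ] Plane) (h : ℝ → ℝ) (x z : ℝ) :
    HasDerivAt (fun z => shear T h (x, z)) (frame T 1) z := by
  have : (fun z => shear T h (x, z)) = fun z => x • frame T 0 + (h x + z) • frame T 1 := by
    ext1 z; exact shear_eq T h (x, z)
  rw [this]
  simpa using (((hasDerivAt_id z).const_add (h x)).smul_const (frame T 1)).const_add
    (x • frame T 0)

lemma hasDerivAt_shear_fst (T : Plane ≃ₗᵢ[ℝ] Plane) {h : ℝ → ℝ} {x h' : ℝ} (z : ℝ)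
    (hx : HasDerivAt h h' x) :
    HasDerivAt (fun x => shear T h (x, z)) (frame T 0 + h' • frame T 1) x := by
  have : (fun x => shear T h (x, z)) = fun x => x • frame T 0 + (h x + z) • frame T 1 := by
    ext1 x; exact shear_eq T h (x, z)
  rw [this]
  have h1 := (hasDerivAt_id x).smul_const (frame T 0)
  rw [one_smul] at h1
  exact h1.add ((hx.add_const z).smul_const (frame T 1))

lemma lipschitzWith_shear_fst (T : Plane ≃ₗᵢ[ℝ] Plane) {h : ℝ → ℝ} {K : ℝ≥0}
    (hh : LipschitzWith K h) (z : ℝ) : LipschitzWith (1 + K) fun x => shear T h (x, z) := by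
  refine LipschitzWith.of_dist_le_mul fun x y => ?_
  rw [dist_eq_norm, shear_eq, shear_eq, Real.dist_eq]
  have h1 : |h x - h y| ≤ K * |x - y| := by
    simpa [Real.dist_eq] using hh.dist_le_mul x y
  calc _ = ‖(x - y) • frame T 0 + (h x - h y) • frame T 1‖ := by congr 1; simp; module
    _ ≤ |x - y| + |h x - h y| := by
      refine (norm_add_le _ _).trans ?_
      simp [norm_smul, norm_frame]
    _ ≤ _ := by push_cast; linarith

/-- Divergence theorem above the graph of a Lipschitz function. -/
theorem integral_divergence_above_graph (T : Plane ≃ₗᵢ[ℝ] Plane) {h : ℝ → ℝ} {K : ℝ≥0}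
    (hh : LipschitzWith K h) {X : Plane → Plane}
    (hX : ContDiffOn ℝ 1 X {x | h ((T x) 0) < (T x) 1})
    (hXc : ContinuousOn X {x | h ((T x) 0) ≤ (T x) 1}) {R C : ℝ}
    (hsupp : ∀ x, h ((T x) 0) ≤ (T x) 1 → R ≤ ‖x‖ → X x = 0)
    (hC : ∀ x, h ((T x) 0) < (T x) 1 → ‖fderiv ℝ X x‖ ≤ C) :
    ∫ x in {x | h ((T x) 0) < (T x) 1}, divergence X x =
      ∫ x, (deriv h x * (T (X (shear T h (x, 0)))) 0 - (T (X (shear T h (x, 0)))) 1) := by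
  wlog hR : 0 < R generalizing R
  · exact this (R := max R 1) (fun x hx hRx => hsupp x hx ((le_max_left _ _).trans hRx))
      (lt_max_of_lt_right one_pos)
  have hhc := hh.continuous
  set G : Set Plane := {x | h ((T x) 0) < (T x) 1} with hG
  have hGo : IsOpen G :=
    isOpen_lt (hhc.comp (continuous_coord T 0)) (continuous_coord T 1)
  have hmemG : ∀ x z : ℝ, 0 < z → shear T h (x, z) ∈ G := fun x z hz => by simp [hG, hz]
  have hC0 : 0 ≤ C := (norm_nonneg _).trans (hC _ (hmemG 0 1 one_pos))
  have hdiff : ∀ x ∈ G, DifferentiableAt ℝ X x := fun x hx =>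
    (hX.contDiffAt (hGo.mem_nhds hx)).differentiableAt (by norm_num)
  have hnear : ∀ x ∈ G, R < ‖x‖ → X =ᶠ[𝓝 x] fun _ => 0 := fun x hx hxR => by
    filter_upwards [hGo.mem_nhds hx, (isOpen_lt continuous_const continuous_norm).mem_nhds hxR]
      with y hy hyR using hsupp y (le_of_lt hy) (le_of_lt hyR)
  have hfd0 : ∀ x ∈ G, R < ‖x‖ → fderiv ℝ X x = 0 := fun x hx hxR => by
    rw [(hnear x hx hxR).fderiv_eq]; simp
  have hfdc : ContinuousOn (fderiv ℝ X) G := hX.continuousOn_fderiv_of_isOpen hGo (by norm_num)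
  set S : Set (ℝ × ℝ) := univ ×ˢ Ioi 0 with hS
  have hSm : MeasurableSet S := MeasurableSet.univ.prod measurableSet_Ioi
  have hpre : shear T h ⁻¹' G = S := by ext p; simp [hG, hS]
  have hmaps : MapsTo (shear T h) S G := fun p hp => by rw [← hpre] at hp; exact hp
  have hshc := continuous_shear T hhc
  rw [← (measurePreserving_shear T hhc).setIntegral_preimage_emb (measurableEmbedding_shear T hhc),
    hpre]
  -- the two parts of the divergence
  set B : Fin 2 → ℝ × ℝ → ℝ := fun i p => (T (fderiv ℝ X (shear T h p) (frame T 1))) i with hB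
  set D : ℝ × ℝ → ℝ := fun p => divergence X (shear T h p) with hD
  -- In the coordinates (x, z) the divergence is ∂ₓX₀ + ∂_z(X₁ − h' X₀); `Q` is the second summand,
  -- and the correction −h' X₀ comes from ∂ₓ acting along `frame T 0 + h' • frame T 1`.
  set Q : ℝ × ℝ → ℝ := fun p => B 1 p - deriv h p.1 * B 0 p with hQ
  have hderivh : ∀ x, |deriv h x| ≤ K := fun x => by
    simpa using norm_deriv_le_of_lipschitz hh (x₀ := x)
  have hfdS : ContinuousOn (fun p => fderiv ℝ X (shear T h p)) S := hfdc.comp hshc.continuousOn hmaps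
  have hBc : ∀ i, ContinuousOn (B i) S := fun i =>
    (continuous_coord T i).comp_continuousOn (hfdS.clm_apply continuousOn_const)
  have hDc : ContinuousOn D S := continuous_trace.comp_continuousOn hfdS
  have hBb : ∀ i, ∀ p ∈ S, |B i p| ≤ C := fun i p hp => by
    refine (norm_coord_le T _ i).trans ?_
    have := (fderiv ℝ X (shear T h p)).le_opNorm (frame T 1)
    rw [norm_frame, mul_one] at this
    exact this.trans (hC _ (hmaps hp))
  have hS'm : ∀ M : ℝ, MeasurableSet (S ∩ shear T h ⁻¹' Metric.closedBall 0 M) := fun M =>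
    hSm.inter (hshc.measurable measurableSet_closedBall)
  have hfin : volume (S ∩ shear T h ⁻¹' Metric.closedBall 0 R) ≠ ⊤ := by
    refine ne_top_of_le_ne_top ?_ (measure_mono inter_subset_right)
    rw [(measurePreserving_shear T hhc).measure_preimage measurableSet_closedBall.nullMeasurableSet]
    exact measure_closedBall_lt_top.ne
  -- Bounded functions vanishing off the preimage of a ball are integrable, because this preimage
  -- has finite measure.
  have hint : ∀ (A : ℝ × ℝ → ℝ) (M : ℝ), AEStronglyMeasurable A (volume.restrict S) →
      (∀ p ∈ S, |A p| ≤ M) → (∀ p ∈ S, R < ‖shear T h p‖ → A p = 0) → IntegrableOn A S := by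
    intro A M hA hAM hA0
    have h1 : IntegrableOn A (S ∩ shear T h ⁻¹' Metric.closedBall 0 R) := by
      refine ⟨hA.mono_set inter_subset_left, HasFiniteIntegral.restrict_of_bounded (C := M)
        hfin.lt_top ?_⟩
      exact (ae_restrict_iff' (hS'm R)).2 (Eventually.of_forall fun p hp => hAM p hp.1)
    refine h1.of_forall_sdiff_eq_zero hSm ?_
    rintro p ⟨hpS, hp⟩
    refine hA0 p hpS ?_
    by_contra hcon
    exact hp ⟨hpS, by simpa using hcon⟩
  have hDint : IntegrableOn D S := by
    refine hint D (2 * C) (hDc.aestronglyMeasurable hSm) (fun p hp => ?_) fun p hp hpR => ?_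
    · exact (abs_trace_le _).trans (by linarith [hC _ (hmaps hp)])
    · simp [hD, divergence, hfd0 _ (hmaps hp) hpR]
  have hQint : IntegrableOn Q S := by
    refine hint Q (C + K * C) ?_ (fun p hp => ?_) fun p hp hpR => ?_
    · refine ((hBc 1).aestronglyMeasurable hSm).sub
        (AEStronglyMeasurable.mul ?_ ((hBc 0).aestronglyMeasurable hSm))
      exact ((measurable_deriv h).comp measurable_fst).aestronglyMeasurable
    · refine (abs_sub _ _).trans (add_le_add (hBb 1 p hp) ?_)
      rw [abs_mul]
      exact mul_le_mul (hderivh _) (hBb 0 p hp) (abs_nonneg _) K.2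
    · simp [hQ, hB, hfd0 _ (hmaps hp) hpR]
  have hvol : (volume : Measure (ℝ × ℝ)).restrict S
      = (volume : Measure ℝ).prod (volume.restrict (Ioi 0)) := by
    rw [hS, Measure.volume_eq_prod, ← Measure.prod_restrict, Measure.restrict_univ]
  have hDQint : IntegrableOn (fun p => D p - Q p) S := hDint.sub hQint
  have hsplit : ∫ p in S, D p = ∫ p in S, Q p + (D p - Q p) := by simp
  rw [show ∫ p in S, divergence X (shear T h p) = ∫ p in S, D p from rfl, hsplit,
    integral_add hQint hDQint]
  rw [IntegrableOn, hvol] at hQint hDQint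
  -- `Q` is a z-derivative and is integrated in z first; `D - Q` is an x-derivative and is
  -- integrated in x first.
  rw [hvol, integral_prod _ hQint, integral_prod_symm _ hDQint]
  have hnormsh : ∀ x z : ℝ, |x| ≤ ‖shear T h (x, z)‖ := fun x z => by
    simpa using norm_coord_le T (shear T h (x, z)) 0
  have hnormsh1 : ∀ x z : ℝ, |h x + z| ≤ ‖shear T h (x, z)‖ := fun x z => by
    simpa using norm_coord_le T (shear T h (x, z)) 1
  -- the horizontal part
  have hP : ∀ z ∈ Ioi (0 : ℝ), ∫ x, (D (x, z) - Q (x, z)) = 0 := by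
    intro z hz
    have hlip : LocallyLipschitz fun x => (T (X (shear T h (x, z)))) 0 := by
      intro x
      obtain ⟨K', t, ht, hKt⟩ :=
        (hX.contDiffAt (hGo.mem_nhds (hmemG x z hz))).exists_lipschitzOnWith
      have h1 : LipschitzWith 1 fun v : Plane => (T v) 0 := by
        refine LipschitzWith.of_dist_le_mul fun v w => ?_
        have := norm_coord_le T (v - w) 0
        rw [map_sub] at this
        simpa [dist_eq_norm] using this
      have hl := lipschitzWith_shear_fst T hh z
      exact ⟨1 * (K' * (1 + K)), _, hl.continuous.continuousAt.preimage_mem_nhds ht,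
        h1.comp_lipschitzOnWith (hKt.comp hl.lipschitzOnWith (mapsTo_preimage _ _))⟩
    rw [← integral_deriv_eq_zero_of_locallyLipschitz hR hlip fun x hx => by
      rw [hsupp _ (le_of_lt (hmemG x z hz)) (hx.trans (hnormsh x z))]; simp]
    refine integral_congr_ae ?_
    -- Rademacher in dimension one: the chain rule in x is needed only where `h` is differentiable.
    filter_upwards [hh.ae_differentiableAt_real] with x hx
    have h1 := (hdiff _ (hmemG x z hz)).hasFDerivAt.comp_hasDerivAt x
      (hasDerivAt_shear_fst T z hx.hasDerivAt)
    have h2 : HasDerivAt (fun x => (T (X (shear T h (x, z)))) 0)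
        ((T (fderiv ℝ X (shear T h (x, z)) (frame T 0 + deriv h x • frame T 1))) 0) x :=
      ((EuclideanSpace.proj (𝕜 := ℝ) (0 : Fin 2)).comp
        (T.toContinuousLinearEquiv : Plane →L[ℝ] Plane)).hasFDerivAt.comp_hasDerivAt x h1
    rw [h2.deriv]
    simp only [hD, hQ, hB, divergence, trace_eq_frame T, map_add, map_smul, PiLp.add_apply,
      PiLp.smul_apply, smul_eq_mul]
    ring
  rw [setIntegral_congr_fun measurableSet_Ioi (g := fun _ => (0 : ℝ)) hP, integral_zero, add_zero]
  -- the vertical part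
  refine integral_congr_ae ?_
  filter_upwards [hQint.prod_right_ae] with x hx
  -- With x fixed, `deriv h x` is just a constant, so differentiability of `h` at x plays no role
  -- here.
  have hderiv : ∀ z ∈ Ioi (0 : ℝ), HasDerivAt (fun z => (T (X (shear T h (x, z)))) 1
      - deriv h x * (T (X (shear T h (x, z)))) 0) (Q (x, z)) z := by
    intro z hz
    have h1 := (hdiff _ (hmemG x z hz)).hasFDerivAt.comp_hasDerivAt z (hasDerivAt_shear_snd T h x z)
    have h2 : ∀ i, HasDerivAt (fun z => (T (X (shear T h (x, z)))) i)
        ((T (fderiv ℝ X (shear T h (x, z)) (frame T 1))) i) z := fun i =>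
      ((EuclideanSpace.proj (𝕜 := ℝ) i).comp
        (T.toContinuousLinearEquiv : Plane →L[ℝ] Plane)).hasFDerivAt.comp_hasDerivAt z h1
    exact (h2 1).sub ((h2 0).const_mul (deriv h x))
  have hcont : ContinuousWithinAt (fun z => (T (X (shear T h (x, z)))) 1
      - deriv h x * (T (X (shear T h (x, z)))) 0) (Ici 0) 0 := by
    have h1 : ContinuousOn (fun z => X (shear T h (x, z))) (Ici 0) :=
      hXc.comp (by fun_prop) fun z (hz : 0 ≤ z) => by simp [hz]
    have h2 : ∀ i, ContinuousOn (fun z => (T (X (shear T h (x, z)))) i) (Ici 0) := fun i =>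
      (continuous_coord T i).comp_continuousOn h1
    exact ((h2 1).sub (continuousOn_const.mul (h2 0))) 0 self_mem_Ici
  have hlim : Tendsto (fun z => (T (X (shear T h (x, z)))) 1
      - deriv h x * (T (X (shear T h (x, z)))) 0) atTop (𝓝 0) := by
    refine tendsto_const_nhds.congr' ?_
    filter_upwards [eventually_ge_atTop (R + |h x|), eventually_gt_atTop 0] with z hz hz0
    rw [hsupp _ (le_of_lt (hmemG x z hz0)) (le_trans ?_ (hnormsh1 x z))]
    · simp
    · linarith [le_abs_self (h x + z), neg_abs_le (h x)]
  rw [integral_Ioi_of_hasDerivAt_of_tendsto hcont hderiv hx hlim]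
  ring

end Ventcel

namespace Ventcel

namespace PlaneCurve

variable (γ : PlaneCurve)

/-! ### Curves -/

lemma Ioo_subset_dom : Ioo 0 γ.L ⊆ γ.dom := fun _ hs => Or.inr hs

lemma dom_eq_univ (h : γ.IsClosedCurve) : γ.dom = univ := by
  ext s; simp [dom, h]

lemma dom_eq_Ioo (h : ¬ γ.IsClosedCurve) : γ.dom = Ioo 0 γ.L := by
  ext s; simp [dom, h]

lemma isOpen_dom : IsOpen γ.dom := by
  by_cases h : γ.IsClosedCurve
  · rw [γ.dom_eq_univ h]; exact isOpen_univ
  · rw [γ.dom_eq_Ioo h]; exact isOpen_Ioo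

lemma hasDerivWithinAt {s : ℝ} (hs : s ∈ Icc 0 γ.L) :
    HasDerivWithinAt γ.r (derivWithin γ.r (Icc 0 γ.L) s) (Icc 0 γ.L) s :=
  (γ.contDiffOn.differentiableOn (by norm_num) s hs).hasDerivWithinAt

lemma continuousOn_derivWithin : ContinuousOn (derivWithin γ.r (Icc 0 γ.L)) (Icc 0 γ.L) :=
  γ.contDiffOn.continuousOn_derivWithin (uniqueDiffOn_Icc γ.L_pos) le_rfl

lemma hasDerivAt_Ioo {s : ℝ} (hs : s ∈ Ioo 0 γ.L) :
    HasDerivAt γ.r (derivWithin γ.r (Icc 0 γ.L) s) s :=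
  (γ.hasDerivWithinAt (Ioo_subset_Icc_self hs)).hasDerivAt (Icc_mem_nhds hs.1 hs.2)

lemma exists_shift_mem_Ico (s : ℝ) : ∃ n : ℤ, s + n * γ.L ∈ Ico 0 γ.L := by
  refine ⟨-⌊s / γ.L⌋, ?_⟩
  have hL := γ.L_pos
  have h1 := Int.floor_le (s / γ.L)
  have h2 := Int.lt_floor_add_one (s / γ.L)
  rw [le_div_iff₀ hL] at h1
  rw [div_lt_iff₀ hL] at h2
  push_cast
  constructor <;> nlinarith

lemma r_add_int_mul (h : γ.IsClosedCurve) (n : ℤ) (s : ℝ) : γ.r (s + n * γ.L) = γ.r s :=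
  (γ.closed_periodic h).int_mul n s

lemma deriv_r_add_int_mul (h : γ.IsClosedCurve) (n : ℤ) (s : ℝ) :
    deriv γ.r (s + n * γ.L) = deriv γ.r s := by
  rw [← deriv_comp_add_const]
  congr 1
  ext1 t; exact γ.r_add_int_mul h n t

/-- A closed curve is `C¹` across its base point. -/
lemma exists_hasDerivAt_of_closed (h : γ.IsClosedCurve) : ∃ g : ℝ → Plane,
    ContinuousOn g (Ioo (-γ.L) γ.L) ∧ ∀ s ∈ Ioo (-γ.L) γ.L, HasDerivAt γ.r (g s) s ∧ ‖g s‖ = 1 := by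
  have hL := γ.L_pos
  set f := derivWithin γ.r (Icc 0 γ.L) with hf
  have hf0 : f 0 = f γ.L := γ.closed_deriv h
  -- The one-sided derivative on [0, L] is glued to its translate on [−L, 0]; they match at 0 by
  -- `closed_deriv`.
  set g : ℝ → Plane := fun s => if 0 ≤ s then f s else f (s + γ.L) with hg
  have hg1 : ∀ s ∈ Icc 0 γ.L, g s = f s := fun s hs => by simp [hg, hs.1]
  have hg2 : ∀ s ∈ Icc (-γ.L) 0, g s = f (s + γ.L) := fun s hs => by
    rcases hs.2.eq_or_lt with rfl | h0
    · simp [hg, hf0]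
    · simp [hg, not_le.2 h0]
  have hmaps : MapsTo (fun s => s + γ.L) (Icc (-γ.L) 0) (Icc 0 γ.L) := fun s hs =>
    ⟨by linarith [hs.1], by linarith [hs.2]⟩
  have hd1 : ∀ s ∈ Icc 0 γ.L, HasDerivWithinAt γ.r (g s) (Icc 0 γ.L) s := fun s hs => by
    rw [hg1 s hs]; exact γ.hasDerivWithinAt hs
  have hd2 : ∀ s ∈ Icc (-γ.L) 0, HasDerivWithinAt γ.r (g s) (Icc (-γ.L) 0) s := fun s hs => by
    rw [hg2 s hs]
    have h1 := (γ.hasDerivWithinAt (hmaps hs)).scomp s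
      ((hasDerivAt_id s).add_const γ.L).hasDerivWithinAt hmaps
    rw [one_smul] at h1
    refine h1.congr_of_mem (fun t _ => ?_) hs
    exact (γ.closed_periodic h t).symm
  refine ⟨g, ?_, fun s hs => ⟨?_, ?_⟩⟩
  · have hc1 : ContinuousOn g (Icc 0 γ.L) := γ.continuousOn_derivWithin.congr hg1
    have hc2 : ContinuousOn g (Icc (-γ.L) 0) :=
      (γ.continuousOn_derivWithin.comp (by fun_prop) hmaps).congr hg2
    refine (hc2.union_of_isClosed hc1 isClosed_Icc isClosed_Icc).mono fun s hs => ?_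
    rcases le_total s 0 with h0 | h0
    · exact Or.inl ⟨hs.1.le, h0⟩
    · exact Or.inr ⟨h0, hs.2.le⟩
  · rcases lt_trichotomy s 0 with h0 | rfl | h0
    · exact (hd2 s ⟨hs.1.le, h0.le⟩).hasDerivAt (Icc_mem_nhds hs.1 h0)
    · refine ((hd2 0 ⟨hs.1.le, le_rfl⟩).union (hd1 0 ⟨le_rfl, hs.2.le⟩)).hasDerivAt ?_
      rw [Icc_union_Icc_eq_Icc (by linarith) hL.le]
      exact Icc_mem_nhds hs.1 hs.2
    · exact (hd1 s ⟨h0.le, hs.2.le⟩).hasDerivAt (Icc_mem_nhds h0 hs.2)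
  · rcases le_total s 0 with h0 | h0
    · rw [hg2 s ⟨hs.1.le, h0⟩]
      exact γ.unit_speed _ (hmaps ⟨hs.1.le, h0⟩)
    · rw [hg1 s ⟨h0, hs.2.le⟩]
      exact γ.unit_speed _ ⟨h0, hs.2.le⟩

/-- For a closed curve the window (−L, L) has the base point in its interior, and every parameter is
moved into it by a multiple of the period. -/
lemma contDiffOn_dom : ContDiffOn ℝ 1 γ.r γ.dom := by
  by_cases h : γ.IsClosedCurve
  · obtain ⟨g, hgc, hg⟩ := γ.exists_hasDerivAt_of_closed h
    have h1 : ContDiffOn ℝ 1 γ.r (Ioo (-γ.L) γ.L) := by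
      have := contDiffOn_succ_iff_deriv_of_isOpen (𝕜 := ℝ) (n := 0) (f := γ.r)
        (isOpen_Ioo (a := -γ.L) (b := γ.L))
      rw [zero_add] at this
      refine this.2 ⟨fun s hs => (hg s hs).1.differentiableAt.differentiableWithinAt, by simp, ?_⟩
      rw [contDiffOn_zero]
      exact hgc.congr fun s hs => (hg s hs).1.deriv
    intro s _
    obtain ⟨n, hn⟩ := γ.exists_shift_mem_Ico s
    have h2 : ContDiffAt ℝ 1 γ.r (s + n * γ.L) := h1.contDiffAt
      (Ioo_mem_nhds (by linarith [hn.1, γ.L_pos]) hn.2)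
    have h3 : ContDiffAt ℝ 1 (fun t => γ.r (t + n * γ.L)) s :=
      ContDiffAt.comp s h2 (contDiffAt_id.add contDiffAt_const)
    have h4 : (fun t => γ.r (t + n * γ.L)) = γ.r := by ext1 t; exact γ.r_add_int_mul h n t
    rw [h4] at h3
    exact h3.contDiffWithinAt
  · rw [γ.dom_eq_Ioo h]
    exact γ.contDiffOn.mono Ioo_subset_Icc_self

lemma contDiffAt {s : ℝ} (hs : s ∈ γ.dom) : ContDiffAt ℝ 1 γ.r s :=
  γ.contDiffOn_dom.contDiffAt (γ.isOpen_dom.mem_nhds hs)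

lemma hasDerivAt {s : ℝ} (hs : s ∈ γ.dom) : HasDerivAt γ.r (deriv γ.r s) s :=
  ((γ.contDiffAt hs).differentiableAt (by norm_num)).hasDerivAt

lemma continuousOn_deriv : ContinuousOn (deriv γ.r) γ.dom :=
  γ.contDiffOn_dom.continuousOn_deriv_of_isOpen γ.isOpen_dom le_rfl

lemma norm_deriv {s : ℝ} (hs : s ∈ γ.dom) : ‖deriv γ.r s‖ = 1 := by
  by_cases h : γ.IsClosedCurve
  · obtain ⟨g, -, hg⟩ := γ.exists_hasDerivAt_of_closed h
    obtain ⟨n, hn⟩ := γ.exists_shift_mem_Ico s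
    obtain ⟨h1, h2⟩ := hg _ (⟨by linarith [hn.1, γ.L_pos], hn.2⟩ : s + n * γ.L ∈ Ioo (-γ.L) γ.L)
    rw [← γ.deriv_r_add_int_mul h n, h1.deriv, h2]
  · rw [γ.dom_eq_Ioo h] at hs
    rw [(γ.hasDerivAt_Ioo hs).deriv, γ.unit_speed s (Ioo_subset_Icc_self hs)]

lemma continuousOn_r_dom : ContinuousOn γ.r γ.dom := γ.contDiffOn_dom.continuousOn

lemma r_mem_innerPart {s : ℝ} (hs : s ∈ γ.dom) : γ.r s ∈ γ.innerPart := by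
  by_cases h : γ.IsClosedCurve
  · obtain ⟨n, hn⟩ := γ.exists_shift_mem_Ico s
    exact ⟨⟨_, Ico_subset_Icc_self hn, γ.r_add_int_mul h n s⟩, Or.inl h⟩
  · rw [γ.dom_eq_Ioo h] at hs
    refine ⟨⟨s, Ioo_subset_Icc_self hs, rfl⟩, Or.inr ⟨fun h0 => ?_, fun h0 => ?_⟩⟩
    · have := γ.simple 0 ⟨le_rfl, γ.L_pos.le⟩ s (Ioo_subset_Icc_self hs) hs.1 h0.symm
      exact hs.2.ne this.2
    · have := γ.simple s (Ioo_subset_Icc_self hs) γ.L ⟨γ.L_pos.le, le_rfl⟩ hs.2 h0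
      exact hs.1.ne' this.1

lemma innerPart_subset_trace : γ.innerPart ⊆ γ.trace := fun _ hx => hx.1

lemma exists_of_mem_innerPart {x : Plane} (hx : x ∈ γ.innerPart) :
    ∃ s ∈ γ.dom, s ∈ Ico 0 γ.L ∧ γ.r s = x := by
  obtain ⟨⟨s, hs, rfl⟩, h⟩ := hx
  rcases h with h | h
  · rcases hs.2.eq_or_lt with rfl | h1
    · exact ⟨0, by rw [γ.dom_eq_univ h]; trivial, ⟨le_rfl, γ.L_pos⟩, h⟩
    · exact ⟨s, by rw [γ.dom_eq_univ h]; trivial, ⟨hs.1, h1⟩, rfl⟩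
  · have h0 : 0 ≠ s := fun h' => h.1 (by rw [h'])
    have h1 : s ≠ γ.L := fun h' => h.2 (by rw [h'])
    have h2 := lt_of_le_of_ne hs.1 h0
    have h3 := lt_of_le_of_ne hs.2 h1
    exact ⟨s, γ.Ioo_subset_dom ⟨h2, h3⟩, ⟨hs.1, h3⟩, rfl⟩

lemma injOn_Ioo : InjOn γ.r (Ioo 0 γ.L) := by
  intro s hs t ht hst
  rcases lt_trichotomy s t with h | h | h
  · exact absurd (γ.simple s (Ioo_subset_Icc_self hs) t (Ioo_subset_Icc_self ht) h hst).1 hs.1.ne'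
  · exact h
  · exact absurd (γ.simple t (Ioo_subset_Icc_self ht) s (Ioo_subset_Icc_self hs) h hst.symm).1
      ht.1.ne'

lemma isCompact_trace : IsCompact γ.trace := isCompact_Icc.image_of_continuousOn
  γ.contDiffOn.continuousOn

lemma innerPart_eq_of_not_closed (h : ¬ γ.IsClosedCurve) :
    γ.innerPart = γ.trace \ {γ.r 0, γ.r γ.L} := by
  ext x
  simp only [innerPart, h, false_or, mem_ofPred_eq, Set.mem_sdiff, mem_insert_iff,
    mem_singleton_iff, not_or, ne_eq]

lemma innerPart_eq_of_closed (h : γ.IsClosedCurve) : γ.innerPart = γ.trace := by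
  ext x
  simp [innerPart, h]

lemma measurableSet_innerPart : MeasurableSet γ.innerPart := by
  by_cases h : γ.IsClosedCurve
  · rw [γ.innerPart_eq_of_closed h]; exact γ.isCompact_trace.measurableSet
  · rw [γ.innerPart_eq_of_not_closed h]
    exact γ.isCompact_trace.measurableSet.diff (Set.toFinite _).measurableSet

lemma aemeasurable_r : AEMeasurable γ.r γ.ds :=
  (γ.contDiffOn.continuousOn.mono Ioo_subset_Icc_self).aemeasurable measurableSet_Ioo

instance : IsFiniteMeasure γ.ds := by unfold ds; infer_instance

/-- Arc length is dominated by a multiple of the Hausdorff measure on the curve. -/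
lemma exists_map_ds_le : ∃ C : ℝ≥0, γ.ds.map γ.r ≤ C • (μH[1].restrict γ.trace : Measure Plane) := by
  have hL := γ.L_pos
  set f := derivWithin γ.r (Icc 0 γ.L) with hf
  have huc := isCompact_Icc.uniformContinuousOn_of_continuous γ.continuousOn_derivWithin
  rw [Metric.uniformContinuousOn_iff] at huc
  obtain ⟨δ, hδ, huc⟩ := huc (1 / 2) (by norm_num)
  -- On parameter distances below δ the velocity varies by at most 1/2, so r differs from a unit
  -- speed line by a 1/2-Lipschitz error, and chords are at least half as long as arcs.
  have key : ∀ s ∈ Icc 0 γ.L, ∀ t ∈ Icc 0 γ.L, |s - t| < δ →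
      dist s t ≤ 2 * dist (γ.r s) (γ.r t) := by
    intro s hs t ht hst
    have hconv : Convex ℝ (Icc 0 γ.L ∩ Metric.ball t δ) :=
      (convex_Icc _ _).inter (convex_ball _ _)
    have hb := hconv.norm_image_sub_le_of_norm_hasDerivWithin_le
      (f := fun s => γ.r s - s • f t) (f' := fun s => f s - f t) (C := 1 / 2)
      (x := t) (y := s) (fun x hx => by
        have h1 := (γ.hasDerivWithinAt hx.1).mono (inter_subset_left (t := Metric.ball t δ))
        have h2 := ((hasDerivAt_id x).smul_const (f t)).hasDerivWithinAt
          (s := Icc 0 γ.L ∩ Metric.ball t δ)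
        rw [one_smul] at h2
        exact h1.sub h2) (fun x hx => by
          rw [← dist_eq_norm]
          exact (huc x hx.1 t ht hx.2).le) ⟨ht, Metric.mem_ball_self hδ⟩
        ⟨hs, by rwa [Metric.mem_ball, Real.dist_eq]⟩
    have h3 : ‖(s - t) • f t‖ = |s - t| := by
      rw [norm_smul, γ.unit_speed t ht, mul_one, Real.norm_eq_abs]
    have h4 : (s - t) • f t = (γ.r s - γ.r t) - ((γ.r s - s • f t) - (γ.r t - t • f t)) := by
      module
    have h5 := norm_sub_le (γ.r s - γ.r t) ((γ.r s - s • f t) - (γ.r t - t • f t))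
    rw [← h4, h3] at h5
    rw [Real.dist_eq, dist_eq_norm]
    rw [Real.norm_eq_abs] at hb
    linarith
  -- On a short piece the inverse of r is 2-Lipschitz, which bounds the parameter measure by twice
  -- the Hausdorff measure.
  have hpiece : ∀ S : Set ℝ, S ⊆ Icc 0 γ.L → (∀ s ∈ S, ∀ t ∈ S, |s - t| < δ) →
      volume S ≤ 2 * μH[1] (γ.r '' S) := by
    intro S hS hSd
    rcases S.eq_empty_or_nonempty with rfl | hne
    · simp
    have hinj : InjOn γ.r S := fun s hs t ht hst => by
      have := key s (hS hs) t (hS ht) (hSd s hs t ht)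
      rw [hst, dist_self, mul_zero] at this
      exact dist_le_zero.1 this
    have hlip : LipschitzOnWith 2 (Function.invFunOn γ.r S) (γ.r '' S) := by
      refine LipschitzOnWith.of_dist_le_mul ?_
      rintro _ ⟨s, hs, rfl⟩ _ ⟨t, ht, rfl⟩
      rw [hinj.leftInvOn_invFunOn hs, hinj.leftInvOn_invFunOn ht]
      exact key s (hS hs) t (hS ht) (hSd s hs t ht)
    have := hlip.hausdorffMeasure_image_le (d := 1) zero_le_one
    rw [hinj.leftInvOn_invFunOn.image_image, hausdorffMeasure_real] at this
    simpa using this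
  obtain ⟨n, hn⟩ := exists_nat_gt (γ.L / δ)
  rw [div_lt_iff₀ hδ] at hn
  have hn0 : 0 < n := by
    rcases Nat.eq_zero_or_pos n with h | h
    · subst h; simp at hn; linarith
    · exact h
  -- There are n pieces of length L/n < δ, each contributing at most twice the measure of the whole
  -- set.
  refine ⟨n * 2, Measure.le_iff.2 fun A hA => ?_⟩
  rw [Measure.map_apply_of_aemeasurable γ.aemeasurable_r hA, ds]
  have hm : NullMeasurableSet (γ.r ⁻¹' A) (volume.restrict (Ioo 0 γ.L)) :=
    γ.aemeasurable_r.nullMeasurable hA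
  rw [Measure.restrict_apply₀ hm, Measure.smul_apply, Measure.restrict_apply hA]
  set ε := γ.L / n with hε
  have hn0' : (0 : ℝ) < n := by exact_mod_cast hn0
  have hεδ : ε < δ := by rw [hε, div_lt_iff₀ hn0']; linarith
  have hε0 : 0 < ε := by positivity
  have hcov : γ.r ⁻¹' A ∩ Ioo 0 γ.L ⊆ ⋃ k ∈ Finset.range n,
      (γ.r ⁻¹' A ∩ Ioo 0 γ.L ∩ Ico (k * ε) ((k + 1) * ε)) := by
    intro s hs
    simp only [mem_iUnion, Finset.mem_range]
    have hs0 : 0 ≤ s / ε := div_nonneg hs.2.1.le hε0.le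
    refine ⟨⌊s / ε⌋₊, ?_, hs, ?_, ?_⟩
    · rw [Nat.floor_lt hs0, div_lt_iff₀ hε0, hε, mul_div_cancel₀ _ hn0'.ne']
      exact hs.2.2
    · rw [← le_div_iff₀ hε0]; exact Nat.floor_le hs0
    · rw [← div_lt_iff₀ hε0]; exact Nat.lt_floor_add_one _
  calc volume (γ.r ⁻¹' A ∩ Ioo 0 γ.L)
      ≤ ∑ k ∈ Finset.range n, volume (γ.r ⁻¹' A ∩ Ioo 0 γ.L ∩ Ico (k * ε) ((k + 1) * ε)) :=
        (measure_mono hcov).trans (measure_biUnion_finset_le _ _)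
    _ ≤ ∑ k ∈ Finset.range n, 2 * μH[1] (A ∩ γ.trace) := by
        refine Finset.sum_le_sum fun k _ => (hpiece _ ?_ ?_).trans ?_
        · exact fun s hs => Ioo_subset_Icc_self hs.1.2
        · intro s hs t ht
          rw [abs_lt]
          constructor <;> nlinarith [hs.2.1, hs.2.2, ht.2.1, ht.2.2]
        · gcongr
          rintro _ ⟨s, hs, rfl⟩
          exact ⟨hs.1.1, s, Ioo_subset_Icc_self hs.1.2, rfl⟩
    _ = _ := by
        rw [Finset.sum_const, Finset.card_range, nsmul_eq_mul, ← mul_assoc, ENNReal.smul_def]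
        simp

end PlaneCurve

end Ventcel

namespace Ventcel

/-! ### Analysis on an interval -/

/-- A function on a bounded interval which is bounded, up to its values outside, is in every `L^p`. -/
lemma memLp_of_bounded_on {α E : Type*} [MeasurableSpace α] [NormedAddCommGroup E] {μ : Measure α}
    {S : Set α} (hS : MeasurableSet S) (hμ : μ S ≠ ⊤) {p : ℝ≥0∞} {f : α → E} {C : ℝ}
    (hf : AEStronglyMeasurable f (μ.restrict S)) (hC : ∀ x ∈ S, ‖f x‖ ≤ C) :
    MemLp f p (μ.restrict S) := by
  have : IsFiniteMeasure (μ.restrict S) := ⟨by rw [Measure.restrict_apply_univ]; exact hμ.lt_top⟩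
  exact MemLp.of_bound hf C ((ae_restrict_iff' hS).2 (Eventually.of_forall hC))

/-- Du Bois-Reymond: a continuous function whose weak derivative is continuous is differentiable. -/
lemma hasDerivAt_of_weak {a b : ℝ} {F c : ℝ → ℝ} (hF : ContinuousOn F (Ioo a b))
    (hc : ContinuousOn c (Ioo a b))
    (h : ∀ η : ℝ → ℝ, ContDiff ℝ 1 η → HasCompactSupport η → tsupport η ⊆ Ioo a b →
      ∫ s in Ioo a b, (F s * deriv η s + c s * η s) = 0) {s : ℝ} (hs : s ∈ Ioo a b) :
    HasDerivAt F (c s) s := by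
  -- an antiderivative of `c`
  have hab : a < b := hs.1.trans hs.2
  set Cc : ℝ → ℝ := fun x => ∫ t in s..x, c t with hCc
  have hcint : ∀ x ∈ Ioo a b, IntervalIntegrable c volume s x := fun x hx =>
    (hc.mono (by
      intro t ht
      rcases mem_uIcc.1 ht with h1 | h1
      · exact ⟨hs.1.trans_le h1.1, h1.2.trans_lt hx.2⟩
      · exact ⟨hx.1.trans_le h1.1, h1.2.trans_lt hs.2⟩)).intervalIntegrable
  have hCd : ∀ x ∈ Ioo a b, HasDerivAt Cc (c x) x := fun x hx =>
    intervalIntegral.integral_hasDerivAt_right (hcint x hx)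
      (hc.stronglyMeasurableAtFilter isOpen_Ioo x hx) (hc.continuousAt (isOpen_Ioo.mem_nhds hx))
  have hCcont : ContinuousOn Cc (Ioo a b) := fun x hx =>
    (hCd x hx).continuousAt.continuousWithinAt
  -- `D` has weak derivative zero; the rest of the proof shows that it is a constant.
  set D : ℝ → ℝ := fun x => F x - Cc x with hD
  have hDcont : ContinuousOn D (Ioo a b) := hF.sub hCcont
  -- integrability of products with compactly supported functions
  have hintg : ∀ A η : ℝ → ℝ, ContinuousOn A (Ioo a b) → Continuous η → HasCompactSupport η →
      tsupport η ⊆ Ioo a b → Continuous fun x => A x * η x := by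
    intro A η hA hη hηc hηs
    rw [continuous_iff_continuousAt]
    intro x
    by_cases hx : x ∈ tsupport η
    · exact ((hA.continuousAt (isOpen_Ioo.mem_nhds (hηs hx))).mul hη.continuousAt)
    · have h1 : (fun x => A x * η x) =ᶠ[𝓝 x] fun _ => 0 := by
        filter_upwards [(isClosed_tsupport η).isOpen_compl.mem_nhds hx] with y hy
        rw [image_eq_zero_of_notMem_tsupport hy, mul_zero]
      exact continuousAt_const.congr h1.symm
  have hintg' : ∀ A η : ℝ → ℝ, ContinuousOn A (Ioo a b) → Continuous η → HasCompactSupport η →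
      tsupport η ⊆ Ioo a b → Integrable fun x => A x * η x := fun A η hA hη hηc hηs =>
    (hintg A η hA hη hηc hηs).integrable_of_hasCompactSupport hηc.mul_left
  have hset : ∀ A η : ℝ → ℝ, tsupport η ⊆ Ioo a b →
      ∫ x in Ioo a b, A x * η x = ∫ x, A x * η x := fun A η hηs =>
    setIntegral_eq_integral_of_forall_compl_eq_zero fun x hx => by
      rw [image_eq_zero_of_notMem_tsupport fun h' => hx (hηs h'), mul_zero]
  have hD0 : ∀ η : ℝ → ℝ, ContDiff ℝ 1 η → HasCompactSupport η → tsupport η ⊆ Ioo a b →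
      ∫ x, D x * deriv η x = 0 := by
    intro η hη hηc hηs
    have hη' : tsupport (deriv η) ⊆ Ioo a b := (tsupport_deriv_subset).trans hηs
    have hηd : Continuous (deriv η) := hη.continuous_deriv le_rfl
    have h1 := h η hη hηc hηs
    rw [integral_add (hintg' F _ hF hηd hηc.deriv hη').integrableOn
      (hintg' c η hc hη.continuous hηc hηs).integrableOn, hset F _ hη', hset c _ hηs] at h1
    have h2 : ∫ x, (Cc x * deriv η x + c x * η x) = 0 := by
      have hd : ∀ x, HasDerivAt (fun x => Cc x * η x) (Cc x * deriv η x + c x * η x) x := by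
        intro x
        by_cases hx : x ∈ tsupport η
        · have := (hCd x (hηs hx)).mul ((hη.differentiable (by norm_num)) x).hasDerivAt
          rwa [add_comm] at this
        · have h3 : (fun x => Cc x * η x) =ᶠ[𝓝 x] fun _ => 0 := by
            filter_upwards [(isClosed_tsupport η).isOpen_compl.mem_nhds hx] with y hy
            rw [image_eq_zero_of_notMem_tsupport hy, mul_zero]
          rw [image_eq_zero_of_notMem_tsupport hx,
            image_eq_zero_of_notMem_tsupport fun h' => hx (tsupport_deriv_subset h')]
          simpa using (hasDerivAt_const x (0 : ℝ)).congr_of_eventuallyEq h3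
      exact integral_eq_zero_of_hasDerivAt_of_integrable hd
        ((hintg' Cc _ hCcont hηd hηc.deriv hη').add (hintg' c η hc hη.continuous hηc hηs))
        (hintg' Cc η hCcont hη.continuous hηc hηs)
    rw [integral_add (hintg' Cc _ hCcont hηd hηc.deriv hη')
      (hintg' c η hc hη.continuous hηc hηs)] at h2
    have h3 : ∫ x, D x * deriv η x = (∫ x, F x * deriv η x) - ∫ x, Cc x * deriv η x := by
      rw [← integral_sub (hintg' F _ hF hηd hηc.deriv hη')
        (hintg' Cc _ hCcont hηd hηc.deriv hη')]
      exact integral_congr_ae (Eventually.of_forall fun x => by simp only [hD]; ring)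
    linarith
  -- a fixed bump function of integral one
  obtain ⟨ρ, hρs, hρc, hρd, hρr, hρ1⟩ := exists_contDiff_tsupport_subset (n := 1)
    (isOpen_Ioo.mem_nhds hs : Ioo a b ∈ 𝓝 s)
  have hρpos : 0 < ∫ x, ρ x := hρd.continuous.integral_pos_of_hasCompactSupport_nonneg_nonzero hρc
    (fun x => (hρr ⟨x, rfl⟩).1) (x := s) (by simp [hρ1])
  -- A compactly supported continuous function of integral zero is the derivative of a compactly
  -- supported C¹ function, hence orthogonal to `D`.
  have hprim : ∀ ζ : ℝ → ℝ, Continuous ζ → HasCompactSupport ζ → tsupport ζ ⊆ Ioo a b →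
      ∫ x, ζ x = 0 → ∫ x, D x * ζ x = 0 := by
    intro ζ hζ hζc hζs hζ0
    set η : ℝ → ℝ := fun x => ∫ t in a..x, ζ t with hη
    have hηd : ∀ x, HasDerivAt η (ζ x) x := fun x => hζ.integral_hasStrictDerivAt a x |>.hasDerivAt
    have hηd' : deriv η = ζ := funext fun x => (hηd x).deriv
    have hηC : ContDiff ℝ 1 η := by
      rw [contDiff_one_iff_deriv]
      exact ⟨fun x => (hηd x).differentiableAt, by rwa [hηd']⟩
    -- Inserting s keeps the set nonempty, so that it has a least and a greatest element even if ζ =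
    -- 0.
    have hK : IsCompact (insert s (tsupport ζ)) := hζc.insert s
    have hKs : insert s (tsupport ζ) ⊆ Ioo a b := insert_subset hs hζs
    obtain ⟨a', ha', ha'l⟩ := hK.exists_isLeast ⟨s, mem_insert _ _⟩
    obtain ⟨b', hb', hb'l⟩ := hK.exists_isGreatest ⟨s, mem_insert _ _⟩
    have hζz : ∀ x, x ∉ Icc a' b' → ζ x = 0 := fun x hx =>
      image_eq_zero_of_notMem_tsupport fun h' =>
        hx ⟨ha'l (mem_insert_of_mem _ h'), hb'l (mem_insert_of_mem _ h')⟩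
    have hηz : ∀ x, x ∉ Icc a' b' → η x = 0 := by
      intro x hx
      rcases lt_or_ge x a' with h1 | h1
      · refine intervalIntegral.integral_zero_ae (Eventually.of_forall fun t ht => hζz t ?_)
        rcases mem_uIoc.1 ht with h2 | h2
        · exact fun h3 => absurd h3.1 (by linarith [h2.2])
        · exact fun h3 => absurd h3.1 (by linarith [h2.2, (hKs ha').1])
      · have h2 : b' < x := by
          by_contra h3; exact hx ⟨h1, not_lt.1 h3⟩
        rw [← hζ0]
        refine intervalIntegral.integral_eq_integral_of_support_subset fun t ht => ?_
        have h3 : t ∈ Icc a' b' := by by_contra h4; exact ht (hζz t h4)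
        exact ⟨(hKs ha').1.trans_le h3.1, h3.2.trans h2.le⟩
    have hηs : tsupport η ⊆ Icc a' b' := closure_minimal
      (fun x hx => by by_contra h4; exact hx (hηz x h4)) isClosed_Icc
    have := hD0 η hηC (isCompact_Icc.of_isClosed_subset (isClosed_tsupport η) hηs)
      (hηs.trans fun x hx => ⟨(hKs ha').1.trans_le hx.1, hx.2.trans_lt (hKs hb').2⟩)
    rwa [hηd'] at this
  -- The only possible value of the constant: the mean of `D` with weight ρ.
  set c₀ : ℝ := (∫ x, D x * ρ x) / ∫ x, ρ x with hc₀
  have hloc : LocallyIntegrableOn (fun x => D x - c₀) (Ioo a b) volume :=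
    (hDcont.sub continuousOn_const).locallyIntegrableOn measurableSet_Ioo
  have hae := isOpen_Ioo.ae_eq_zero_of_integral_contDiff_smul_eq_zero (E := ℝ) hloc ?_
  · have h1 : (fun x => D x - c₀) =ᵐ[volume.restrict (Ioo a b)] fun _ => 0 :=
      (ae_restrict_iff' measurableSet_Ioo).2 hae
    have h2 := Measure.eqOn_open_of_ae_eq h1 isOpen_Ioo (hDcont.sub continuousOn_const)
      continuousOn_const
    refine ((hCd s hs).add_const c₀).congr_of_eventuallyEq ?_
    filter_upwards [isOpen_Ioo.mem_nhds hs] with x hx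
    have := h2 hx
    simp only [hD] at this
    linarith
  · intro ξ hξ hξc hξs
    have hρi : Integrable ρ := hρd.continuous.integrable_of_hasCompactSupport hρc
    have hξi : Integrable ξ := hξ.continuous.integrable_of_hasCompactSupport hξc
    -- With this multiple of ρ subtracted, ξ has integral zero and `hprim` applies.
    set k : ℝ := (∫ x, ξ x) / ∫ x, ρ x with hk
    have hζs : tsupport (fun x => ξ x - k * ρ x) ⊆ tsupport ξ ∪ tsupport ρ := by
      refine closure_minimal (fun x hx => ?_) ((isClosed_tsupport _).union (isClosed_tsupport _))
      by_contra h4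
      rw [mem_union, not_or] at h4
      refine hx ?_
      simp only
      rw [image_eq_zero_of_notMem_tsupport h4.1, image_eq_zero_of_notMem_tsupport h4.2]
      simp
    have h1 := hprim (fun x => ξ x - k * ρ x)
      (hξ.continuous.sub (continuous_const.mul hρd.continuous))
      ((hξc.isCompact.union hρc.isCompact).of_isClosed_subset (isClosed_tsupport _) hζs)
      (hζs.trans (union_subset hξs hρs)) (by
        rw [integral_sub hξi (hρi.const_mul k), integral_const_mul, hk,
          div_mul_cancel₀ _ hρpos.ne', sub_self])
    have hi1 := hintg' D ξ hDcont hξ.continuous hξc hξs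
    have hi2 := hintg' D ρ hDcont hρd.continuous hρc hρs
    have h2 : ∫ x, D x * (ξ x - k * ρ x) = (∫ x, D x * ξ x) - k * ∫ x, D x * ρ x := by
      rw [← integral_const_mul, ← integral_sub hi1 (hi2.const_mul k)]
      exact integral_congr_ae (Eventually.of_forall fun x => by simp only; ring)
    have h3 : ∫ x, ξ x • (D x - c₀) = (∫ x, D x * ξ x) - c₀ * ∫ x, ξ x := by
      rw [← integral_const_mul, ← integral_sub hi1 (hξi.const_mul c₀)]
      exact integral_congr_ae (Eventually.of_forall fun x => by simp only [smul_eq_mul]; ring)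
    rw [h3, ← h1, h2, hk, hc₀]
    ring

namespace PlaneCurve

variable (γ : PlaneCurve)

/-- Integration by parts on a curve. -/
lemma integral_mul_test {b b' η : ℝ → ℝ} (hb : ∀ s ∈ γ.dom, HasDerivAt b (b' s) s)
    (hper : γ.IsClosedCurve → b γ.L = b 0) (hη : γ.IsTest η)
    (hint : Integrable (fun s => b s * deriv η s + b' s * η s) γ.ds) :
    ∫ s, (b s * deriv η s + b' s * η s) ∂γ.ds = 0 := by
  have hd : ∀ s, HasDerivAt (fun s => b s * η s) (b s * deriv η s + b' s * η s) s := by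
    intro s
    by_cases hs : s ∈ γ.dom
    · have := (hb s hs).mul ((hη.1.differentiable (by norm_num)) s).hasDerivAt
      rwa [add_comm] at this
    · have hnc : ¬ γ.IsClosedCurve := fun h => hs (Or.inl h)
      rw [γ.dom_eq_Ioo hnc] at hs
      have hs' : s ∉ tsupport η := fun h => hs ((hη.2.2 hnc).2 h)
      have h3 : (fun x => b x * η x) =ᶠ[𝓝 s] fun _ => 0 := by
        filter_upwards [(isClosed_tsupport η).isOpen_compl.mem_nhds hs'] with y hy
        rw [image_eq_zero_of_notMem_tsupport hy, mul_zero]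
      rw [image_eq_zero_of_notMem_tsupport hs',
        image_eq_zero_of_notMem_tsupport fun h' => hs' (tsupport_deriv_subset h')]
      simpa using (hasDerivAt_const s (0 : ℝ)).congr_of_eventuallyEq h3
  rw [ds, ← integral_Ioc_eq_integral_Ioo, ← intervalIntegral.integral_of_le γ.L_pos.le,
    intervalIntegral.integral_eq_sub_of_hasDerivAt (fun s _ => hd s)]
  -- The boundary terms cancel by periodicity on a closed curve and vanish separately on an open
  -- one.
  · by_cases h : γ.IsClosedCurve
    · have := (hη.2.1 h) 0
      rw [zero_add] at this
      rw [hper h, this, sub_self]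
    · have h0 : η 0 = 0 := image_eq_zero_of_notMem_tsupport fun h' =>
        lt_irrefl _ ((hη.2.2 h).2 h').1
      have h1 : η γ.L = 0 := image_eq_zero_of_notMem_tsupport fun h' =>
        lt_irrefl _ ((hη.2.2 h).2 h').2
      simp [h0, h1]
  · rw [intervalIntegrable_iff_integrableOn_Ioo_of_le γ.L_pos.le]
    exact hint

/-- A `C¹` function supported in `(0, L)` agrees on `(0, L)` with a test function. -/
lemma exists_test_eqOn {η : ℝ → ℝ} (hη : ContDiff ℝ 1 η) (hs : tsupport η ⊆ Ioo 0 γ.L) :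
    ∃ θ, γ.IsTest θ ∧ EqOn θ η (Ioo 0 γ.L) := by
  by_cases h : γ.IsClosedCurve
  · have hL := γ.L_pos
    -- The periodic extension of η from [0, L). It is C¹ across multiples of L because η vanishes
    -- near 0 and near L.
    set θ : ℝ → ℝ := fun s => η (s - ⌊s / γ.L⌋ * γ.L) with hθ
    have hper : Function.Periodic θ γ.L := by
      intro s
      have : ⌊(s + γ.L) / γ.L⌋ = ⌊s / γ.L⌋ + 1 := by
        rw [add_div, div_self hL.ne', Int.floor_add_one]
      simp only [hθ, this]
      push_cast
      congr 1; ring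
    have heq : EqOn θ η (Ico 0 γ.L) := by
      intro s hs
      have : ⌊s / γ.L⌋ = 0 := by
        rw [Int.floor_eq_zero_iff]
        exact ⟨div_nonneg hs.1 hL.le, (div_lt_one hL).2 hs.2⟩
      simp [hθ, this]
    have hnear0 : ∀ᶠ s in 𝓝 (0 : ℝ), η s = 0 := by
      filter_upwards [(isClosed_tsupport η).isOpen_compl.mem_nhds
        (fun h' => lt_irrefl _ (hs h').1 : (0 : ℝ) ∉ tsupport η)] with y hy
      exact image_eq_zero_of_notMem_tsupport hy
    have hnearL : ∀ᶠ s in 𝓝 γ.L, η s = 0 := by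
      filter_upwards [(isClosed_tsupport η).isOpen_compl.mem_nhds
        (fun h' => lt_irrefl _ (hs h').2 : γ.L ∉ tsupport η)] with y hy
      exact image_eq_zero_of_notMem_tsupport hy
    have hθ0 : θ =ᶠ[𝓝 0] fun _ => 0 := by
      have h1 : ∀ᶠ s in 𝓝 (0 : ℝ), η (s + γ.L) = 0 := by
        have : Tendsto (fun s : ℝ => s + γ.L) (𝓝 0) (𝓝 γ.L) := by
          simpa using (continuous_id.add continuous_const).tendsto (0 : ℝ) (f := fun s => s + γ.L)
        exact this.eventually hnearL
      filter_upwards [hnear0, h1, Ioo_mem_nhds (neg_lt_zero.2 hL) hL] with s h2 h3 h4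
      rcases lt_or_ge s 0 with h5 | h5
      · rw [← hper s, heq ⟨by linarith [h4.1], by linarith⟩, h3]
      · rw [heq ⟨h5, h4.2⟩, h2]
    have hC : ∀ s ∈ Ico 0 γ.L, ContDiffAt ℝ 1 θ s := by
      intro s hs
      rcases hs.1.eq_or_lt with rfl | h0
      · exact contDiffAt_const.congr_of_eventuallyEq hθ0
      · refine hη.contDiffAt.congr_of_eventuallyEq ?_
        filter_upwards [Ioo_mem_nhds h0 hs.2] with t ht using heq (Ioo_subset_Ico_self ht)
    refine ⟨θ, ⟨contDiff_iff_contDiffAt.2 fun s => ?_, fun _ => hper, fun h' => absurd h h'⟩,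
      heq.mono Ioo_subset_Ico_self⟩
    obtain ⟨n, hn⟩ := γ.exists_shift_mem_Ico s
    have h3 : ContDiffAt ℝ 1 (fun t => θ (t + n * γ.L)) s :=
      ContDiffAt.comp (g := θ) s (hC _ hn) (contDiffAt_id.add contDiffAt_const)
    rwa [show (fun t => θ (t + n * γ.L)) = θ from funext fun t => (hper.int_mul n) t] at h3
  · refine ⟨η, ⟨hη, fun h' => absurd h' h, fun _ => ⟨?_, hs⟩⟩, fun _ _ => rfl⟩
    exact isCompact_Icc.of_isClosed_subset (isClosed_tsupport η) (hs.trans Ioo_subset_Icc_self)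

/-- Functions on a curve are determined by their integrals against test functions. -/
lemma ae_eq_of_integral_test {p q : ℝ → ℝ} (hp : Integrable p γ.ds) (hq : Integrable q γ.ds)
    (h : ∀ η, γ.IsTest η → ∫ s, p s * η s ∂γ.ds = ∫ s, q s * η s ∂γ.ds) : p =ᵐ[γ.ds] q := by
  have hloc : LocallyIntegrableOn (fun s => p s - q s) (Ioo 0 γ.L) volume :=
    IntegrableOn.locallyIntegrableOn (hp.sub hq)
  have key := isOpen_Ioo.ae_eq_zero_of_integral_contDiff_smul_eq_zero (E := ℝ) hloc ?_
  · rw [Filter.EventuallyEq, ds, ae_restrict_iff' measurableSet_Ioo]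
    filter_upwards [key] with s hs hs'
    exact sub_eq_zero.1 (hs hs')
  · intro ζ hζ hζc hζs
    obtain ⟨θ, hθ, heq⟩ := γ.exists_test_eqOn (hζ.of_le (by simp)) hζs
    obtain ⟨C, hC⟩ := isCompact_Icc.exists_bound_of_continuousOn
      (hθ.1.continuous.continuousOn (s := Icc 0 γ.L))
    have hb : ∀ᵐ s ∂γ.ds, ‖θ s‖ ≤ C := by
      rw [ds, ae_restrict_iff' measurableSet_Ioo]
      exact Eventually.of_forall fun s hs => hC s (Ioo_subset_Icc_self hs)
    have hi : ∀ a, Integrable a γ.ds → Integrable (fun s => a s * θ s) γ.ds := fun a ha =>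
      ha.mul_bdd hθ.1.continuous.aestronglyMeasurable hb
    have h1 := h θ hθ
    rw [← sub_eq_zero, ← integral_sub (hi p hp) (hi q hq)] at h1
    rw [← setIntegral_eq_integral_of_forall_compl_eq_zero (s := Ioo 0 γ.L) fun s hs => by
      rw [image_eq_zero_of_notMem_tsupport fun h' => hs (hζs h'), zero_smul]]
    refine Eq.trans ?_ h1
    refine setIntegral_congr_fun measurableSet_Ioo fun s hs => ?_
    simp only [smul_eq_mul, ← heq hs]
    ring

end PlaneCurve

end Ventcel

namespace Ventcel

/-! ### Boundary charts -/

/-- In the open bounded set `U`, the set `Ω` is the part above the graph of `h` in the frame `T`. -/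
structure GraphChart (Ω : Set Plane) (T : Plane ≃ₗᵢ[ℝ] Plane) (h : ℝ → ℝ) (K : ℝ≥0)
    (U : Set Plane) : Prop where
  lip : LipschitzWith K h
  isOpen : IsOpen U
  bounded : Bornology.IsBounded U
  mem_iff : ∀ x ∈ U, (x ∈ Ω ↔ h ((T x) 0) < (T x) 1)

lemma HasLipschitzBoundary.exists_chart {Ω : Set Plane} (hΩ : HasLipschitzBoundary Ω) {p : Plane}
    (hp : p ∈ frontier Ω) : ∃ T h K U, GraphChart Ω T h K U ∧ p ∈ U := by
  obtain ⟨T, h, K, δ, hh, hδ, hU⟩ := hΩ p hp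
  exact ⟨T, h, K, Metric.ball p δ, ⟨hh, Metric.isOpen_ball, Metric.isBounded_ball, hU⟩,
    Metric.mem_ball_self hδ⟩

/-- The parametrization of the graph of `h` by the first coordinate. -/
noncomputable def graphMap (T : Plane ≃ₗᵢ[ℝ] Plane) (h : ℝ → ℝ) (x : ℝ) : Plane :=
  shear T h (x, 0)

@[simp] lemma graphMap_coord_zero (T : Plane ≃ₗᵢ[ℝ] Plane) (h : ℝ → ℝ) (x : ℝ) :
    (T (graphMap T h x)) 0 = x := by simp [graphMap]

@[simp] lemma graphMap_coord_one (T : Plane ≃ₗᵢ[ℝ] Plane) (h : ℝ → ℝ) (x : ℝ) :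
    (T (graphMap T h x)) 1 = h x := by simp [graphMap]

lemma ext_coord (T : Plane ≃ₗᵢ[ℝ] Plane) {x y : Plane} (h0 : (T x) 0 = (T y) 0)
    (h1 : (T x) 1 = (T y) 1) : x = y := by
  rw [eq_frame_sum T x, eq_frame_sum T y, h0, h1]

lemma lipschitzWith_coord (T : Plane ≃ₗᵢ[ℝ] Plane) (i : Fin 2) :
    LipschitzWith 1 fun v : Plane => (T v) i := by
  refine LipschitzWith.of_dist_le_mul fun v w => ?_
  have := norm_coord_le T (v - w) i
  rw [map_sub] at this
  simpa [dist_eq_norm] using this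

/-- The measure of the first coordinate is dominated by the Hausdorff measure. -/
lemma volume_graphMap_preimage_le (T : Plane ≃ₗᵢ[ℝ] Plane) (h : ℝ → ℝ) (A : Set Plane) :
    volume (graphMap T h ⁻¹' A) ≤ μH[1] A := by
  have h1 := (lipschitzWith_coord T 0).hausdorffMeasure_image_le (d := 1) zero_le_one A
  rw [hausdorffMeasure_real] at h1
  simp only [ENNReal.coe_one, ENNReal.one_rpow, one_mul] at h1
  refine (measure_mono fun x hx => ?_).trans h1
  exact ⟨graphMap T h x, hx, graphMap_coord_zero T h x⟩

namespace GraphChart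

variable {Ω : Set Plane} {T : Plane ≃ₗᵢ[ℝ] Plane} {h : ℝ → ℝ} {K : ℝ≥0} {U : Set Plane}

lemma lipschitzWith_graphMap (H : GraphChart Ω T h K U) : LipschitzWith (1 + K) (graphMap T h) :=
  lipschitzWith_shear_fst T H.lip 0

lemma continuous_graphMap (H : GraphChart Ω T h K U) : Continuous (graphMap T h) :=
  H.lipschitzWith_graphMap.continuous

/-- Points strictly below the graph have a neighbourhood missing Ω; points on or above it are limits
of points of Ω obtained by moving upwards. -/
lemma mem_closure_iff (H : GraphChart Ω T h K U) {x : Plane} (hx : x ∈ U) :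
    x ∈ closure Ω ↔ h ((T x) 0) ≤ (T x) 1 := by
  have hc0 := H.lip.continuous.comp (continuous_coord T 0)
  have hc1 := continuous_coord T 1
  constructor
  · intro hcl
    by_contra hcon
    push Not at hcon
    have ho : IsOpen (U ∩ {y | (T y) 1 < h ((T y) 0)}) := H.isOpen.inter (isOpen_lt hc1 hc0)
    obtain ⟨y, ⟨hyU, hy⟩, hyΩ⟩ := mem_closure_iff_nhds.1 hcl _ (ho.mem_nhds ⟨hx, hcon⟩)
    exact lt_asymm hy ((H.mem_iff y hyU).1 hyΩ)
  · intro hle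
    have hcont : Continuous fun t : ℝ => shear T h ((T x) 0, (T x) 1 - h ((T x) 0) + t) :=
      (continuous_shear T H.lip.continuous).comp (by fun_prop)
    have h0 : shear T h ((T x) 0, (T x) 1 - h ((T x) 0) + 0) = x := by
      rw [add_zero]; exact shear_coord T h x
    have htend : Tendsto (fun t : ℝ => shear T h ((T x) 0, (T x) 1 - h ((T x) 0) + t)) (𝓝[>] 0)
        (𝓝 x) := by
      have := (hcont.tendsto 0).mono_left (nhdsWithin_le_nhds (s := Ioi 0))
      rwa [h0] at this
    refine mem_closure_of_tendsto htend ?_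
    filter_upwards [htend.eventually (H.isOpen.mem_nhds hx), self_mem_nhdsWithin] with t ht ht0
    rw [H.mem_iff _ ht, shear_coord_zero, shear_coord_one]
    have : (0 : ℝ) < t := ht0
    simp only
    linarith

lemma mem_frontier_iff (H : GraphChart Ω T h K U) (hΩ : IsOpen Ω) {x : Plane} (hx : x ∈ U) :
    x ∈ frontier Ω ↔ (T x) 1 = h ((T x) 0) := by
  rw [hΩ.frontier_eq, Set.mem_sdiff, H.mem_closure_iff hx, H.mem_iff x hx, not_lt]
  exact ⟨fun h => le_antisymm h.2 h.1, fun h => ⟨h.ge, h.le⟩⟩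

lemma graphMap_mem_frontier (H : GraphChart Ω T h K U) (hΩ : IsOpen Ω) {x : ℝ}
    (hx : graphMap T h x ∈ U) : graphMap T h x ∈ frontier Ω := by
  rw [H.mem_frontier_iff hΩ hx]; simp

lemma eq_graphMap (H : GraphChart Ω T h K U) (hΩ : IsOpen Ω) {x : Plane} (hx : x ∈ U)
    (hxf : x ∈ frontier Ω) : graphMap T h ((T x) 0) = x := by
  rw [H.mem_frontier_iff hΩ hx] at hxf
  exact ext_coord T (by simp) (by simp [hxf])

/-- The graph map is (1 + K)-Lipschitz. Together with `volume_graphMap_preimage_le` this makes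
boundary length and the coordinate measure comparable, which replaces an exact length formula
throughout. -/
lemma hausdorffMeasure_le (H : GraphChart Ω T h K U) (hΩ : IsOpen Ω) (A : Set Plane) :
    μH[1] (A ∩ (frontier Ω ∩ U)) ≤ (1 + K : ℝ≥0) * volume (graphMap T h ⁻¹' (A ∩ U)) := by
  have h1 := H.lipschitzWith_graphMap.hausdorffMeasure_image_le (d := 1) zero_le_one
    (graphMap T h ⁻¹' (A ∩ U))
  rw [hausdorffMeasure_real, ENNReal.rpow_one] at h1
  refine (measure_mono ?_).trans h1
  rintro x ⟨hxA, hxf, hxU⟩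
  refine ⟨(T x) 0, ?_, H.eq_graphMap hΩ hxU hxf⟩
  rw [mem_preimage, H.eq_graphMap hΩ hxU hxf]
  exact ⟨hxA, hxU⟩

lemma exists_bound (H : GraphChart Ω T h K U) :
    ∃ R > 0, U ⊆ Metric.ball 0 R ∧ graphMap T h ⁻¹' U ⊆ Ioo (-R) R := by
  obtain ⟨R, hR0, hR⟩ := H.bounded.subset_ball_lt 0 0
  refine ⟨R, hR0, hR, fun x hx => ?_⟩
  have h1 := norm_coord_le T (graphMap T h x) 0
  have h2 := hR hx
  rw [mem_ball_zero_iff] at h2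
  rw [graphMap_coord_zero] at h1
  exact abs_lt.1 (h1.trans_lt h2)

lemma volume_preimage_lt_top (H : GraphChart Ω T h K U) :
    volume (graphMap T h ⁻¹' U) < ⊤ := by
  obtain ⟨R, -, -, hR⟩ := H.exists_bound
  exact (measure_mono hR).trans_lt (by simp)

end GraphChart

lemma HasLipschitzBoundary.hausdorffMeasure_frontier_lt_top {Ω : Set Plane}
    (hL : HasLipschitzBoundary Ω) (hΩ : IsOpen Ω) (hb : Bornology.IsBounded Ω) :
    μH[1] (frontier Ω) < ⊤ := by
  have hc : IsCompact (frontier Ω) :=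
    Metric.isCompact_of_isClosed_isBounded isClosed_frontier
      (hb.closure.subset frontier_subset_closure)
  refine hc.measure_lt_top_of_nhdsWithin fun p hp => ?_
  obtain ⟨T, h, K, U, H, hpU⟩ := hL.exists_chart hp
  refine ⟨frontier Ω ∩ U, inter_mem self_mem_nhdsWithin
    (mem_nhdsWithin_of_mem_nhds (H.isOpen.mem_nhds hpU)), ?_⟩
  have := H.hausdorffMeasure_le hΩ univ
  rw [univ_inter, univ_inter] at this
  exact this.trans_lt (ENNReal.mul_lt_top (by simp) H.volume_preimage_lt_top)

/-- The closure of a Lipschitz domain is a set of unique differentiability. -/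
lemma HasLipschitzBoundary.uniqueDiffOn_closure {Ω : Set Plane}
    (hL : HasLipschitzBoundary Ω) (hΩ : IsOpen Ω) : UniqueDiffOn ℝ (closure Ω) := by
  intro p hp
  by_cases hpΩ : p ∈ Ω
  · exact (hΩ.uniqueDiffWithinAt hpΩ).mono subset_closure
  have hpf : p ∈ frontier Ω := by rw [hΩ.frontier_eq]; exact ⟨hp, hpΩ⟩
  obtain ⟨T, h, K, δ, hh, hδ, hU⟩ := hL p hpf
  have H : GraphChart Ω T h K (Metric.ball p δ) :=
    ⟨hh, Metric.isOpen_ball, Metric.isBounded_ball, hU⟩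
  have hpg := (H.mem_frontier_iff hΩ (Metric.mem_ball_self hδ)).1 hpf
  -- A truncated open cone with vertex p, steeper than the Lipschitz constant and hence contained in
  -- Ω. It is convex with nonempty interior, and p lies in its closure.
  set W : Set Plane := Metric.ball p δ ∩ {y | K * |(T y) 0 - (T p) 0| < (T y) 1 - (T p) 1} with hW
  have hWo : IsOpen W := Metric.isOpen_ball.inter (isOpen_lt
    (continuous_const.mul ((continuous_coord T 0).sub continuous_const).abs)
    ((continuous_coord T 1).sub continuous_const))
  have hWc : Convex ℝ W := by
    refine (convex_ball p δ).inter ?_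
    intro x hx y hy a b ha hb hab
    simp only [mem_ofPred_eq, map_add, map_smul, PiLp.add_apply, PiLp.smul_apply,
      smul_eq_mul] at hx hy ⊢
    have e0 : a * (T x) 0 + b * (T y) 0 - (T p) 0
        = a * ((T x) 0 - (T p) 0) + b * ((T y) 0 - (T p) 0) := by
      linear_combination (T p) 0 * hab
    have e1 : a * (T x) 1 + b * (T y) 1 - (T p) 1
        = a * ((T x) 1 - (T p) 1) + b * ((T y) 1 - (T p) 1) := by
      linear_combination (T p) 1 * hab
    rw [e0, e1]
    have h1 := abs_add_le (a * ((T x) 0 - (T p) 0)) (b * ((T y) 0 - (T p) 0))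
    rw [abs_mul, abs_mul, abs_of_nonneg ha, abs_of_nonneg hb] at h1
    have h2 := mul_le_mul_of_nonneg_left h1 K.2
    -- The strict inequality survives only with a positive weight, so a = 0 is separate.
    rcases ha.eq_or_lt with rfl | ha'
    · have hb1 : b = 1 := by linarith
      subst hb1
      simpa using hy
    · have h3 := mul_lt_mul_of_pos_left hx ha'
      have h4 := mul_le_mul_of_nonneg_left hy.le hb
      have h5 : (K : ℝ) * (a * |(T x) 0 - (T p) 0| + b * |(T y) 0 - (T p) 0|)
        = a * (K * |(T x) 0 - (T p) 0|) + b * (K * |(T y) 0 - (T p) 0|) := by ring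
      exact h2.trans_lt (by rw [show (K.1 : ℝ) = K from rfl, h5]; linarith)
  have hWΩ : W ⊆ Ω := by
    rintro y ⟨hyU, hy⟩
    rw [hU y hyU]
    have h1 : |h ((T y) 0) - h ((T p) 0)| ≤ K * |(T y) 0 - (T p) 0| := by
      simpa [Real.dist_eq] using hh.dist_le_mul ((T y) 0) ((T p) 0)
    have h2 : K * |(T y) 0 - (T p) 0| < (T y) 1 - (T p) 1 := hy
    linarith [le_abs_self (h ((T y) 0) - h ((T p) 0))]
  have hpW : p ∈ closure W := by
    have hc : Continuous fun t : ℝ => p + t • frame T 1 := by fun_prop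
    have ht : Tendsto (fun t : ℝ => p + t • frame T 1) (𝓝[>] 0) (𝓝 p) := by
      simpa using (hc.tendsto 0).mono_left (nhdsWithin_le_nhds (s := Ioi 0))
    refine mem_closure_of_tendsto ht ?_
    filter_upwards [ht.eventually (Metric.ball_mem_nhds p hδ), self_mem_nhdsWithin] with t h1 h2
    refine ⟨h1, ?_⟩
    have : (0 : ℝ) < t := h2
    simp [frame, this]
  refine (uniqueDiffWithinAt_convex hWc ?_ hpW).mono (hWΩ.trans subset_closure)
  rw [hWo.interior_eq]
  exact closure_nonempty_iff.1 ⟨p, hpW⟩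

end Ventcel

namespace Ventcel

/-! ### Curves inside a boundary chart and the outer normal. -/

lemma inner_coord (T : Plane ≃ₗᵢ[ℝ] Plane) (v w : Plane) :
    inner ℝ v w = (T v) 0 * (T w) 0 + (T v) 1 * (T w) 1 := by
  rw [← T.inner_map_map, PiLp.inner_apply, Fin.sum_univ_two]
  simp [mul_comm]

lemma norm_sq_coord (T : Plane ≃ₗᵢ[ℝ] Plane) (v : Plane) :
    ‖v‖ ^ 2 = (T v) 0 ^ 2 + (T v) 1 ^ 2 := by
  rw [← real_inner_self_eq_norm_sq, inner_coord T]; ring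

lemma hasDerivAt_coord (T : Plane ≃ₗᵢ[ℝ] Plane) (i : Fin 2) {r : ℝ → Plane} {v : Plane} {s : ℝ}
    (hr : HasDerivAt r v s) : HasDerivAt (fun t => (T (r t)) i) ((T v) i) s :=
  ((EuclideanSpace.proj (𝕜 := ℝ) i).comp
    (T.toContinuousLinearEquiv : Plane →L[ℝ] Plane)).hasFDerivAt.comp_hasDerivAt s hr

/-- The downward unit normal to a curve with velocity `v`, in the frame `T`. -/
noncomputable def downNormal (T : Plane ≃ₗᵢ[ℝ] Plane) (v : Plane) : Plane :=
  ((T v) 0 / |(T v) 0|) • ((T v) 1 • frame T 0 - (T v) 0 • frame T 1)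

@[simp] lemma frame_coord (T : Plane ≃ₗᵢ[ℝ] Plane) (i j : Fin 2) :
    (T (frame T i)) j = if j = i then 1 else 0 := by
  simp [frame]

lemma downNormal_coord_zero (T : Plane ≃ₗᵢ[ℝ] Plane) (v : Plane) :
    (T (downNormal T v)) 0 = (T v) 0 / |(T v) 0| * (T v) 1 := by
  simp [downNormal]

lemma downNormal_coord_one (T : Plane ≃ₗᵢ[ℝ] Plane) (v : Plane) :
    (T (downNormal T v)) 1 = - ((T v) 0 / |(T v) 0| * (T v) 0) := by
  simp [downNormal]

namespace PlaneCurve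

variable {γ : PlaneCurve} {Ω : Set Plane}

/-- The outer normal is unique. -/
lemma IsOuterNormal.unique {s : ℝ} (hs : s ∈ γ.dom) {n n' : Plane} (hn : γ.IsOuterNormal Ω s n)
    (hn' : γ.IsOuterNormal Ω s n') : n = n' := by
  set T := LinearIsometryEquiv.refl ℝ Plane
  obtain ⟨h1, h2, h3⟩ := hn
  obtain ⟨h1', h2', h3'⟩ := hn'
  have hv := γ.norm_deriv hs
  set v := deriv γ.r s
  have q1 := norm_sq_coord T n
  have q2 := norm_sq_coord T n'
  have q3 := norm_sq_coord T v
  rw [h1] at q1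
  rw [h1'] at q2
  rw [hv] at q3
  rw [inner_coord T] at h2 h2'
  set a := (T n) 0
  set b := (T n) 1
  set a' := (T n') 0
  set b' := (T n') 1
  set c := (T v) 0
  set d := (T v) 1
  -- `n` and `n'` are both multiples of the rotated velocity
  have e1 : a = (a * d - b * c) * d := by linear_combination (a) * q3 + c * h2
  have e2 : b = -(a * d - b * c) * c := by linear_combination (b) * q3 + d * h2
  have e1' : a' = (a' * d - b' * c) * d := by linear_combination (a') * q3 + c * h2'
  have e2' : b' = -(a' * d - b' * c) * c := by linear_combination (b') * q3 + d * h2'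
  have hk : (a * d - b * c) ^ 2 = 1 := by
    linear_combination (-1 : ℝ) * q3 + (-(c ^ 2 + d ^ 2)) * q1 + (- (a * c + b * d)) * h2
  have hk' : (a' * d - b' * c) ^ 2 = 1 := by
    linear_combination (-1 : ℝ) * q3 + (-(c ^ 2 + d ^ 2)) * q2 + (- (a' * c + b' * d)) * h2'
  have hsq : (a * d - b * c) ^ 2 = (a' * d - b' * c) ^ 2 := by rw [hk, hk']
  rcases sq_eq_sq_iff_eq_or_eq_neg.1 hsq with h | h
  · refine ext_coord T ?_ ?_
    · change a = a'; rw [e1, e1', h]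
    · change b = b'; rw [e2, e2', h]
  -- Opposite unit normals would place the same point γ.r s − t n both in Ω and outside its closure.
  · exfalso
    have hneg : n' = -n := by
      refine ext_coord T ?_ ?_
      · rw [map_neg, PiLp.neg_apply]; change a' = -a; rw [e1, e1', h]; ring
      · rw [map_neg, PiLp.neg_apply]; change b' = -b; rw [e2, e2', h]; ring
    obtain ⟨t, ht, ht'⟩ := (h3.and h3').exists
    apply ht'.2
    rw [hneg, smul_neg, ← sub_eq_add_neg]
    exact subset_closure ht.1

variable {T : Plane ≃ₗᵢ[ℝ] Plane} {h : ℝ → ℝ} {K : ℝ≥0} {U : Set Plane}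

lemma eventually_mem_chart (H : GraphChart Ω T h K U) {s : ℝ} (hs : s ∈ γ.dom) (hsU : γ.r s ∈ U) :
    ∀ᶠ t in 𝓝 s, t ∈ γ.dom ∧ γ.r t ∈ U :=
  Filter.Eventually.and (γ.isOpen_dom.mem_nhds hs)
    ((γ.hasDerivAt hs).continuousAt.eventually (H.isOpen.mem_nhds hsU))

lemma r_mem_frontier (hγ : γ.trace ⊆ frontier Ω) {s : ℝ} (hs : s ∈ γ.dom) :
    γ.r s ∈ frontier Ω := hγ (γ.innerPart_subset_trace (γ.r_mem_innerPart hs))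

/-- The first coordinate is a regular parameter of a curve in a chart. -/
lemma deriv_coord_ne_zero (hΩ : IsOpen Ω) (hγ : γ.trace ⊆ frontier Ω) (H : GraphChart Ω T h K U)
    {s : ℝ} (hs : s ∈ γ.dom) (hsU : γ.r s ∈ U) : (T (deriv γ.r s)) 0 ≠ 0 := by
  intro h0
  have hd := γ.hasDerivAt hs
  have d0 := hasDerivAt_coord T 0 hd
  have d1 := hasDerivAt_coord T 1 hd
  rw [h0, hasDerivAt_iff_isLittleO] at d0
  simp only [smul_zero, sub_zero] at d0
  -- The curve runs on the graph, so increments of the second coordinate are at most K times those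
  -- of the first. If the first derivative vanished, so would the second, against unit speed.
  have hbig : (fun t => (T (γ.r t)) 1 - (T (γ.r s)) 1) =O[𝓝 s]
      fun t => (T (γ.r t)) 0 - (T (γ.r s)) 0 := by
    refine Asymptotics.IsBigO.of_bound K ?_
    filter_upwards [eventually_mem_chart H hs hsU] with t ht
    rw [(H.mem_frontier_iff hΩ ht.2).1 (r_mem_frontier hγ ht.1),
      (H.mem_frontier_iff hΩ hsU).1 (r_mem_frontier hγ hs)]
    simpa [dist_eq_norm] using H.lip.dist_le_mul ((T (γ.r t)) 0) ((T (γ.r s)) 0)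
  have hl := hbig.trans_isLittleO d0
  have d1' : HasDerivAt (fun t => (T (γ.r t)) 1) 0 s := by
    rw [hasDerivAt_iff_isLittleO]
    simpa using hl
  have h1 := d1.unique d1'
  have h2 := norm_sq_coord T (deriv γ.r s)
  rw [γ.norm_deriv hs, h0, h1] at h2
  norm_num at h2

/-- The inverse of the first coordinate along a curve in a chart. -/
lemma exists_inverse (hΩ : IsOpen Ω) (hγ : γ.trace ⊆ frontier Ω) (H : GraphChart Ω T h K U)
    {s : ℝ} (hs : s ∈ γ.dom) (hsU : γ.r s ∈ U) : ∃ ρ : ℝ → ℝ, ContDiffAt ℝ 1 ρ ((T (γ.r s)) 0) ∧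
      ρ ((T (γ.r s)) 0) = s ∧ (∀ᶠ t in 𝓝 s, ρ ((T (γ.r t)) 0) = t) ∧
      ∀ᶠ x in 𝓝 ((T (γ.r s)) 0), ρ x ∈ γ.dom ∧ γ.r (ρ x) ∈ U ∧ γ.r (ρ x) = graphMap T h x := by
  have hne := deriv_coord_ne_zero hΩ hγ H hs hsU
  have hC : ContDiffAt ℝ 1 (fun t => (T (γ.r t)) 0) s :=
    ((EuclideanSpace.proj (𝕜 := ℝ) (0 : Fin 2)).comp
      (T.toContinuousLinearEquiv : Plane →L[ℝ] Plane)).contDiff.contDiffAt.comp s (γ.contDiffAt hs)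
  have hd := hasDerivAt_coord T 0 (γ.hasDerivAt hs)
  have hfd : HasFDerivAt (fun t => (T (γ.r t)) 0)
      ((ContinuousLinearEquiv.unitsEquivAut ℝ (Units.mk0 _ hne) : ℝ ≃L[ℝ] ℝ) : ℝ →L[ℝ] ℝ) s := by
    refine hd.hasFDerivAt.congr_fderiv ?_
    ext; simp
  set e := hC.toOpenPartialHomeomorph _ hfd one_ne_zero with he
  have hes : s ∈ e.source := hC.mem_toOpenPartialHomeomorph_source hfd one_ne_zero
  have hecoe : (e : ℝ → ℝ) = fun t => (T (γ.r t)) 0 := hC.toOpenPartialHomeomorph_coe hfd one_ne_zero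
  have het : (T (γ.r s)) 0 ∈ e.target := by
    have := e.map_source hes
    rwa [hecoe] at this
  have hinv : e.symm ((T (γ.r s)) 0) = s := by
    have := e.left_inv hes
    rwa [hecoe] at this
  refine ⟨e.symm, hC.to_localInverse hfd one_ne_zero, hinv, ?_, ?_⟩
  · filter_upwards [e.open_source.mem_nhds hes] with t ht
    have := e.left_inv ht
    rwa [hecoe] at this
  · have hcont : ContinuousAt e.symm ((T (γ.r s)) 0) := e.continuousAt_symm het
    have hev := eventually_mem_chart H hs hsU
    rw [← hinv] at hev
    filter_upwards [hcont.eventually hev, e.open_target.mem_nhds het] with x hx hxt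
    refine ⟨hx.1, hx.2, ?_⟩
    have hx0 : (T (γ.r (e.symm x))) 0 = x := by
      have := e.right_inv hxt
      rwa [hecoe] at this
    have := H.eq_graphMap hΩ hx.2 (r_mem_frontier hγ hx.1)
    rw [hx0] at this
    exact this.symm

/-- The slope of the graph in terms of the velocity of the curve. -/
lemma hasDerivAt_graph (hΩ : IsOpen Ω) (hγ : γ.trace ⊆ frontier Ω) (H : GraphChart Ω T h K U)
    {s : ℝ} (hs : s ∈ γ.dom) (hsU : γ.r s ∈ U) :
    HasDerivAt h ((T (deriv γ.r s)) 1 / (T (deriv γ.r s)) 0) ((T (γ.r s)) 0) := by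
  obtain ⟨ρ, hρC, hρs, hρl, hρr⟩ := exists_inverse hΩ hγ H hs hsU
  have hne := deriv_coord_ne_zero hΩ hγ H hs hsU
  have hd := γ.hasDerivAt hs
  have hρd := (hρC.differentiableAt one_ne_zero).hasDerivAt
  set ρ' := deriv ρ ((T (γ.r s)) 0)
  have h1 : HasDerivAt (fun t => ρ ((T (γ.r t)) 0)) (ρ' * (T (deriv γ.r s)) 0) s :=
    hρd.comp s (hasDerivAt_coord T 0 hd)
  have h2 : ρ' * (T (deriv γ.r s)) 0 = 1 :=
    h1.unique ((hasDerivAt_id s).congr_of_eventuallyEq hρl)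
  have h3 : ρ' = ((T (deriv γ.r s)) 0)⁻¹ := eq_inv_of_mul_eq_one_left h2
  -- Near the base point `h` coincides with the second coordinate of the curve after ρ, so it is
  -- differentiable there although only Lipschitz by assumption.
  have h4 : HasDerivAt (fun x => (T (γ.r (ρ x))) 1) ((T (deriv γ.r s)) 1 * ρ') ((T (γ.r s)) 0) := by
    have h5 := hasDerivAt_coord T 1 hd
    rw [← hρs] at h5
    have := h5.comp _ hρd
    rwa [hρs] at this
  rw [h3, ← div_eq_mul_inv] at h4
  refine h4.congr_of_eventuallyEq ?_
  filter_upwards [hρr] with x hx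
  rw [hx.2.2, graphMap_coord_one]

/-- In a chart, the outer normal points downwards. -/
lemma isOuterNormal_downNormal (hΩ : IsOpen Ω) (hγ : γ.trace ⊆ frontier Ω)
    (H : GraphChart Ω T h K U) {s : ℝ} (hs : s ∈ γ.dom) (hsU : γ.r s ∈ U) :
    γ.IsOuterNormal Ω s (downNormal T (deriv γ.r s)) := by
  have hne := deriv_coord_ne_zero hΩ hγ H hs hsU
  have hgd := hasDerivAt_graph hΩ hγ H hs hsU
  have hv := γ.norm_deriv hs
  have hfr := (H.mem_frontier_iff hΩ hsU).1 (r_mem_frontier hγ hs)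
  set v := deriv γ.r s
  set n := downNormal T v with hn
  have n0 := downNormal_coord_zero T v
  have n1 := downNormal_coord_one T v
  rw [← hn] at n0 n1
  have q3 := norm_sq_coord T v
  rw [hv] at q3
  set c := (T v) 0
  set d := (T v) 1
  have habs : 0 < |c| := abs_pos.2 hne
  have hcc : c * c = |c| * |c| := (abs_mul_abs_self c).symm
  have n1' : (T n) 1 = -|c| := by
    rw [n1]; field_simp; rw [pow_two, hcc, pow_two]
  have hsgn : (c / |c|) ^ 2 = 1 := by
    rw [div_pow, sq_abs, div_self (pow_ne_zero 2 hne)]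
  refine ⟨?_, ?_, ?_⟩
  · have : ‖n‖ ^ 2 = 1 := by
      rw [norm_sq_coord T, n0, n1]
      linear_combination (d ^ 2 + c ^ 2) * hsgn - q3
    nlinarith [norm_nonneg n]
  · rw [inner_coord T, n0, n1]; ring
  · -- comparison of the graph with its tangent
    set σ := (T (γ.r s)) 0
    have hlin : ∀ w : ℝ, HasDerivAt (fun t : ℝ => h (σ + t * w)) (d / c * w) 0 := fun w => by
      have h1 : HasDerivAt (fun t : ℝ => σ + t * w) w 0 := by
        simpa using ((hasDerivAt_id (0 : ℝ)).mul_const w).const_add σ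
      have h2 : HasDerivAt h (d / c) (σ + 0 * w) := by simpa using hgd
      exact h2.comp 0 h1
    have key : ∀ w m : ℝ, d / c * w < m →
        ∀ᶠ t : ℝ in 𝓝[>] 0, h (σ + t * w) < h σ + t * m := by
      intro w m hwm
      have h1 : HasDerivAt (fun t : ℝ => h (σ + t * w) - t * m) (d / c * w - m) 0 := by
        have h0 := (hasDerivAt_id (0 : ℝ)).mul_const m
        rw [one_mul] at h0
        exact (hlin w).sub h0
      have h2 := (hasDerivAt_iff_tendsto_slope_zero.1 h1).eventually
        (gt_mem_nhds (sub_neg.2 hwm))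
      have h3 : ∀ᶠ t : ℝ in 𝓝[>] 0, _ := h2.filter_mono
        (nhdsWithin_mono 0 fun t ht => ne_of_gt ht)
      filter_upwards [h3, self_mem_nhdsWithin] with t ht ht0
      have ht0' : (0 : ℝ) < t := ht0
      simp only [zero_add, zero_mul, add_zero, sub_zero, smul_eq_mul] at ht
      have := neg_of_mul_neg_right ht (inv_nonneg.2 ht0'.le)
      linarith
    have hsub : ∀ᶠ t : ℝ in 𝓝[>] 0, γ.r s - t • n ∈ U := by
      have hc : Continuous fun t : ℝ => γ.r s - t • n := by fun_prop
      have : Tendsto (fun t : ℝ => γ.r s - t • n) (𝓝[>] 0) (𝓝 (γ.r s)) := by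
        simpa using (hc.tendsto 0).mono_left (nhdsWithin_le_nhds (s := Ioi 0))
      exact this.eventually (H.isOpen.mem_nhds hsU)
    have hadd : ∀ᶠ t : ℝ in 𝓝[>] 0, γ.r s + t • n ∈ U := by
      have hc : Continuous fun t : ℝ => γ.r s + t • n := by fun_prop
      have : Tendsto (fun t : ℝ => γ.r s + t • n) (𝓝[>] 0) (𝓝 (γ.r s)) := by
        simpa using (hc.tendsto 0).mono_left (nhdsWithin_le_nhds (s := Ioi 0))
      exact this.eventually (H.isOpen.mem_nhds hsU)
    -- In the direction n the tangent of the graph rises at rate d²/|c| ≥ 0, while the point itself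
    -- descends at rate |c| > 0: both comparisons are strict.
    have hprod : d / c * (T n) 0 = d ^ 2 / |c| := by
      rw [n0]; field_simp
    have hpos : 0 ≤ d ^ 2 / |c| := by positivity
    have k1 := key (-(T n) 0) |c| (by rw [mul_neg, hprod]; linarith)
    -- the same comparison for the reflected function
    have k2 : ∀ᶠ t : ℝ in 𝓝[>] 0, h σ - t * |c| < h (σ + t * (T n) 0) := by
      have h1 : HasDerivAt (fun t : ℝ => h (σ + t * (T n) 0) + t * |c|)
          (d / c * (T n) 0 + |c|) 0 := by
        have h0 := (hasDerivAt_id (0 : ℝ)).mul_const |c|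
        rw [one_mul] at h0
        exact (hlin ((T n) 0)).add h0
      have h2 := (hasDerivAt_iff_tendsto_slope_zero.1 h1).eventually
        (lt_mem_nhds (by rw [hprod]; linarith : (0 : ℝ) < d / c * (T n) 0 + |c|))
      have h3 : ∀ᶠ t : ℝ in 𝓝[>] 0, _ := h2.filter_mono
        (nhdsWithin_mono 0 fun t ht => ne_of_gt ht)
      filter_upwards [h3, self_mem_nhdsWithin] with t ht ht0
      have ht0' : (0 : ℝ) < t := ht0
      simp only [zero_add, zero_mul, add_zero, smul_eq_mul] at ht
      have := (pos_iff_pos_of_mul_pos ht).1 (inv_pos.2 ht0')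
      linarith
    filter_upwards [hsub, hadd, k1, k2] with t h1 h2 h3 h4
    constructor
    · rw [H.mem_iff _ h1]
      simp only [map_sub, map_smul, PiLp.sub_apply, PiLp.smul_apply, smul_eq_mul, n1', hfr]
      rw [show σ + t * -(T n) 0 = σ - t * (T n) 0 by ring] at h3
      change h (σ - t * (T n) 0) < h σ - t * -|c|
      linarith
    · rw [H.mem_closure_iff h2]
      simp only [map_add, map_smul, PiLp.add_apply, PiLp.smul_apply, smul_eq_mul, n1', hfr, not_le]
      change h σ + t * -|c| < h (σ + t * (T n) 0)
      linarith

variable (γ Ω) in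
/-- The outer normal along a curve. -/
noncomputable def normal (s : ℝ) : Plane := Classical.epsilon (γ.IsOuterNormal Ω s)

lemma normal_eq_of_isOuterNormal {s : ℝ} (hs : s ∈ γ.dom) {n : Plane}
    (hn : γ.IsOuterNormal Ω s n) : γ.normal Ω s = n :=
  (Classical.epsilon_spec (p := γ.IsOuterNormal Ω s) ⟨n, hn⟩).unique hs hn

lemma normal_eq_downNormal (hΩ : IsOpen Ω) (hγ : γ.trace ⊆ frontier Ω)
    (H : GraphChart Ω T h K U) {s : ℝ} (hs : s ∈ γ.dom) (hsU : γ.r s ∈ U) :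
    γ.normal Ω s = downNormal T (deriv γ.r s) :=
  normal_eq_of_isOuterNormal hs (isOuterNormal_downNormal hΩ hγ H hs hsU)

lemma isOuterNormal_normal (hL : HasLipschitzBoundary Ω) (hΩ : IsOpen Ω)
    (hγ : γ.trace ⊆ frontier Ω) {s : ℝ} (hs : s ∈ γ.dom) :
    γ.IsOuterNormal Ω s (γ.normal Ω s) := by
  obtain ⟨T, h, K, U, H, hU⟩ := hL.exists_chart (r_mem_frontier hγ hs)
  rw [normal_eq_downNormal hΩ hγ H hs hU]
  exact isOuterNormal_downNormal hΩ hγ H hs hU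

/-- In a chart the normal is an explicit function of the continuous velocity, whose first coordinate
does not vanish. -/
lemma continuousOn_normal (hL : HasLipschitzBoundary Ω) (hΩ : IsOpen Ω)
    (hγ : γ.trace ⊆ frontier Ω) : ContinuousOn (γ.normal Ω) γ.dom := by
  intro s hs
  obtain ⟨T, h, K, U, H, hU⟩ := hL.exists_chart (r_mem_frontier hγ hs)
  have hd : ContinuousAt (deriv γ.r) s := γ.continuousOn_deriv.continuousAt
    (γ.isOpen_dom.mem_nhds hs)
  have hne := deriv_coord_ne_zero hΩ hγ H hs hU
  have h0 := (continuous_coord T 0).continuousAt.comp hd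
  have h1 := (continuous_coord T 1).continuousAt.comp hd
  have hc : ContinuousAt (fun t => downNormal T (deriv γ.r t)) s :=
    (h0.div h0.abs (abs_ne_zero.2 hne)).smul
      ((h1.smul continuousAt_const).sub (h0.smul continuousAt_const))
  refine (hc.congr ?_).continuousWithinAt
  filter_upwards [eventually_mem_chart H hs hU] with t ht
  exact (normal_eq_downNormal hΩ hγ H ht.1 ht.2).symm

lemma normal_add_int_mul (h : γ.IsClosedCurve) (m : ℤ) (s : ℝ) :
    γ.normal Ω (s + m * γ.L) = γ.normal Ω s := by
  have : γ.IsOuterNormal Ω (s + m * γ.L) = γ.IsOuterNormal Ω s := by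
    ext n
    simp only [IsOuterNormal, γ.r_add_int_mul h, γ.deriv_r_add_int_mul h]
  rw [normal, normal, this]

/-- Near an inner point of a curve, the boundary consists of nearby points of the curve. -/
lemma eventually_frontier (hL : HasLipschitzBoundary Ω) (hΩ : IsOpen Ω)
    (hγ : γ.trace ⊆ frontier Ω) {s : ℝ} (hs : s ∈ γ.dom) {N : Set ℝ} (hN : N ∈ 𝓝 s) :
    ∀ᶠ x in 𝓝 (γ.r s), x ∈ frontier Ω → ∃ t ∈ N, t ∈ γ.dom ∧ γ.r t = x := by
  obtain ⟨T, h, K, U, H, hU⟩ := hL.exists_chart (r_mem_frontier hγ hs)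
  obtain ⟨ρ, hρC, hρs, hρl, hρr⟩ := exists_inverse hΩ hγ H hs hU
  have hρN : ∀ᶠ x in 𝓝 ((T (γ.r s)) 0), ρ x ∈ N := by
    rw [← hρs] at hN
    exact hρC.continuousAt.eventually hN
  have hco := (continuous_coord T 0).continuousAt (x := γ.r s)
  filter_upwards [hco.eventually hρN, hco.eventually hρr, H.isOpen.mem_nhds hU] with x h1 h2 hxU hxf
  exact ⟨_, h1, h2.1, h2.2.2.trans (H.eq_graphMap hΩ hxU hxf)⟩

end PlaneCurve

end Ventcel

namespace Ventcel

/-! ### The divergence theorem on an admissible domain -/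

variable {N : ℕ} {Ω : Set Plane} {Γ : Fin N → PlaneCurve}

namespace IsAdmissible

lemma isCompact_closure (hA : IsAdmissible Ω Γ) : IsCompact (closure Ω) :=
  hA.isBounded.isCompact_closure

lemma uniqueDiffOn (hA : IsAdmissible Ω Γ) : UniqueDiffOn ℝ (closure Ω) :=
  hA.lipschitz.uniqueDiffOn_closure hA.isOpen

lemma trace_subset (hA : IsAdmissible Ω Γ) (i : Fin N) : (Γ i).trace ⊆ frontier Ω :=
  (subset_iUnion (fun i => (Γ i).trace) i).trans hA.ssubset.subset

lemma hausdorffMeasure_frontier_lt_top (hA : IsAdmissible Ω Γ) : μH[1] (frontier Ω) < ⊤ :=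
  hA.lipschitz.hausdorffMeasure_frontier_lt_top hA.isOpen hA.isBounded

lemma volume_lt_top (hA : IsAdmissible Ω Γ) : volume Ω < ⊤ := hA.isBounded.measure_lt_top

lemma measurableSet_gammaNu : MeasurableSet (GammaNu Γ) :=
  MeasurableSet.iUnion fun i => (Γ i).measurableSet_innerPart

lemma measurableSet_gammaD : MeasurableSet (GammaD Ω Γ) :=
  isClosed_frontier.measurableSet.diff measurableSet_gammaNu

lemma gammaD_subset_frontier : GammaD Ω Γ ⊆ frontier Ω := sdiff_subset

lemma isFiniteMeasure_volume (hA : IsAdmissible Ω Γ) :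
    IsFiniteMeasure (volume.restrict Ω : Measure Plane) :=
  ⟨by rw [Measure.restrict_apply_univ]; exact hA.volume_lt_top⟩

lemma isFiniteMeasure_bdry (hA : IsAdmissible Ω Γ) : IsFiniteMeasure (bdry Ω) :=
  ⟨by rw [bdry, Measure.restrict_apply_univ]; exact hA.hausdorffMeasure_frontier_lt_top⟩

lemma gammaD_le_bdry : (μH[1].restrict (GammaD Ω Γ) : Measure Plane) ≤ bdry Ω :=
  Measure.restrict_mono gammaD_subset_frontier le_rfl

lemma fderivWithin_eq (hA : IsAdmissible Ω Γ) {F : Type*} [NormedAddCommGroup F] [NormedSpace ℝ F]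
    (X : Plane → F) {x : Plane} (hx : x ∈ Ω) :
    fderivWithin ℝ X (closure Ω) x = fderiv ℝ X x :=
  fderivWithin_of_mem_nhds (mem_of_superset (hA.isOpen.mem_nhds hx) subset_closure)

lemma contDiffAt (hA : IsAdmissible Ω Γ) {F : Type*} [NormedAddCommGroup F] [NormedSpace ℝ F]
    {X : Plane → F} {n : WithTop ℕ∞} (hX : ContDiffOn ℝ n X (closure Ω)) {x : Plane} (hx : x ∈ Ω) :
    ContDiffAt ℝ n X x :=
  hX.contDiffAt (mem_of_superset (hA.isOpen.mem_nhds hx) subset_closure)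

lemma exists_bound (hA : IsAdmissible Ω Γ) {F : Type*} [NormedAddCommGroup F] [NormedSpace ℝ F]
    {X : Plane → F} (hX : ContDiffOn ℝ 1 X (closure Ω)) :
    ∃ C, 0 ≤ C ∧ (∀ x ∈ closure Ω, ‖X x‖ ≤ C) ∧ ∀ x ∈ Ω, ‖fderiv ℝ X x‖ ≤ C := by
  obtain ⟨C₁, h1⟩ := hA.isCompact_closure.exists_bound_of_continuousOn hX.continuousOn
  obtain ⟨C₂, h2⟩ := hA.isCompact_closure.exists_bound_of_continuousOn
    (hX.continuousOn_fderivWithin hA.uniqueDiffOn (by norm_num))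
  refine ⟨max (max C₁ C₂) 0, le_max_right _ _, fun x hx => ?_, fun x hx => ?_⟩
  · exact (h1 x hx).trans ((le_max_left _ _).trans (le_max_left _ _))
  · rw [← hA.fderivWithin_eq X hx]
    exact (h2 x (subset_closure hx)).trans ((le_max_right _ _).trans (le_max_left _ _))

lemma continuousOn_fderiv (hA : IsAdmissible Ω Γ) {F : Type*} [NormedAddCommGroup F]
    [NormedSpace ℝ F] {X : Plane → F} (hX : ContDiffOn ℝ 1 X (closure Ω)) :
    ContinuousOn (fderiv ℝ X) Ω :=
  (hX.mono subset_closure).continuousOn_fderiv_of_isOpen hA.isOpen (by norm_num)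

lemma integrableOn_divergence (hA : IsAdmissible Ω Γ) {X : Plane → Plane}
    (hX : ContDiffOn ℝ 1 X (closure Ω)) : IntegrableOn (divergence X) Ω := by
  obtain ⟨C, -, -, hC⟩ := hA.exists_bound hX
  have := memLp_of_bounded_on (p := 1) (μ := volume) hA.isOpen.measurableSet hA.volume_lt_top.ne
    (f := divergence X) (C := 2 * C)
    ((continuous_trace.comp_continuousOn (hA.continuousOn_fderiv hX)).aestronglyMeasurable
      hA.isOpen.measurableSet)
    (fun x hx => (abs_trace_le _).trans (by linarith [hC x hx]))
  exact memLp_one_iff_integrable.1 this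

lemma integrable_bdry (hA : IsAdmissible Ω Γ) {F : Type*} [NormedAddCommGroup F]
    {X : Plane → F} (hX : ContinuousOn X (closure Ω)) : Integrable X (bdry Ω) := by
  obtain ⟨C, h1⟩ := hA.isCompact_closure.exists_bound_of_continuousOn hX
  exact memLp_one_iff_integrable.1 (memLp_of_bounded_on isClosed_frontier.measurableSet
    hA.hausdorffMeasure_frontier_lt_top.ne ((hX.mono frontier_subset_closure).aestronglyMeasurable
      isClosed_frontier.measurableSet) fun x hx => h1 x (frontier_subset_closure hx))

/-- The flux through the curves of a vector field. -/
noncomputable def _root_.Ventcel.flux (Ω : Set Plane) (Γ : Fin N → PlaneCurve) (X : Plane → Plane) :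
    ℝ := ∑ i, ∫ s, inner ℝ (X ((Γ i).r s)) ((Γ i).normal Ω s) ∂(Γ i).ds

lemma divergence_eq_zero_of_notMem {X : Plane → Plane} {x : Plane} (hx : x ∉ tsupport X) :
    divergence X x = 0 := by
  rw [divergence, image_eq_zero_of_notMem_tsupport fun h => hx (tsupport_fderiv_subset ℝ h)]
  simp

/-- Such a field is C¹ on the whole plane. The graph theorem is applied with a horizontal line at
height −R, where the field vanishes. -/
lemma integral_divergence_eq_zero (hA : IsAdmissible Ω Γ) {X : Plane → Plane}
    (hX : ContDiffOn ℝ 1 X (closure Ω)) (hs : tsupport X ⊆ Ω) :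
    ∫ x in Ω, divergence X x = 0 := by
  obtain ⟨R, hR0, hR⟩ := hA.isBounded.subset_ball_lt 0 0
  obtain ⟨C, hC0, -, hC⟩ := hA.exists_bound hX
  set T := LinearIsometryEquiv.refl ℝ Plane
  have hz : ∀ x, R ≤ ‖x‖ → X x = 0 := fun x hx => image_eq_zero_of_notMem_tsupport fun h => by
    have := hR (hs h)
    rw [mem_ball_zero_iff] at this
    linarith
  have hXC : ContDiff ℝ 1 X := contDiff_iff_contDiffAt.2 fun x => by
    by_cases hx : x ∈ tsupport X
    · exact hA.contDiffAt hX (hs hx)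
    · exact contDiffAt_const.congr_of_eventuallyEq (notMem_tsupport_iff_eventuallyEq.1 hx)
  have key := integral_divergence_above_graph T (h := fun _ => -R) (K := 0) (LipschitzWith.const _)
    hXC.contDiffOn hXC.continuous.continuousOn (R := R) (C := C) (fun x _ hx => hz x hx)
    (fun x _ => by
      by_cases hx : x ∈ tsupport X
      · exact hC x (hs hx)
      · rwa [image_eq_zero_of_notMem_tsupport fun h => hx (tsupport_fderiv_subset ℝ h), norm_zero])
  have h0 : ∀ x : ℝ, X (shear T (fun _ => -R) (x, 0)) = 0 := fun x => hz _ (by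
    have := norm_coord_le T (shear T (fun _ => -R) (x, 0)) 1
    rw [shear_coord_one] at this
    simp only [add_zero, abs_neg, abs_of_pos hR0] at this
    exact this)
  simp only [h0, map_zero, PiLp.zero_apply, mul_zero, sub_zero, integral_zero] at key
  rw [← key, setIntegral_eq_integral_of_forall_compl_eq_zero,
    setIntegral_eq_integral_of_forall_compl_eq_zero]
  · intro x hx
    refine divergence_eq_zero_of_notMem fun h => hx ?_
    have h1 := hR (hs h)
    have h2 := norm_coord_le T x 1
    rw [mem_ball_zero_iff] at h1
    have h3 := neg_abs_le ((T x) 1)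
    change -R < (T x) 1
    linarith
  · exact fun x hx => divergence_eq_zero_of_notMem fun h => hx (hs h)

variable {T : Plane ≃ₗᵢ[ℝ] Plane} {h : ℝ → ℝ} {K : ℝ≥0} {U : Set Plane}

/-- The divergence theorem for fields supported in a boundary chart. -/
lemma integral_divergence_chart (hA : IsAdmissible Ω Γ) (H : GraphChart Ω T h K U)
    {X : Plane → Plane} (hX : ContDiffOn ℝ 1 X (closure Ω)) (hs : tsupport X ⊆ U) :
    ∫ x in Ω, divergence X x =
      ∫ x, (deriv h x * (T (X (graphMap T h x))) 0 - (T (X (graphMap T h x))) 1) := by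
  obtain ⟨R, hR0, hR, -⟩ := H.exists_bound
  obtain ⟨C, hC0, -, hC⟩ := hA.exists_bound hX
  have hG : MeasurableSet {x | h ((T x) 0) < (T x) 1} :=
    (isOpen_lt (H.lip.continuous.comp (continuous_coord T 0)) (continuous_coord T 1)).measurableSet
  have key := integral_divergence_above_graph T H.lip (X := X) (R := R) (C := C) ?_ ?_ ?_ ?_
  · refine Eq.trans ?_ key
    -- Ω and the epigraph agree only inside `U`; both integrals reduce to Ω ∩ U because the
    -- divergence vanishes off the support of X.
    rw [setIntegral_eq_of_subset_of_forall_sdiff_eq_zero (s := Ω ∩ U) hA.isOpen.measurableSet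
      inter_subset_left, setIntegral_eq_of_subset_of_forall_sdiff_eq_zero (s := Ω ∩ U) hG]
    · rintro x ⟨hxΩ, hxU⟩
      exact (H.mem_iff x hxU).1 hxΩ
    · rintro x ⟨hx, hx'⟩
      exact divergence_eq_zero_of_notMem fun h' => hx' ⟨(H.mem_iff x (hs h')).2 hx, hs h'⟩
    · rintro x ⟨hx, hx'⟩
      exact divergence_eq_zero_of_notMem fun h' => hx' ⟨hx, hs h'⟩
  · intro x hx
    by_cases hxX : x ∈ tsupport X
    · exact (hA.contDiffAt hX ((H.mem_iff x (hs hxX)).2 hx)).contDiffWithinAt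
    · exact (contDiffAt_const.congr_of_eventuallyEq
        (notMem_tsupport_iff_eventuallyEq.1 hxX)).contDiffWithinAt
  · intro x hx
    by_cases hxX : x ∈ tsupport X
    · have hxU := hs hxX
      have h1 := hX.continuousOn x ((H.mem_closure_iff hxU).2 hx)
      refine h1.mono_of_mem_nhdsWithin ?_
      filter_upwards [self_mem_nhdsWithin, mem_nhdsWithin_of_mem_nhds (H.isOpen.mem_nhds hxU)]
        with y hy hyU
      exact (H.mem_closure_iff hyU).2 hy
    · exact (continuousAt_const.congr
        (notMem_tsupport_iff_eventuallyEq.1 hxX).symm).continuousWithinAt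
  · intro x _ hxR
    refine image_eq_zero_of_notMem_tsupport fun h' => ?_
    have := hR (hs h')
    rw [mem_ball_zero_iff] at this
    linarith
  · intro x hx
    by_cases hxX : x ∈ tsupport X
    · exact hC x ((H.mem_iff x (hs hxX)).2 hx)
    · rwa [image_eq_zero_of_notMem_tsupport fun h' => hxX (tsupport_fderiv_subset ℝ h'), norm_zero]

/-- X is controlled only on the closure of Ω: graph points inside `U` are boundary points, and all
others lie off the support. -/
lemma continuous_comp_graphMap (hA : IsAdmissible Ω Γ) (H : GraphChart Ω T h K U)
    {F : Type*} [NormedAddCommGroup F]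
    {X : Plane → F} (hX : ContinuousOn X (closure Ω)) (hs : tsupport X ⊆ U) :
    Continuous (fun x => X (graphMap T h x)) ∧ HasCompactSupport (fun x => X (graphMap T h x)) := by
  constructor
  · rw [continuous_iff_continuousAt]
    intro x
    by_cases hx : graphMap T h x ∈ tsupport X
    · have hU := hs hx
      have h1 : ∀ᶠ y in 𝓝 x, graphMap T h y ∈ U :=
        H.continuous_graphMap.continuousAt.eventually (H.isOpen.mem_nhds hU)
      have h2 : ContinuousWithinAt X (closure Ω) (graphMap T h x) :=
        hX _ (frontier_subset_closure (H.graphMap_mem_frontier hA.isOpen hU))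
      refine h2.tendsto.comp (tendsto_nhdsWithin_iff.2 ⟨H.continuous_graphMap.continuousAt, ?_⟩)
      filter_upwards [h1] with y hy
      exact frontier_subset_closure (H.graphMap_mem_frontier hA.isOpen hy)
    · have h1 := H.continuous_graphMap.continuousAt.eventually (notMem_tsupport_iff_eventuallyEq.1 hx)
      exact continuousAt_const.congr (Filter.EventuallyEq.symm h1)
  · obtain ⟨R, -, -, hR⟩ := H.exists_bound
    refine HasCompactSupport.of_support_subset_isCompact (isCompact_Icc (a := -R) (b := R)) ?_
    intro x hx
    exact Ioo_subset_Icc_self (hR (hs (subset_tsupport X hx)))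

end IsAdmissible

end Ventcel

namespace Ventcel

variable {N : ℕ} {Ω : Set Plane} {Γ : Fin N → PlaneCurve}

namespace IsAdmissible

variable {T : Plane ≃ₗᵢ[ℝ] Plane} {h : ℝ → ℝ} {K : ℝ≥0} {U : Set Plane}

/-! ### The flux through the boundary, in a chart and globally. -/

lemma _root_.Ventcel.GraphChart.map_graphMap_le (H : GraphChart Ω T h K U) (A : Set Plane) :
    (volume.restrict (graphMap T h ⁻¹' A)).map (graphMap T h) ≤ μH[1].restrict A := by
  refine Measure.le_iff.2 fun B hB => ?_
  have hm := H.continuous_graphMap.measurable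
  rw [Measure.map_apply hm hB, Measure.restrict_apply (hm hB), Measure.restrict_apply hB,
    ← preimage_inter]
  exact volume_graphMap_preimage_le T h _

/-- The part of the boundary integral in a chart which lies on the inner part of a curve. -/
lemma setIntegral_chart_curve (hA : IsAdmissible Ω Γ) (H : GraphChart Ω T h K U) (i : Fin N)
    {X : Plane → Plane} (hs : tsupport X ⊆ U) :
    ∫ x in graphMap T h ⁻¹' (U ∩ ((Γ i).innerPart \ {(Γ i).r 0})),
      (deriv h x * (T (X (graphMap T h x))) 0 - (T (X (graphMap T h x))) 1) =
    ∫ s, inner ℝ (X ((Γ i).r s)) ((Γ i).normal Ω s) ∂(Γ i).ds := by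
  set γ := Γ i
  have hγ := hA.trace_subset i
  set J : Set ℝ := Ioo 0 γ.L ∩ γ.r ⁻¹' U with hJ
  have hJo : IsOpen J := (γ.continuousOn_r_dom.mono γ.Ioo_subset_dom).isOpen_inter_preimage
    isOpen_Ioo H.isOpen
  have hJd : ∀ s ∈ J, s ∈ γ.dom := fun s hs => γ.Ioo_subset_dom hs.1
  have hgr : ∀ s ∈ J, graphMap T h ((T (γ.r s)) 0) = γ.r s := fun s hs =>
    H.eq_graphMap hA.isOpen hs.2 (PlaneCurve.r_mem_frontier hγ (hJd s hs))
  -- Removing the base point, which matters only for a closed curve, leaves exactly the points with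
  -- parameter in (0, L).
  have himg : graphMap T h ⁻¹' (U ∩ (γ.innerPart \ {γ.r 0})) = (fun s => (T (γ.r s)) 0) '' J := by
    ext x
    constructor
    · rintro ⟨hxU, hxi, hx0⟩
      obtain ⟨s, -, hsI, hsx⟩ := γ.exists_of_mem_innerPart hxi
      have hs0 : s ≠ 0 := fun h0 => hx0 (by rw [mem_singleton_iff, ← hsx, h0])
      refine ⟨s, ⟨⟨lt_of_le_of_ne hsI.1 hs0.symm, hsI.2⟩, ?_⟩, ?_⟩
      · rw [mem_preimage, hsx]; exact hxU
      · simp only [hsx, graphMap_coord_zero]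
    · rintro ⟨s, hs, rfl⟩
      simp only [mem_preimage]
      rw [hgr s hs]
      refine ⟨hs.2, γ.r_mem_innerPart (hJd s hs), fun h0 => ?_⟩
      have := (γ.simple 0 ⟨le_rfl, γ.L_pos.le⟩ s (Ioo_subset_Icc_self hs.1) hs.1.1 h0.symm).2
      exact hs.1.2.ne this
  have hinj : InjOn (fun s => (T (γ.r s)) 0) J := by
    intro s hs t ht hst
    refine γ.injOn_Ioo hs.1 ht.1 ?_
    rw [← hgr s hs, ← hgr t ht]
    exact congrArg _ hst
  -- Change of variables from the first coordinate to arc length. With velocity (c, d) the Jacobian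
  -- is |c|, the slope of the graph is d/c, and |c| (d/c X₀ − X₁) is the product of X with the
  -- downward normal.
  rw [himg, integral_image_eq_integral_abs_deriv_smul hJo.measurableSet
    (fun s hs => (hasDerivAt_coord T 0 (γ.hasDerivAt (hJd s hs))).hasDerivWithinAt) hinj,
    PlaneCurve.ds, setIntegral_eq_of_subset_of_forall_sdiff_eq_zero (s := J) measurableSet_Ioo
      inter_subset_left]
  · refine setIntegral_congr_fun hJo.measurableSet fun s hs' => ?_
    have hne := PlaneCurve.deriv_coord_ne_zero hA.isOpen hγ H (hJd s hs') hs'.2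
    simp only
    rw [hgr s hs', PlaneCurve.normal_eq_downNormal hA.isOpen hγ H (hJd s hs') hs'.2,
      (PlaneCurve.hasDerivAt_graph hA.isOpen hγ H (hJd s hs') hs'.2).deriv, inner_coord T,
      downNormal_coord_zero, downNormal_coord_one, smul_eq_mul]
    set c := (T (deriv γ.r s)) 0
    set d := (T (deriv γ.r s)) 1
    have habs : |c| ≠ 0 := abs_ne_zero.2 hne
    have hcc : |c| * |c| = c * c := abs_mul_abs_self c
    have hc1 : |c| / c = c / |c| := by
      rw [div_eq_div_iff hne habs, hcc]
    have hc2 : c / |c| * c = |c| := by rw [div_mul_eq_mul_div, ← hcc, mul_div_cancel_right₀ _ habs]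
    rw [hc2, ← hc1]
    ring
  · rintro s ⟨hs1, hs2⟩
    have : X (γ.r s) = 0 := image_eq_zero_of_notMem_tsupport fun h' => hs2 ⟨hs1, hs h'⟩
    rw [this, inner_zero_left]

/-- The chart integral splits into the curves, whose share is exactly the flux, and Γ_D. On Γ_D a
bound is enough: the integrand is at most (1 + K)‖X‖ and the coordinate measure is at most the
Hausdorff measure. -/
lemma flux_chart_estimate (hA : IsAdmissible Ω Γ) (H : GraphChart Ω T h K U)
    {X : Plane → Plane} (hX : ContDiffOn ℝ 1 X (closure Ω)) (hs : tsupport X ⊆ U) :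
    |(∫ x in Ω, divergence X x) - flux Ω Γ X| ≤
      (1 + K) * ∫ x in GammaD Ω Γ, ‖X x‖ ∂μH[1] := by
  have hgm := H.continuous_graphMap.measurable
  obtain ⟨hYc, hYs⟩ := hA.continuous_comp_graphMap H hX.continuousOn hs
  set B : ℝ → ℝ := fun x => deriv h x * (T (X (graphMap T h x))) 0 - (T (X (graphMap T h x))) 1
    with hB
  have hYi : Integrable fun x => X (graphMap T h x) := hYc.integrable_of_hasCompactSupport hYs
  have hBle : ∀ x, ‖B x‖ ≤ (1 + K) * ‖X (graphMap T h x)‖ := fun x => by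
    have h1 := norm_coord_le T (X (graphMap T h x)) 0
    have h2 := norm_coord_le T (X (graphMap T h x)) 1
    have h3 : |deriv h x| ≤ K := by simpa using norm_deriv_le_of_lipschitz H.lip (x₀ := x)
    have h4 : |deriv h x * (T (X (graphMap T h x))) 0| ≤ K * ‖X (graphMap T h x)‖ := by
      rw [abs_mul]; exact mul_le_mul h3 h1 (abs_nonneg _) K.2
    have h5 := abs_sub (deriv h x * (T (X (graphMap T h x))) 0) ((T (X (graphMap T h x))) 1)
    rw [Real.norm_eq_abs]
    linarith
  have hBm : AEStronglyMeasurable B volume := by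
    refine AEStronglyMeasurable.sub ((measurable_deriv h).aestronglyMeasurable.mul ?_) ?_
    · exact ((continuous_coord T 0).comp hYc).aestronglyMeasurable
    · exact ((continuous_coord T 1).comp hYc).aestronglyMeasurable
  have hBi : Integrable B := (hYi.norm.const_mul (1 + (K : ℝ))).mono' hBm
    (Eventually.of_forall hBle)
  have hBz : ∀ x, graphMap T h x ∉ U → B x = 0 := fun x hx => by
    simp only [hB]
    rw [image_eq_zero_of_notMem_tsupport fun h' => hx (hs h')]
    simp
  set E : Fin N → Set ℝ := fun i => graphMap T h ⁻¹' (U ∩ ((Γ i).innerPart \ {(Γ i).r 0})) with hE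
  set ED : Set ℝ := graphMap T h ⁻¹' (U ∩ GammaD Ω Γ) with hED
  have hEm : ∀ i, MeasurableSet (E i) := fun i => hgm (H.isOpen.measurableSet.inter
    ((Γ i).measurableSet_innerPart.diff (measurableSet_singleton _)))
  have hUDm : MeasurableSet (U ∩ GammaD Ω Γ) := H.isOpen.measurableSet.inter measurableSet_gammaD
  have hEDm : MeasurableSet ED := hgm hUDm
  have hsplit : B =ᵐ[volume] fun x => ED.indicator B x + ∑ i, (E i).indicator B x := by
    -- The base points, excluded from the sets `E i`, have finitely many first coordinates, a null
    -- set.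
    have hfin : (range fun i => (T ((Γ i).r 0)) 0).Finite := Set.finite_range _
    filter_upwards [measure_eq_zero_iff_ae_notMem.1 (hfin.measure_zero volume)] with x hx
    by_cases hxU : graphMap T h x ∈ U
    · have hxf := H.graphMap_mem_frontier hA.isOpen hxU
      by_cases hxν : graphMap T h x ∈ GammaNu Γ
      · obtain ⟨i, hi⟩ := mem_iUnion.1 hxν
        have hxi : x ∈ E i := ⟨hxU, hi, fun h0 => hx ⟨i, by
          rw [mem_singleton_iff] at h0
          simp only
          rw [← h0, graphMap_coord_zero]⟩⟩
        have hxj : ∀ j, j ≠ i → x ∉ E j := fun j hj hxj =>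
          (hA.disjoint j i hj).le_bot ⟨hxj.2.1.1, hi.1⟩
        have hxD : x ∉ ED := fun h' => h'.2.2 hxν
        rw [indicator_of_notMem hxD, zero_add, Finset.sum_eq_single i
          (fun j _ hj => indicator_of_notMem (hxj j hj) _) (by simp), indicator_of_mem hxi]
      · have hxD : x ∈ ED := ⟨hxU, hxf, hxν⟩
        rw [indicator_of_mem hxD, Finset.sum_eq_zero, add_zero]
        intro j _
        exact indicator_of_notMem (fun h' => hxν (mem_iUnion.2 ⟨j, h'.2.1⟩)) _
    · rw [hBz x hxU, indicator_of_notMem (fun h' => hxU h'.1), Finset.sum_eq_zero, add_zero]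
      exact fun j _ => indicator_of_notMem (fun h' => hxU h'.1) _
  have hmain : (∫ x in Ω, divergence X x) - flux Ω Γ X = ∫ x in ED, B x := by
    rw [hA.integral_divergence_chart H hX hs, integral_congr_ae hsplit,
      integral_add (hBi.indicator hEDm) (integrable_finsetSum _ fun i _ => hBi.indicator (hEm i)),
      integral_finsetSum _ fun i _ => hBi.indicator (hEm i), integral_indicator hEDm]
    simp only [integral_indicator (hEm _), flux]
    rw [Finset.sum_congr rfl fun i _ => hA.setIntegral_chart_curve H i hs]
    ring
  rw [hmain, ← Real.norm_eq_abs]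
  refine (norm_integral_le_integral_norm _).trans ?_
  refine (integral_mono hBi.integrableOn.norm
    (hYi.norm.const_mul (1 + (K : ℝ))).integrableOn fun x => hBle x).trans ?_
  rw [integral_const_mul]
  gcongr
  have hXD : Integrable X (μH[1].restrict (GammaD Ω Γ)) :=
    (hA.integrable_bdry hX.continuousOn).mono_measure gammaD_le_bdry
  have hle : (volume.restrict ED).map (graphMap T h) ≤ μH[1].restrict (GammaD Ω Γ) :=
    (H.map_graphMap_le _).trans (Measure.restrict_mono inter_subset_right le_rfl)
  calc ∫ x in ED, ‖X (graphMap T h x)‖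
      = ∫ y, ‖X y‖ ∂((volume.restrict ED).map (graphMap T h)) :=
        (integral_map hgm.aemeasurable (hXD.mono_measure hle).norm.aestronglyMeasurable).symm
    _ ≤ _ := integral_mono_measure hle (Eventually.of_forall fun _ => norm_nonneg _) hXD.norm

lemma aestronglyMeasurable_normal (hA : IsAdmissible Ω Γ) (i : Fin N) :
    AEStronglyMeasurable ((Γ i).normal Ω) (Γ i).ds :=
  ((PlaneCurve.continuousOn_normal hA.lipschitz hA.isOpen (hA.trace_subset i)).mono
    (Γ i).Ioo_subset_dom).aestronglyMeasurable measurableSet_Ioo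

lemma continuousOn_comp_r (hA : IsAdmissible Ω Γ) (i : Fin N) {F : Type*} [TopologicalSpace F]
    {X : Plane → F} (hX : ContinuousOn X (closure Ω)) :
    ContinuousOn (fun s => X ((Γ i).r s)) (Γ i).dom :=
  hX.comp (Γ i).continuousOn_r_dom fun _ hs =>
    frontier_subset_closure (PlaneCurve.r_mem_frontier (hA.trace_subset i) hs)

lemma integrable_flux (hA : IsAdmissible Ω Γ) (i : Fin N) {X : Plane → Plane}
    (hX : ContinuousOn X (closure Ω)) :
    Integrable (fun s => inner ℝ (X ((Γ i).r s)) ((Γ i).normal Ω s)) (Γ i).ds := by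
  obtain ⟨C, hC⟩ := hA.isCompact_closure.exists_bound_of_continuousOn hX
  refine memLp_one_iff_integrable.1 (memLp_of_bounded_on (C := C) measurableSet_Ioo (by simp)
    ?_ fun s hs => ?_)
  · exact (((hA.continuousOn_comp_r i hX).mono (Γ i).Ioo_subset_dom).aestronglyMeasurable
      measurableSet_Ioo).inner (hA.aestronglyMeasurable_normal i)
  · have hsd := (Γ i).Ioo_subset_dom hs
    have h1 := PlaneCurve.isOuterNormal_normal hA.lipschitz hA.isOpen (hA.trace_subset i) hsd
    refine (norm_inner_le_norm _ _).trans ?_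
    rw [h1.1, mul_one]
    exact hC _ (frontier_subset_closure (PlaneCurve.r_mem_frontier (hA.trace_subset i) hsd))

/-- Divergence theorem: the flux through the curves is the total divergence, up to the flux through
`Γ_D`. -/
theorem exists_flux_estimate (hA : IsAdmissible Ω Γ) : ∃ C : ℝ, ∀ X : Plane → Plane,
    ContDiffOn ℝ 1 X (closure Ω) →
    |(∫ x in Ω, divergence X x) - flux Ω Γ X| ≤ C * ∫ x in GammaD Ω Γ, ‖X x‖ ∂μH[1] := by
  have hloc : ∀ p ∈ closure Ω, ∃ U ∈ 𝓝 p, ∃ C : ℝ, 0 ≤ C ∧ IsOpen U ∧ ∀ X : Plane → Plane,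
      ContDiffOn ℝ 1 X (closure Ω) → tsupport X ⊆ U →
      |(∫ x in Ω, divergence X x) - flux Ω Γ X| ≤ C * ∫ x in GammaD Ω Γ, ‖X x‖ ∂μH[1] := by
    intro p hp
    by_cases hpΩ : p ∈ Ω
    · refine ⟨Ω, hA.isOpen.mem_nhds hpΩ, 0, le_rfl, hA.isOpen, fun X hX hs => ?_⟩
      rw [hA.integral_divergence_eq_zero hX hs, flux, Finset.sum_eq_zero]
      · simp
      · intro i _
        rw [PlaneCurve.ds]
        refine setIntegral_eq_zero_of_forall_eq_zero fun s hs' => ?_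
        have hf := PlaneCurve.r_mem_frontier (hA.trace_subset i) ((Γ i).Ioo_subset_dom hs')
        rw [hA.isOpen.frontier_eq] at hf
        rw [image_eq_zero_of_notMem_tsupport fun h' => hf.2 (hs h'), inner_zero_left]
    · obtain ⟨T, h, K, U, H, hU⟩ := hA.lipschitz.exists_chart
        (by rw [hA.isOpen.frontier_eq]; exact ⟨hp, hpΩ⟩ : p ∈ frontier Ω)
      exact ⟨U, H.isOpen.mem_nhds hU, 1 + K, by positivity, H.isOpen, fun X hX hs =>
        hA.flux_chart_estimate H hX hs⟩
  choose! U hUp C hC0 hUo hUC using hloc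
  obtain ⟨t, htc, ht⟩ := hA.isCompact_closure.elim_nhds_subcover U hUp
  -- Both sides of the local estimates are summed over a partition of unity; since its members are
  -- at most 1, the constants simply add up.
  obtain ⟨f, hf⟩ := SmoothPartitionOfUnity.exists_isSubordinate (modelWithCornersSelf ℝ Plane)
    isClosed_closure (fun p : t => U p) (fun p => hUo p (htc p p.2)) (by
      intro x hx
      obtain ⟨p, hp, hxp⟩ := mem_iUnion₂.1 (ht hx)
      exact mem_iUnion.2 ⟨⟨p, hp⟩, hxp⟩)
  refine ⟨∑ p : t, C p, fun X hX => ?_⟩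
  set Y : t → Plane → Plane := fun p x => f p x • X x with hY
  have hYC : ∀ p, ContDiffOn ℝ 1 (Y p) (closure Ω) := fun p =>
    ((f p).contMDiff.contDiff.of_le (by simp)).contDiffOn.smul hX
  have hYs : ∀ p, tsupport (Y p) ⊆ U p := fun p =>
    (tsupport_smul_subset_left (f p) X).trans (hf p)
  have hsum : ∀ x ∈ closure Ω, X x = ∑ p, Y p x := fun x hx => by
    have := f.sum_eq_one hx
    rw [finsum_eq_sum_of_fintype] at this
    simp only [hY]
    rw [← Finset.sum_smul, this, one_smul]
  have hdiv : ∫ x in Ω, divergence X x = ∑ p, ∫ x in Ω, divergence (Y p) x := by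
    rw [← integral_finsetSum _ fun p _ => hA.integrableOn_divergence (hYC p)]
    refine setIntegral_congr_fun hA.isOpen.measurableSet fun x hx => ?_
    have h1 : X =ᶠ[𝓝 x] fun x => ∑ p, Y p x := by
      filter_upwards [hA.isOpen.mem_nhds hx] with y hy using hsum y (subset_closure hy)
    simp only [divergence]
    rw [h1.fderiv_eq, fderiv_fun_sum fun p _ =>
      (hA.contDiffAt (hYC p) hx).differentiableAt (by norm_num)]
    rw [← map_sum]
    congr 1
    ext v : 1
    simp
  have hflux : flux Ω Γ X = ∑ p, flux Ω Γ (Y p) := by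
    simp only [flux]
    rw [Finset.sum_comm]
    refine Finset.sum_congr rfl fun i _ => ?_
    rw [← integral_finsetSum _ fun p _ => hA.integrable_flux i (hYC p).continuousOn]
    rw [PlaneCurve.ds]
    refine setIntegral_congr_fun measurableSet_Ioo fun s hs => ?_
    rw [hsum _ (frontier_subset_closure (PlaneCurve.r_mem_frontier (hA.trace_subset i)
      ((Γ i).Ioo_subset_dom hs))), sum_inner]
  rw [hdiv, hflux, ← Finset.sum_sub_distrib, Finset.sum_mul]
  refine (Finset.abs_sum_le_sum_abs _ _).trans (Finset.sum_le_sum fun p _ => ?_)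
  refine (hUC p (htc p p.2) (Y p) (hYC p) (hYs p)).trans ?_
  refine mul_le_mul_of_nonneg_left ?_ (hC0 p (htc p p.2))
  refine integral_mono ((hA.integrable_bdry (hYC p).continuousOn).mono_measure gammaD_le_bdry).norm
    ((hA.integrable_bdry hX.continuousOn).mono_measure gammaD_le_bdry).norm fun x => ?_
  simp only [hY, norm_smul, Real.norm_eq_abs, abs_of_nonneg (f.nonneg p x)]
  exact mul_le_of_le_one_left (norm_nonneg _) (f.le_one p x)

end IsAdmissible

end Ventcel

namespace Ventcel

/-! ### Convergence in `L²` -/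

/-- By Hölder's inequality the products with a fixed L² function converge in L¹. -/
lemma tendsto_integral_inner {α E : Type*} [MeasurableSpace α] {μ : Measure α}
    [NormedAddCommGroup E] [InnerProductSpace ℝ E] {F : ℕ → α → E} {f b : α → E}
    (hF : ∀ n, AEStronglyMeasurable (F n) μ) (hf : MemLp f 2 μ) (hb : MemLp b 2 μ)
    (h : Tendsto (fun n => eLpNorm (fun x => F n x - f x) 2 μ) atTop (𝓝 0)) :
    Tendsto (fun n => ∫ x, inner ℝ (F n x) (b x) ∂μ) atTop (𝓝 (∫ x, inner ℝ (f x) (b x) ∂μ)) := by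
  have hdiff : ∀ n, AEStronglyMeasurable (fun x => F n x - f x) μ := fun n => (hF n).sub hf.1
  have hle : ∀ n, eLpNorm (fun x => inner ℝ (F n x - f x) (b x)) 1 μ ≤
      eLpNorm (fun x => F n x - f x) 2 μ * eLpNorm b 2 μ := fun n => by
    have := eLpNorm_le_eLpNorm_mul_eLpNorm_of_nnnorm (p := 2) (q := 2) (r := 1) (hdiff n) hb.1
      (fun x y => inner ℝ x y) 1 (Eventually.of_forall fun x => by
        rw [one_mul]; exact nnnorm_inner_le_nnnorm (𝕜 := ℝ) _ _)
    simpa using this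
  have hlim : Tendsto (fun n => eLpNorm (fun x => F n x - f x) 2 μ * eLpNorm b 2 μ) atTop (𝓝 0) := by
    have := ENNReal.Tendsto.mul_const h (Or.inr hb.2.ne)
    rwa [zero_mul] at this
  have hfb : Integrable (fun x => inner ℝ (f x) (b x)) μ := by
    have := MemLp.integrable_mul (p := 2) (q := 2) hf.norm hb.norm
    exact this.mono' (hf.1.inner hb.1) (Eventually.of_forall fun x => norm_inner_le_norm _ _)
  refine tendsto_integral_of_L1' _ hfb.1 ?_ ?_
  -- `F n` is only assumed measurable; it is in L² as soon as its distance to f is finite.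
  · filter_upwards [h.eventually (gt_mem_nhds ENNReal.zero_lt_top)] with n hn
    have h1 : MemLp (fun x => F n x - f x) 2 μ := ⟨hdiff n, hn⟩
    have h2 : MemLp (F n) 2 μ := by
      have := h1.add hf
      exact this.congr_norm (hF n) (Eventually.of_forall fun x => by simp)
    have := MemLp.integrable_mul (p := 2) (q := 2) h2.norm hb.norm
    exact this.mono' (h2.1.inner hb.1) (Eventually.of_forall fun x => norm_inner_le_norm _ _)
  · refine tendsto_of_tendsto_of_tendsto_of_le_of_le tendsto_const_nhds hlim (fun _ => zero_le) ?_
    intro n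
    exact (eLpNorm_congr_ae (Eventually.of_forall fun x =>
      (inner_sub_left (F n x) (f x) (b x)).symm)).trans_le (hle n)

lemma tendsto_integral_mul {α : Type*} [MeasurableSpace α] {μ : Measure α} {F : ℕ → α → ℝ}
    {f b : α → ℝ} (hF : ∀ n, AEStronglyMeasurable (F n) μ) (hf : MemLp f 2 μ) (hb : MemLp b 2 μ)
    (h : Tendsto (fun n => eLpNorm (fun x => F n x - f x) 2 μ) atTop (𝓝 0)) :
    Tendsto (fun n => ∫ x, F n x * b x ∂μ) atTop (𝓝 (∫ x, f x * b x ∂μ)) := by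
  have h1 : ∀ x y : ℝ, inner ℝ x y = x * y := fun x y => by
    simp [mul_comm]
  have := tendsto_integral_inner hF hf hb h
  simp only [h1] at this
  exact this

/-! ### Calculus in the plane -/

lemma inner_gradient_eq (θ : Plane → ℝ) (x v : Plane) :
    inner ℝ (gradient θ x) v = fderiv ℝ θ x v := by
  rw [gradient, InnerProductSpace.toDual_symm_apply]

lemma divergence_smul {θ : Plane → ℝ} {Y : Plane → Plane} {x : Plane}
    (hθ : DifferentiableAt ℝ θ x) (hY : DifferentiableAt ℝ Y x) :
    divergence (fun y => θ y • Y y) x = θ x * divergence Y x + inner ℝ (gradient θ x) (Y x) := by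
  set T := LinearIsometryEquiv.refl ℝ Plane
  rw [inner_gradient_eq, divergence, divergence, fderiv_fun_smul hθ hY, trace_eq_frame T,
    trace_eq_frame T]
  conv_rhs => rw [eq_frame_sum T (Y x)]
  simp only [add_apply, smul_apply,
    ContinuousLinearMap.smulRight_apply, map_add, map_smul, PiLp.add_apply, PiLp.smul_apply,
    smul_eq_mul]
  ring

lemma gradient_mul {θ η : Plane → ℝ} {x : Plane} (hθ : DifferentiableAt ℝ θ x)
    (hη : DifferentiableAt ℝ η x) :
    gradient (fun y => θ y * η y) x = θ x • gradient η x + η x • gradient θ x := by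
  refine ext_inner_right ℝ fun v => ?_
  rw [inner_add_left, real_inner_smul_left, real_inner_smul_left, inner_gradient_eq,
    inner_gradient_eq, inner_gradient_eq, fderiv_fun_mul hθ hη]
  simp

lemma gradient_sub {θ η : Plane → ℝ} {x : Plane} (hθ : DifferentiableAt ℝ θ x)
    (hη : DifferentiableAt ℝ η x) :
    gradient (fun y => θ y - η y) x = gradient θ x - gradient η x := by
  rw [gradient, fderiv_fun_sub hθ hη, map_sub]; rfl

lemma gradient_add {θ η : Plane → ℝ} {x : Plane} (hθ : DifferentiableAt ℝ θ x)
    (hη : DifferentiableAt ℝ η x) :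
    gradient (fun y => θ y + η y) x = gradient θ x + gradient η x := by
  rw [gradient, fderiv_fun_add hθ hη, map_add]; rfl

/-- The gradient within a set. -/
noncomputable def gradientOn (S : Set Plane) (u : Plane → ℝ) (x : Plane) : Plane :=
  (InnerProductSpace.toDual ℝ Plane).symm (fderivWithin ℝ u S x)

lemma inner_gradientOn (S : Set Plane) (u : Plane → ℝ) (x v : Plane) :
    inner ℝ (gradientOn S u x) v = fderivWithin ℝ u S x v := by
  rw [gradientOn, InnerProductSpace.toDual_symm_apply]

variable {N : ℕ} {Ω : Set Plane} {Γ : Fin N → PlaneCurve}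

namespace IsAdmissible

lemma gradientOn_eq (hA : IsAdmissible Ω Γ) (u : Plane → ℝ) {x : Plane} (hx : x ∈ Ω) :
    gradientOn (closure Ω) u x = gradient u x := by
  rw [gradientOn, hA.fderivWithin_eq u hx, gradient]

lemma contDiffOn_gradientOn (hA : IsAdmissible Ω Γ) {u : Plane → ℝ} {m n : WithTop ℕ∞}
    (hu : ContDiffOn ℝ n u (closure Ω)) (hmn : m + 1 ≤ n) :
    ContDiffOn ℝ m (gradientOn (closure Ω) u) (closure Ω) :=
  (InnerProductSpace.toDual ℝ Plane).symm.contDiff.comp_contDiffOn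
    (hu.fderivWithin hA.uniqueDiffOn hmn)

/-- Both sides are the trace of the second derivative in an orthonormal basis. Inside Ω the
derivative within the closure is the ordinary one. -/
lemma divergence_gradientOn (hA : IsAdmissible Ω Γ) {u : Plane → ℝ}
    (hu : ContDiffOn ℝ 2 u (closure Ω)) {x : Plane} (hx : x ∈ Ω) :
    divergence (gradientOn (closure Ω) u) x = Laplacian.laplacian u x := by
  have h1 : gradientOn (closure Ω) u =ᶠ[𝓝 x] fun y =>
      (InnerProductSpace.toDual ℝ Plane).symm (fderiv ℝ u y) := by
    filter_upwards [hA.isOpen.mem_nhds hx] with y hy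
    rw [hA.gradientOn_eq u hy, gradient]
  have h2 : DifferentiableAt ℝ (fderiv ℝ u) x :=
    ((hA.contDiffAt hu hx).fderiv_right (m := 1) (by norm_num)).differentiableAt (by norm_num)
  have h3 : HasFDerivAt (fun y => (InnerProductSpace.toDual ℝ Plane).symm (fderiv ℝ u y))
      (((InnerProductSpace.toDual ℝ Plane).symm.toContinuousLinearEquiv.toContinuousLinearMap).comp
        (fderiv ℝ (fderiv ℝ u) x)) x :=
    ((InnerProductSpace.toDual ℝ Plane).symm.toContinuousLinearEquiv.hasFDerivAt).comp x
      h2.hasFDerivAt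
  rw [divergence, h1.fderiv_eq, h3.fderiv, LinearMap.trace_eq_sum_inner _
    (stdOrthonormalBasis ℝ Plane),
    InnerProductSpace.laplacian_eq_iteratedFDeriv_stdOrthonormalBasis]
  refine Finset.sum_congr rfl fun i _ => ?_
  rw [iteratedFDeriv_two_apply, real_inner_comm]
  change inner ℝ ((InnerProductSpace.toDual ℝ Plane).symm _) _ = _
  rw [InnerProductSpace.toDual_symm_apply]
  simp

variable {ψ : Plane → ℝ}

lemma memLp_volume (hA : IsAdmissible Ω Γ) {F : Type*} [NormedAddCommGroup F] {X : Plane → F}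
    {p : ℝ≥0∞} (hX : ContinuousOn X (closure Ω)) : MemLp X p (volume.restrict Ω) := by
  obtain ⟨C, hC⟩ := hA.isCompact_closure.exists_bound_of_continuousOn hX
  exact memLp_of_bounded_on hA.isOpen.measurableSet hA.volume_lt_top.ne
    ((hX.mono subset_closure).aestronglyMeasurable hA.isOpen.measurableSet)
    fun x hx => hC x (subset_closure hx)

lemma memLp_bdry (hA : IsAdmissible Ω Γ) {F : Type*} [NormedAddCommGroup F] {X : Plane → F}
    {p : ℝ≥0∞} (hX : ContinuousOn X (closure Ω)) : MemLp X p (bdry Ω) := by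
  obtain ⟨C, hC⟩ := hA.isCompact_closure.exists_bound_of_continuousOn hX
  exact memLp_of_bounded_on isClosed_frontier.measurableSet
    hA.hausdorffMeasure_frontier_lt_top.ne
    ((hX.mono frontier_subset_closure).aestronglyMeasurable isClosed_frontier.measurableSet)
    fun x hx => hC x (frontier_subset_closure hx)

lemma memLp_gradient (hA : IsAdmissible Ω Γ) {p : ℝ≥0∞} (hψ : ContDiffOn ℝ 1 ψ (closure Ω)) :
    MemLp (gradient ψ) p (volume.restrict Ω) := by
  have h1 := hA.memLp_volume (p := p) (hA.contDiffOn_gradientOn (m := 0) hψ (by simp)).continuousOn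
  refine h1.ae_eq ((ae_restrict_iff' hA.isOpen.measurableSet).2 (Eventually.of_forall fun x hx => ?_))
  exact hA.gradientOn_eq ψ hx

lemma differentiableAt (hA : IsAdmissible Ω Γ) (hψ : ContDiffOn ℝ 1 ψ (closure Ω)) {x : Plane}
    (hx : x ∈ Ω) : DifferentiableAt ℝ ψ x :=
  (hA.contDiffAt hψ hx).differentiableAt (by norm_num)

/-- Classical derivatives are weak derivatives. -/
lemma memH1 (hA : IsAdmissible Ω Γ) (hψ : ContDiffOn ℝ 1 ψ (closure Ω)) :
    MemH1 Ω ψ (gradient ψ) := by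
  refine ⟨hA.memLp_volume hψ.continuousOn, hA.memLp_gradient hψ, fun η hη _ hηs => ?_⟩
  have hηC : ContDiffOn ℝ 1 η (closure Ω) := hη.contDiffOn
  have hi : ∀ a b : Plane → ℝ, ContDiffOn ℝ 1 a (closure Ω) → ContDiffOn ℝ 1 b (closure Ω) →
      Integrable (fun x => a x • gradient b x) (volume.restrict Ω) := by
    intro a b ha hb
    have h1 := hA.memLp_volume (p := 1) (ha.continuousOn.smul
      (hA.contDiffOn_gradientOn (m := 0) hb (by simp)).continuousOn)
    refine (memLp_one_iff_integrable.1 h1).congr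
      ((ae_restrict_iff' hA.isOpen.measurableSet).2 (Eventually.of_forall fun x hx => ?_))
    rw [Pi.smul_apply', hA.gradientOn_eq b hx]
  rw [eq_neg_iff_add_eq_zero, ← integral_add (hi _ _ hψ hηC) (hi _ _ hηC hψ)]
  refine ext_inner_right ℝ fun v => ?_
  have hsum : Integrable (fun x => ψ x • gradient η x + η x • gradient ψ x) (volume.restrict Ω) :=
    (hi _ _ hψ hηC).add (hi _ _ hηC hψ)
  rw [inner_zero_left, real_inner_comm, ← integral_inner hsum]
  -- The vector identity is tested against a constant v: the divergence of (ψη)v is the v-component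
  -- of the gradient of ψη.
  have h2 := hA.integral_divergence_eq_zero (X := fun x => (ψ x * η x) • v)
    ((hψ.mul hηC).smul contDiffOn_const)
    ((tsupport_smul_subset_left (fun x => ψ x * η x) _).trans
      ((tsupport_mul_subset_right).trans hηs))
  rw [← h2]
  refine setIntegral_congr_fun hA.isOpen.measurableSet fun x hx => ?_
  have hd1 := hA.differentiableAt hψ hx
  have hd2 := hA.differentiableAt hηC hx
  rw [divergence_smul (θ := fun x => ψ x * η x) (hd1.mul hd2) (differentiableAt_const v), gradient_mul hd1 hd2,
    real_inner_comm]
  simp [divergence]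

end IsAdmissible

/-- Weak gradients are unique. -/
lemma MemH1.ae_eq {u : Plane → ℝ} {D₁ D₂ : Plane → Plane} (hΩ : IsOpen Ω)
    (hf : IsFiniteMeasure (volume.restrict Ω : Measure Plane)) (h1 : MemH1 Ω u D₁)
    (h2 : MemH1 Ω u D₂) : D₁ =ᵐ[volume.restrict Ω] D₂ := by
  have i1 : IntegrableOn D₁ Ω := h1.2.1.integrable (by norm_num)
  have i2 : IntegrableOn D₂ Ω := h2.2.1.integrable (by norm_num)
  have key := hΩ.ae_eq_zero_of_integral_contDiff_smul_eq_zero (f := fun x => D₁ x - D₂ x)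
    (μ := volume) (IntegrableOn.locallyIntegrableOn (i1.sub i2)) ?_
  · refine (ae_restrict_iff' hΩ.measurableSet).2 ?_
    filter_upwards [key] with x hx hxΩ
    exact sub_eq_zero.1 (hx hxΩ)
  · intro η hη hηc hηs
    have e1 := h1.2.2 η (hη.of_le (by simp)) hηc hηs
    have e2 := h2.2.2 η (hη.of_le (by simp)) hηc hηs
    rw [e1, neg_inj] at e2
    obtain ⟨C, hC⟩ := hηc.exists_bound_of_continuous hη.continuous
    have hi : ∀ D : Plane → Plane, IntegrableOn D Ω → IntegrableOn (fun x => η x • D x) Ω :=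
      fun D hD => hD.bdd_smul C hη.continuous.aestronglyMeasurable (Eventually.of_forall hC)
    rw [← setIntegral_eq_integral_of_forall_compl_eq_zero (s := Ω) fun x hx => by
      rw [image_eq_zero_of_notMem_tsupport fun h' => hx (hηs h'), zero_smul]]
    simp only [smul_sub]
    rw [integral_sub (hi _ i1) (hi _ i2), e2, sub_self]

end Ventcel

namespace Ventcel

variable {N : ℕ} {Ω : Set Plane} {Γ : Fin N → PlaneCurve}

/-! ### Traces -/

lemma IsTrace.add (hΩ : IsOpen Ω) {v v' : Plane → ℝ} {Dv Dv' : Plane → Plane} {t t' : Plane → ℝ}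
    (hv : MemH1 Ω v Dv) (hv' : MemH1 Ω v' Dv') (h : IsTrace Ω v Dv t) (h' : IsTrace Ω v' Dv' t') :
    IsTrace Ω (fun x => v x + v' x) (fun x => Dv x + Dv' x) (fun x => t x + t' x) := by
  obtain ⟨ht, ψ, hψ, h1, h2, h3⟩ := h
  obtain ⟨ht', ψ', hψ', h1', h2', h3'⟩ := h'
  have hm : MeasurableSet Ω := hΩ.measurableSet
  have hgm : ∀ θ : Plane → ℝ, ContDiffOn ℝ 1 θ (closure Ω) →
      AEStronglyMeasurable (gradient θ) (volume.restrict Ω) := fun θ hθ =>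
    (((InnerProductSpace.toDual ℝ Plane).symm.continuous.comp_continuousOn
      ((hθ.mono subset_closure).continuousOn_fderiv_of_isOpen hΩ (by norm_num))).congr
        fun x _ => rfl).aestronglyMeasurable hm
  have hadd : ∀ {a b : ℕ → ℝ≥0∞} {c : ℕ → ℝ≥0∞}, Tendsto a atTop (𝓝 0) → Tendsto b atTop (𝓝 0) →
      (∀ n, c n ≤ a n + b n) → Tendsto c atTop (𝓝 0) := by
    intro a b c ha hb hc
    have := ha.add hb
    rw [add_zero] at this
    exact tendsto_of_tendsto_of_tendsto_of_le_of_le tendsto_const_nhds this (fun _ => zero_le) hc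
  refine ⟨ht.add ht', fun n x => ψ n x + ψ' n x, fun n => (hψ n).add (hψ' n), hadd h1 h1' fun n => ?_,
    hadd h2 h2' fun n => ?_, hadd h3 h3' fun n => ?_⟩
  · refine le_trans (le_of_eq ?_) (eLpNorm_add_le
      ((((hψ n).continuousOn.mono subset_closure).aestronglyMeasurable hm).sub hv.1.1)
      ((((hψ' n).continuousOn.mono subset_closure).aestronglyMeasurable hm).sub hv'.1.1) (by simp))
    refine eLpNorm_congr_ae (Eventually.of_forall fun x => ?_)
    simp only [Pi.add_apply]; ring
  · refine le_trans (le_of_eq ?_) (eLpNorm_add_le ((hgm _ (hψ n)).sub hv.2.1.1)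
      ((hgm _ (hψ' n)).sub hv'.2.1.1) (by simp))
    refine eLpNorm_congr_ae ((ae_restrict_iff' hm).2 (Eventually.of_forall fun x hx => ?_))
    have hd : ∀ θ : Plane → ℝ, ContDiffOn ℝ 1 θ (closure Ω) → DifferentiableAt ℝ θ x := fun θ hθ =>
      (hθ.contDiffAt (mem_of_superset (hΩ.mem_nhds hx) subset_closure)).differentiableAt
        (by norm_num)
    simp only [Pi.add_apply, gradient_add (hd _ (hψ n)) (hd _ (hψ' n))]
    abel
  · have hfm : MeasurableSet (frontier Ω) := isClosed_frontier.measurableSet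
    refine le_trans (le_of_eq ?_) (eLpNorm_add_le
      ((((hψ n).continuousOn.mono frontier_subset_closure).aestronglyMeasurable hfm).sub ht.1)
      ((((hψ' n).continuousOn.mono frontier_subset_closure).aestronglyMeasurable hfm).sub ht'.1)
      (by simp))
    refine eLpNorm_congr_ae (Eventually.of_forall fun x => ?_)
    simp only [Pi.add_apply]; ring

lemma MemH1.add {v v' : Plane → ℝ} {Dv Dv' : Plane → Plane}
    (hf : IsFiniteMeasure (volume.restrict Ω : Measure Plane))
    (hv : MemH1 Ω v Dv) (hv' : MemH1 Ω v' Dv') :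
    MemH1 Ω (fun x => v x + v' x) (fun x => Dv x + Dv' x) := by
  refine ⟨hv.1.add hv'.1, hv.2.1.add hv'.2.1, fun η hη hηc hηs => ?_⟩
  have hgc : Continuous (gradient η) :=
    (InnerProductSpace.toDual ℝ Plane).symm.continuous.comp (hη.continuous_fderiv (by norm_num))
  have hgs : HasCompactSupport (gradient η) :=
    (hηc.fderiv ℝ).comp_left (g := (InnerProductSpace.toDual ℝ Plane).symm) (map_zero _)
  obtain ⟨C, hC⟩ := hgs.exists_bound_of_continuous hgc
  obtain ⟨C', hC'⟩ := hηc.exists_bound_of_continuous hη.continuous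
  have i1 : ∀ a : Plane → ℝ, MemLp a 2 (volume.restrict Ω) →
      Integrable (fun x => a x • gradient η x) (volume.restrict Ω) := fun a ha =>
    (ha.integrable (by norm_num)).smul_bdd C hgc.aestronglyMeasurable (Eventually.of_forall hC)
  have i2 : ∀ D : Plane → Plane, MemLp D 2 (volume.restrict Ω) →
      Integrable (fun x => η x • D x) (volume.restrict Ω) := fun D hD =>
    (hD.integrable (by norm_num)).bdd_smul C' hη.continuous.aestronglyMeasurable
      (Eventually.of_forall hC')
  simp only [add_smul, smul_add]
  rw [integral_add (i1 _ hv.1) (i1 _ hv'.1), integral_add (i2 _ hv.2.1) (i2 _ hv'.2.1),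
    hv.2.2 η hη hηc hηs, hv'.2.2 η hη hηc hηs]
  abel

namespace IsAdmissible

/-- Boundary length is locally bounded by a multiple of the coordinate measure, and a locally null
set is null; so almost everywhere statements on ∂Ω may be checked in charts. -/
lemma ae_bdry_of_chart (hA : IsAdmissible Ω Γ) {P : Plane → Prop}
    (hP : ∀ T h K U, GraphChart Ω T h K U →
      ∀ᵐ x ∂(volume.restrict (graphMap T h ⁻¹' U)), P (graphMap T h x)) :
    ∀ᵐ x ∂(bdry Ω), P x := by
  rw [bdry, ae_restrict_iff' isClosed_frontier.measurableSet, ae_iff]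
  refine measure_null_of_locally_null _ fun p hp => ?_
  have hpf : p ∈ frontier Ω := by by_contra h'; exact hp fun h'' => absurd h'' h'
  obtain ⟨T, h, K, U, H, hU⟩ := hA.lipschitz.exists_chart hpf
  refine ⟨_, inter_mem_nhdsWithin _ (H.isOpen.mem_nhds hU), ?_⟩
  have h1 := H.hausdorffMeasure_le hA.isOpen {x | ¬ P x}
  have h2 : volume (graphMap T h ⁻¹' ({x | ¬ P x} ∩ U)) = 0 := by
    have h3 := hP T h K U H
    rw [ae_restrict_iff' (H.continuous_graphMap.measurable H.isOpen.measurableSet), ae_iff] at h3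
    refine measure_mono_null (fun x hx => ?_) h3
    exact fun h' => hx.1 (h' hx.2)
  rw [h2, mul_zero] at h1
  refine measure_mono_null (fun x hx => ?_) (nonpos_iff_eq_zero.1 h1)
  have hx1 : x ∈ frontier Ω := by by_contra h'; exact hx.1 fun h'' => absurd h'' h'
  exact ⟨fun h' => hx.1 fun _ => h', hx1, hx.2⟩

/-- A sequence of `C¹` functions which tends to zero in `H¹` can only have the trace zero. -/
theorem trace_eq_zero (hA : IsAdmissible Ω Γ) {θ : ℕ → Plane → ℝ} {τ : Plane → ℝ}
    (hθ : ∀ n, ContDiffOn ℝ 1 (θ n) (closure Ω))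
    (h0 : Tendsto (fun n => eLpNorm (θ n) 2 (volume.restrict Ω)) atTop (𝓝 0))
    (h1 : Tendsto (fun n => eLpNorm (gradient (θ n)) 2 (volume.restrict Ω)) atTop (𝓝 0))
    (hτ : MemLp τ 2 (bdry Ω))
    (h2 : Tendsto (fun n => eLpNorm (fun x => θ n x - τ x) 2 (bdry Ω)) atTop (𝓝 0)) :
    ∀ᵐ x ∂(bdry Ω), τ x = 0 := by
  have hfin := hA.isFiniteMeasure_bdry
  refine hA.ae_bdry_of_chart fun T h K U H => ?_
  have hgm := H.continuous_graphMap.measurable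
  -- The coordinate measure transported to the boundary. It is dominated by length, so the L²
  -- convergence carries over to it.
  set μ : Measure Plane := (volume.restrict (graphMap T h ⁻¹' U)).map (graphMap T h) with hμ
  have hμle : μ ≤ bdry Ω := by
    have := H.map_graphMap_le (U ∩ frontier Ω)
    rw [show graphMap T h ⁻¹' (U ∩ frontier Ω) = graphMap T h ⁻¹' U from Set.ext fun x =>
      ⟨fun hx => hx.1, fun hx => ⟨hx, H.graphMap_mem_frontier hA.isOpen hx⟩⟩] at this
    exact this.trans (Measure.restrict_mono inter_subset_right le_rfl)
  have hμfin : IsFiniteMeasure μ := isFiniteMeasure_of_le _ hμle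
  have hτμ : MemLp τ 2 μ := hτ.mono_measure hμle
  have h2μ : Tendsto (fun n => eLpNorm (fun x => θ n x - τ x) 2 μ) atTop (𝓝 0) :=
    tendsto_of_tendsto_of_tendsto_of_le_of_le tendsto_const_nhds h2 (fun _ => zero_le)
      fun n => eLpNorm_mono_measure _ hμle
  have hθμ : ∀ n, AEStronglyMeasurable (θ n) μ := fun n =>
    (hA.memLp_bdry (p := 2) (hθ n).continuousOn).1.mono_measure hμle
  have key := H.isOpen.ae_eq_zero_of_integral_contDiff_smul_eq_zero (f := τ) (μ := μ)
    ((hτμ.integrable (by norm_num)).locallyIntegrable.locallyIntegrableOn U) ?_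
  · have h3 := ae_of_ae_map hgm.aemeasurable key
    filter_upwards [h3, ae_restrict_mem (hgm H.isOpen.measurableSet)] with x hx hxU
    exact hx hxU
  · intro g hg hgc hgs
    have hg1 : ContDiff ℝ 1 g := hg.of_le (by simp)
    -- A vertical field: the term with h' disappears from the chart formula and the boundary
    -- integral is −∫ θₙ g dμ.
    set Y : Plane → Plane := fun x => g x • frame T 1 with hY
    have hYC : ContDiffOn ℝ 1 Y (closure Ω) := (hg1.smul contDiff_const).contDiffOn
    have hgμ : MemLp g 2 μ := hg1.continuous.memLp_of_hasCompactSupport hgc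
    have hl1 := tendsto_integral_mul hθμ hτμ hgμ h2μ
    have heq : ∀ n, ∫ x, θ n x * g x ∂μ = -∫ x in Ω, divergence (fun y => θ n y • Y y) x := by
      intro n
      have hs : tsupport (fun y => θ n y • Y y) ⊆ U :=
        (tsupport_smul_subset_right _ _).trans ((tsupport_smul_subset_left _ _).trans hgs)
      rw [hA.integral_divergence_chart (X := fun y => θ n y • Y y) H ((hθ n).smul hYC) hs, hμ,
        integral_map (f := fun x => θ n x * g x) hgm.aemeasurable ((hθμ n).mul hgμ.1),
        ← integral_neg,
        setIntegral_eq_integral_of_forall_compl_eq_zero fun x hx => by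
          rw [image_eq_zero_of_notMem_tsupport (f := g) fun h' => hx (hgs h'), mul_zero]]
      refine integral_congr_ae (Eventually.of_forall fun x => ?_)
      simp [hY]
    -- The divergence is θₙ div Y + ∇θₙ · Y, and both θₙ and ∇θₙ tend to zero in L².
    have hl2 : Tendsto (fun n => ∫ x in Ω, divergence (fun y => θ n y • Y y) x) atTop (𝓝 0) := by
      have hdivY : MemLp (divergence Y) 2 (volume.restrict Ω) := by
        obtain ⟨C, -, -, hC⟩ := hA.exists_bound hYC
        exact memLp_of_bounded_on (C := 2 * C) hA.isOpen.measurableSet hA.volume_lt_top.ne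
          ((continuous_trace.comp_continuousOn (hA.continuousOn_fderiv hYC)).aestronglyMeasurable
            hA.isOpen.measurableSet)
          (fun x hx => (abs_trace_le _).trans (by linarith [hC x hx]))
      have hYL : MemLp Y 2 (volume.restrict Ω) := hA.memLp_volume hYC.continuousOn
      have hθL : ∀ n, MemLp (θ n) 2 (volume.restrict Ω) := fun n =>
        hA.memLp_volume (hθ n).continuousOn
      have hgL : ∀ n, MemLp (gradient (θ n)) 2 (volume.restrict Ω) := fun n =>
        hA.memLp_gradient (hθ n)
      have l1 := tendsto_integral_mul (f := fun _ => (0 : ℝ)) (fun n => (hθL n).1) MemLp.zero' hdivY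
        (by simpa using h0)
      have l2 := tendsto_integral_inner (f := fun _ => (0 : Plane)) (fun n => (hgL n).1) MemLp.zero'
        hYL (by simpa using h1)
      have l3 := l1.add l2
      simp only [zero_mul, inner_zero_left, integral_zero, add_zero] at l3
      refine l3.congr fun n => ?_
      rw [← integral_add]
      · refine setIntegral_congr_fun hA.isOpen.measurableSet fun x hx => ?_
        exact (divergence_smul (hA.differentiableAt (hθ n) hx)
          ((hA.contDiffAt hYC hx).differentiableAt (by norm_num))).symm
      · exact (hθL n).integrable_mul hdivY
      · exact (MemLp.integrable_mul (p := 2) (q := 2) (hgL n).norm hYL.norm).mono'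
          ((hgL n).1.inner hYL.1) (Eventually.of_forall fun x => norm_inner_le_norm _ _)
    have hl3 := hl2.neg
    rw [neg_zero] at hl3
    simp only [heq] at hl1
    have := tendsto_nhds_unique hl1 hl3
    rw [← this]
    exact integral_congr_ae (Eventually.of_forall fun x => by simp only [smul_eq_mul]; ring)

/-- The trace of a function which is `C¹` up to the boundary is its restriction. -/
theorem trace_eq (hA : IsAdmissible Ω Γ) {u t : Plane → ℝ} {Du : Plane → Plane}
    (hu : ContDiffOn ℝ 1 u (closure Ω)) (h : MemH1 Ω u Du) (ht : IsTrace Ω u Du t) :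
    ∀ᵐ x ∂(bdry Ω), t x = u x := by
  obtain ⟨htL, ψ, hψ, h0, h1, h2⟩ := ht
  have hDu := h.ae_eq hA.isOpen hA.isFiniteMeasure_volume (hA.memH1 hu)
  have key := hA.trace_eq_zero (θ := fun n x => ψ n x - u x) (τ := fun x => t x - u x)
    (fun n => (hψ n).sub hu) h0 ?_ (htL.sub (hA.memLp_bdry hu.continuousOn)) ?_
  · filter_upwards [key] with x hx using sub_eq_zero.1 hx
  · refine h1.congr fun n => eLpNorm_congr_ae ?_
    filter_upwards [hDu, ae_restrict_mem hA.isOpen.measurableSet] with x hx hxΩ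
    rw [gradient_sub (hA.differentiableAt (hψ n) hxΩ) (hA.differentiableAt hu hxΩ), hx]
  · simpa using h2

lemma isTrace_self (hA : IsAdmissible Ω Γ) {u : Plane → ℝ}
    (hu : ContDiffOn ℝ 1 u (closure Ω)) : IsTrace Ω u (gradient u) u :=
  ⟨hA.memLp_bdry hu.continuousOn, fun _ => u, fun _ => hu, by simp, by simp, by simp⟩

lemma exists_map_ds_le (hA : IsAdmissible Ω Γ) (i : Fin N) :
    ∃ C : ℝ≥0, (Γ i).ds.map (Γ i).r ≤ C • bdry Ω := by
  obtain ⟨C, hC⟩ := (Γ i).exists_map_ds_le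
  refine ⟨C, hC.trans ?_⟩
  exact smul_le_smul_left C (Measure.restrict_mono (hA.trace_subset i) le_rfl)

lemma ae_ds_of_ae_bdry (hA : IsAdmissible Ω Γ) (i : Fin N) {P : Plane → Prop}
    (h : ∀ᵐ x ∂(bdry Ω), P x) : ∀ᵐ s ∂(Γ i).ds, P ((Γ i).r s) := by
  obtain ⟨C, hC⟩ := hA.exists_map_ds_le i
  refine ae_of_ae_map (Γ i).aemeasurable_r ?_
  exact (Measure.absolutelyContinuous_of_le_smul (c := (C : ℝ≥0∞)) hC).ae_le h

/-- Arc length on a curve is dominated by boundary length, so passing to the arc length parameter is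
bounded from L²(∂Ω). Convergence of traces is thereby inherited by the curves. -/
lemma exists_eLpNorm_comp_le (hA : IsAdmissible Ω Γ) (i : Fin N) : ∃ C : ℝ≥0∞, C ≠ ⊤ ∧
    ∀ F : Plane → ℝ, AEStronglyMeasurable F (bdry Ω) →
      AEStronglyMeasurable (fun s => F ((Γ i).r s)) (Γ i).ds ∧
      eLpNorm (fun s => F ((Γ i).r s)) 2 (Γ i).ds ≤ C * eLpNorm F 2 (bdry Ω) := by
  obtain ⟨C, hC⟩ := hA.exists_map_ds_le i
  refine ⟨(C : ℝ≥0∞) ^ (1 / (2 : ℝ≥0∞)).toReal, by simp, fun F hF => ?_⟩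
  have hF' : AEStronglyMeasurable F ((Γ i).ds.map (Γ i).r) :=
    hF.mono_ac (Measure.absolutelyContinuous_of_le_smul (c := (C : ℝ≥0∞)) hC)
  refine ⟨hF'.comp_aemeasurable (Γ i).aemeasurable_r, ?_⟩
  have h1 : eLpNorm (fun s => F ((Γ i).r s)) 2 (Γ i).ds = eLpNorm F 2 ((Γ i).ds.map (Γ i).r) :=
    (eLpNorm_map_measure hF' (Γ i).aemeasurable_r).symm
  rw [h1]
  refine (eLpNorm_mono_measure F hC).trans ?_
  have := eLpNorm_smul_measure_of_ne_top (p := 2) (by simp) (f := F) (μ := bdry Ω) (C : ℝ≥0∞)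
  rw [smul_eq_mul] at this
  exact le_of_eq this

lemma memLp_comp_r (hA : IsAdmissible Ω Γ) (i : Fin N) {F : Plane → ℝ} (hF : MemLp F 2 (bdry Ω)) :
    MemLp (fun s => F ((Γ i).r s)) 2 (Γ i).ds := by
  obtain ⟨C, hC, h⟩ := hA.exists_eLpNorm_comp_le i
  exact ⟨(h F hF.1).1, (h F hF.1).2.trans_lt (ENNReal.mul_lt_top hC.lt_top hF.2)⟩

/-- Second derivatives extend continuously to the compact closure and are bounded. This also yields
f ∈ L² from the pointwise equation. -/
lemma memLp_laplacian (hA : IsAdmissible Ω Γ) {u : Plane → ℝ}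
    (hu : ContDiffOn ℝ 2 u (closure Ω)) :
    MemLp (Laplacian.laplacian u) 2 (volume.restrict Ω) := by
  have hGC : ContDiffOn ℝ 1 (gradientOn (closure Ω) u) (closure Ω) :=
    hA.contDiffOn_gradientOn hu (by norm_num)
  obtain ⟨C', -, -, hC'⟩ := hA.exists_bound hGC
  have : MemLp (divergence (gradientOn (closure Ω) u)) 2 (volume.restrict Ω) :=
    memLp_of_bounded_on (C := 2 * C') hA.isOpen.measurableSet hA.volume_lt_top.ne
      ((continuous_trace.comp_continuousOn (hA.continuousOn_fderiv hGC)).aestronglyMeasurable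
        hA.isOpen.measurableSet)
      (fun x hx => (abs_trace_le _).trans (by linarith [hC' x hx]))
  exact this.ae_eq ((ae_restrict_iff' hA.isOpen.measurableSet).2
    (Eventually.of_forall fun x hx => hA.divergence_gradientOn hu hx))

/-- Green's formula for functions in `H¹` whose trace vanishes on `Γ_D`. -/
theorem green (hA : IsAdmissible Ω Γ) {u w t : Plane → ℝ} {Dw : Plane → Plane}
    (hu : ContDiffOn ℝ 2 u (closure Ω)) (hw : MemH1 Ω w Dw) (ht : IsTrace Ω w Dw t)
    (h0 : ∀ᵐ x ∂(μH[1].restrict (GammaD Ω Γ)), t x = 0) :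
    (∫ x in Ω, w x * Laplacian.laplacian u x) + ∫ x in Ω, inner ℝ (Dw x) (gradient u x) =
      ∑ i, ∫ s, t ((Γ i).r s) *
        fderivWithin ℝ u (closure Ω) ((Γ i).r s) ((Γ i).normal Ω s) ∂(Γ i).ds := by
  obtain ⟨C, hC⟩ := hA.exists_flux_estimate
  obtain ⟨htL, ψ, hψ, h1, h2, h3⟩ := ht
  set G := gradientOn (closure Ω) u with hG
  have hGC : ContDiffOn ℝ 1 G (closure Ω) := hA.contDiffOn_gradientOn hu (by norm_num)
  have hu1 : ContDiffOn ℝ 1 u (closure Ω) := hu.of_le (by norm_num)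
  have hlap := hA.memLp_laplacian hu
  have hgu : MemLp (gradient u) 2 (volume.restrict Ω) := hA.memLp_gradient hu1
  have hψL : ∀ n, MemLp (ψ n) 2 (volume.restrict Ω) := fun n => hA.memLp_volume (hψ n).continuousOn
  have hψg : ∀ n, MemLp (gradient (ψ n)) 2 (volume.restrict Ω) := fun n => hA.memLp_gradient (hψ n)
  have hψb : ∀ n, MemLp (ψ n) 2 (bdry Ω) := fun n => hA.memLp_bdry (hψ n).continuousOn
  have l1 := tendsto_integral_mul (fun n => (hψL n).1) hw.1 hlap h1
  have l2 := tendsto_integral_inner (fun n => (hψg n).1) hw.2.1 hgu h2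
  -- The product rule for the fields ψₙ ∇u, to which the flux estimate will be applied.
  have e12 : ∀ n, (∫ x in Ω, ψ n x * Laplacian.laplacian u x) +
      ∫ x in Ω, inner ℝ (gradient (ψ n) x) (gradient u x) =
      ∫ x in Ω, divergence (fun y => ψ n y • G y) x := fun n => by
    rw [← integral_add]
    · refine setIntegral_congr_fun hA.isOpen.measurableSet fun x hx => ?_
      rw [divergence_smul (hA.differentiableAt (hψ n) hx)
        ((hA.contDiffAt hGC hx).differentiableAt (by norm_num)), hA.divergence_gradientOn hu hx,
        hG, hA.gradientOn_eq u hx]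
    · exact (hψL n).integrable_mul hlap
    · exact (MemLp.integrable_mul (p := 2) (q := 2) (hψg n).norm hgu.norm).mono'
        ((hψg n).1.inner hgu.1) (Eventually.of_forall fun x => norm_inner_le_norm _ _)
  have l12 := l1.add l2
  simp only [e12] at l12
  have l3 : Tendsto (fun n => flux Ω Γ (fun y => ψ n y • G y)) atTop (𝓝 (∑ i, ∫ s, t ((Γ i).r s) *
      fderivWithin ℝ u (closure Ω) ((Γ i).r s) ((Γ i).normal Ω s) ∂(Γ i).ds)) := by
    simp only [flux, real_inner_smul_left, hG, inner_gradientOn]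
    refine tendsto_finsetSum _ fun i _ => ?_
    obtain ⟨C', hC', hle⟩ := hA.exists_eLpNorm_comp_le i
    refine tendsto_integral_mul (fun n => (hle _ (hψb n).1).1) (hA.memLp_comp_r i htL) ?_ ?_
    · obtain ⟨B, -, hB, -⟩ := hA.exists_bound hGC
      refine memLp_of_bounded_on (C := B) measurableSet_Ioo (by simp) ?_ fun s hs => ?_
      · have := (hA.integrable_flux i hGC.continuousOn).1
        simp only [hG, inner_gradientOn] at this
        exact this
      · have hsd := (Γ i).Ioo_subset_dom hs
        have h1 := PlaneCurve.isOuterNormal_normal hA.lipschitz hA.isOpen (hA.trace_subset i) hsd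
        rw [← inner_gradientOn]
        refine (norm_inner_le_norm _ _).trans ?_
        rw [h1.1, mul_one]
        exact hB _ (frontier_subset_closure (PlaneCurve.r_mem_frontier (hA.trace_subset i) hsd))
    · have := ENNReal.Tendsto.const_mul (a := C') h3 (Or.inr hC')
      rw [mul_zero] at this
      exact tendsto_of_tendsto_of_tendsto_of_le_of_le tendsto_const_nhds this (fun _ => zero_le)
        fun n => (hle (fun x => ψ n x - t x) ((hψb n).1.sub htL.1)).2
  -- On Γ_D the approximations tend to the trace t = 0 in L², so the error of the flux estimate
  -- disappears in the limit.
  have l4 : Tendsto (fun n => C * ∫ x in GammaD Ω Γ, ‖ψ n x • G x‖ ∂μH[1]) atTop (𝓝 0) := by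
    have hGL : MemLp (fun x => ‖G x‖) 2 (μH[1].restrict (GammaD Ω Γ)) :=
      (hA.memLp_bdry hGC.continuousOn).norm.mono_measure gammaD_le_bdry
    have htD : MemLp (fun x => ‖t x‖) 2 (μH[1].restrict (GammaD Ω Γ)) :=
      htL.norm.mono_measure gammaD_le_bdry
    have := tendsto_integral_mul (F := fun n x => ‖ψ n x‖)
      (fun n => (hψb n).1.norm.mono_measure gammaD_le_bdry) htD hGL
      (tendsto_of_tendsto_of_tendsto_of_le_of_le tendsto_const_nhds h3 (fun _ => zero_le)
        fun n => (eLpNorm_mono_measure _ gammaD_le_bdry).trans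
          (eLpNorm_mono fun x => abs_norm_sub_norm_le _ _))
    have hz : ∫ x in GammaD Ω Γ, ‖t x‖ * ‖G x‖ ∂μH[1] = 0 := by
      refine integral_eq_zero_of_ae ?_
      filter_upwards [h0] with x hx
      simp [hx]
    rw [hz] at this
    have h5 := this.const_mul C
    rw [mul_zero] at h5
    simpa only [norm_smul] using h5
  have l5 := squeeze_zero_norm (fun n => (Real.norm_eq_abs _).trans_le
    (hC _ ((hψ n).smul hGC))) l4
  have l6 := tendsto_nhds_unique l5 (l12.sub l3)
  linarith

end IsAdmissible

end Ventcel

namespace Ventcel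

/-! ### The boundary condition as a first order equation -/

/-- At a zero of `a`, the product with a continuous function is differentiable. -/
lemma hasDerivAt_mul_of_eq_zero {a w : ℝ → ℝ} {a' s : ℝ} (ha : HasDerivAt a a' s) (h0 : a s = 0)
    (hw : ContinuousAt w s) : HasDerivAt (fun t => a t * w t) (a' * w s) s := by
  rw [hasDerivAt_iff_tendsto_slope] at ha ⊢
  refine (ha.mul (hw.tendsto.mono_left nhdsWithin_le_nhds)).congr fun t => ?_
  simp only [slope_def_field, h0]
  ring

variable {N : ℕ} {Ω : Set Plane} {Γ : Fin N → PlaneCurve}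

namespace PlaneCurve

/-- The tangential flux `a₂ ∇_τ u` along a curve. -/
noncomputable def tangentialFlux (γ : PlaneCurve) (a₂ u : Plane → ℝ) (s : ℝ) : ℝ :=
  a₂ (γ.r s) * deriv (fun s => u (γ.r s)) s

/-- The derivative of the tangential flux prescribed by the boundary condition. -/
noncomputable def fluxRate (γ : PlaneCurve) (Ω : Set Plane) (g a₂ a₀ u : Plane → ℝ) (s : ℝ) : ℝ :=
  deriv (fun s => a₂ (γ.r s)) s * deriv (fun s => u (γ.r s)) s +
    (fderivWithin ℝ u (closure Ω) (γ.r s) (γ.normal Ω s) + a₀ (γ.r s) * u (γ.r s) - g (γ.r s))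

variable {γ : PlaneCurve}

lemma deriv_comp_add_int_mul {F : Type*} [NormedAddCommGroup F] [NormedSpace ℝ F]
    (h : γ.IsClosedCurve) (X : Plane → F) (m : ℤ) (s : ℝ) :
    deriv (fun s => X (γ.r s)) (s + m * γ.L) = deriv (fun s => X (γ.r s)) s := by
  rw [← deriv_comp_add_const]
  congr 1
  ext1 t; rw [γ.r_add_int_mul h]

lemma tangentialFlux_add_int_mul (h : γ.IsClosedCurve) (a₂ u : Plane → ℝ) (m : ℤ) (s : ℝ) :
    γ.tangentialFlux a₂ u (s + m * γ.L) = γ.tangentialFlux a₂ u s := by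
  simp only [tangentialFlux, deriv_comp_add_int_mul h, γ.r_add_int_mul h]

lemma fluxRate_add_int_mul (h : γ.IsClosedCurve) (g a₂ a₀ u : Plane → ℝ) (m : ℤ) (s : ℝ) :
    γ.fluxRate Ω g a₂ a₀ u (s + m * γ.L) = γ.fluxRate Ω g a₂ a₀ u s := by
  simp only [fluxRate, deriv_comp_add_int_mul h, γ.r_add_int_mul h, normal_add_int_mul h]

end PlaneCurve

namespace IsAdmissible

/-- The curve stays in the closure of Ω, so the chain rule within that set applies, whatever u does
outside it. -/
lemma hasDerivAt_comp_r (hA : IsAdmissible Ω Γ) (i : Fin N) {u : Plane → ℝ}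
    (hu : ContDiffOn ℝ 1 u (closure Ω)) {s : ℝ} (hs : s ∈ (Γ i).dom) :
    HasDerivAt (fun s => u ((Γ i).r s))
      (fderivWithin ℝ u (closure Ω) ((Γ i).r s) (deriv (Γ i).r s)) s := by
  have hmem : ∀ t ∈ (Γ i).dom, (Γ i).r t ∈ closure Ω := fun t ht =>
    frontier_subset_closure (PlaneCurve.r_mem_frontier (hA.trace_subset i) ht)
  have h1 := (hu.differentiableOn (by norm_num) _ (hmem s hs)).hasFDerivWithinAt
  refine (h1.comp_hasDerivWithinAt (t := closure Ω) s ((Γ i).hasDerivAt hs).hasDerivWithinAt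
    (s := (Γ i).dom) hmem).hasDerivAt ((Γ i).isOpen_dom.mem_nhds hs)

lemma continuousOn_deriv_comp_r (hA : IsAdmissible Ω Γ) (i : Fin N) {u : Plane → ℝ}
    (hu : ContDiffOn ℝ 1 u (closure Ω)) :
    ContinuousOn (deriv fun s => u ((Γ i).r s)) (Γ i).dom :=
  ((hA.continuousOn_comp_r i (hu.continuousOn_fderivWithin hA.uniqueDiffOn (by norm_num))).clm_apply
    (Γ i).continuousOn_deriv).congr fun s hs => (hA.hasDerivAt_comp_r i hu hs).deriv

lemma exists_bound_deriv_comp_r (hA : IsAdmissible Ω Γ) (i : Fin N) {u : Plane → ℝ}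
    (hu : ContDiffOn ℝ 1 u (closure Ω)) :
    ∃ C, ∀ s ∈ (Γ i).dom, |u ((Γ i).r s)| ≤ C ∧ |deriv (fun s => u ((Γ i).r s)) s| ≤ C ∧
      |fderivWithin ℝ u (closure Ω) ((Γ i).r s) ((Γ i).normal Ω s)| ≤ C := by
  obtain ⟨C₁, h1⟩ := hA.isCompact_closure.exists_bound_of_continuousOn hu.continuousOn
  obtain ⟨C₂, h2⟩ := hA.isCompact_closure.exists_bound_of_continuousOn
    (hu.continuousOn_fderivWithin hA.uniqueDiffOn (by norm_num))
  refine ⟨max C₁ C₂, fun s hs => ?_⟩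
  have hm : (Γ i).r s ∈ closure Ω :=
    frontier_subset_closure (PlaneCurve.r_mem_frontier (hA.trace_subset i) hs)
  have hn := (PlaneCurve.isOuterNormal_normal hA.lipschitz hA.isOpen (hA.trace_subset i) hs).1
  refine ⟨(h1 _ hm).trans (le_max_left _ _), ?_, ?_⟩
  · rw [(hA.hasDerivAt_comp_r i hu hs).deriv]
    have := (fderivWithin ℝ u (closure Ω) ((Γ i).r s)).le_opNorm (deriv (Γ i).r s)
    rw [(Γ i).norm_deriv hs, mul_one] at this
    exact this.trans ((h2 _ hm).trans (le_max_right _ _))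
  · have := (fderivWithin ℝ u (closure Ω) ((Γ i).r s)).le_opNorm ((Γ i).normal Ω s)
    rw [hn, mul_one] at this
    exact this.trans ((h2 _ hm).trans (le_max_right _ _))

lemma continuousOn_normalDeriv (hA : IsAdmissible Ω Γ) (i : Fin N) {u : Plane → ℝ}
    (hu : ContDiffOn ℝ 1 u (closure Ω)) :
    ContinuousOn (fun s => fderivWithin ℝ u (closure Ω) ((Γ i).r s) ((Γ i).normal Ω s))
      (Γ i).dom :=
  (hA.continuousOn_comp_r i (hu.continuousOn_fderivWithin hA.uniqueDiffOn (by norm_num))).clm_apply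
    (PlaneCurve.continuousOn_normal hA.lipschitz hA.isOpen (hA.trace_subset i))

lemma continuousOn_tangentialFlux (hA : IsAdmissible Ω Γ) (i : Fin N) {a₂ u : Plane → ℝ}
    (ha₂ : ContDiffOn ℝ 1 (fun s => a₂ ((Γ i).r s)) (Γ i).dom)
    (hu : ContDiffOn ℝ 1 u (closure Ω)) :
    ContinuousOn ((Γ i).tangentialFlux a₂ u) (Γ i).dom :=
  ha₂.continuousOn.mul (hA.continuousOn_deriv_comp_r i hu)

lemma continuousOn_comp_of_gammaNu (i : Fin N) {g : Plane → ℝ}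
    (hg : ContinuousOn g (GammaNu Γ)) : ContinuousOn (fun s => g ((Γ i).r s)) (Γ i).dom :=
  hg.comp (Γ i).continuousOn_r_dom fun _ hs => mem_iUnion.2 ⟨i, (Γ i).r_mem_innerPart hs⟩

lemma continuousOn_fluxRate (hA : IsAdmissible Ω Γ) (i : Fin N) {g a₂ a₀ u : Plane → ℝ}
    (hg : ContinuousOn g (GammaNu Γ))
    (ha₂ : ContDiffOn ℝ 1 (fun s => a₂ ((Γ i).r s)) (Γ i).dom)
    (ha₀ : ContinuousOn a₀ (GammaNu Γ)) (hu : ContDiffOn ℝ 1 u (closure Ω)) :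
    ContinuousOn ((Γ i).fluxRate Ω g a₂ a₀ u) (Γ i).dom :=
  ((ha₂.continuousOn_deriv_of_isOpen (Γ i).isOpen_dom le_rfl).mul
    (hA.continuousOn_deriv_comp_r i hu)).add
    (((hA.continuousOn_normalDeriv i hu).add
      ((continuousOn_comp_of_gammaNu i ha₀).mul (hA.continuousOn_comp_r i hu.continuousOn))).sub
      (continuousOn_comp_of_gammaNu i hg))

/-- The Ventcel condition at a point, as a first order equation for the tangential flux. -/
lemma ventcel_iff (hA : IsAdmissible Ω Γ) (i : Fin N) {g a₂ a₀ u : Plane → ℝ}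
    (ha₂ : ContDiffOn ℝ 1 (fun s => a₂ ((Γ i).r s)) (Γ i).dom)
    (hu : ContDiffOn ℝ 1 u (closure Ω)) {s : ℝ} (hs : s ∈ (Γ i).dom) :
    ((a₂ ((Γ i).r s) ≠ 0 →
      (∀ᶠ s' in 𝓝 s, DifferentiableAt ℝ (fun s => u ((Γ i).r s)) s') ∧
      DifferentiableAt ℝ (deriv fun s => u ((Γ i).r s)) s) ∧
    ∃ n : Plane, (Γ i).IsOuterNormal Ω s n ∧
      fderivWithin ℝ u (closure Ω) ((Γ i).r s) n
        - a₂ ((Γ i).r s) * deriv (deriv fun s => u ((Γ i).r s)) s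
        + a₀ ((Γ i).r s) * u ((Γ i).r s) = g ((Γ i).r s)) ↔
    HasDerivAt ((Γ i).tangentialFlux a₂ u) ((Γ i).fluxRate Ω g a₂ a₀ u s) s := by
  have hnor := PlaneCurve.isOuterNormal_normal hA.lipschitz hA.isOpen (hA.trace_subset i) hs
  have hnhds := (Γ i).isOpen_dom.mem_nhds hs
  have hex : ∀ P : Plane → Prop, (∃ n, (Γ i).IsOuterNormal Ω s n ∧ P n) ↔ P ((Γ i).normal Ω s) :=
    fun P => ⟨fun ⟨n, hn, hP⟩ => by rwa [PlaneCurve.normal_eq_of_isOuterNormal hs hn],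
      fun hP => ⟨_, hnor, hP⟩⟩
  rw [hex]
  have had : HasDerivAt (fun s => a₂ ((Γ i).r s)) (deriv (fun s => a₂ ((Γ i).r s)) s) s :=
    ((ha₂.contDiffAt hnhds).differentiableAt (by norm_num)).hasDerivAt
  have hvc : ContinuousAt (deriv fun s => u ((Γ i).r s)) s :=
    (hA.continuousOn_deriv_comp_r i hu).continuousAt hnhds
  have hdiff : ∀ᶠ s' in 𝓝 s, DifferentiableAt ℝ (fun s => u ((Γ i).r s)) s' := by
    filter_upwards [hnhds] with t ht using (hA.hasDerivAt_comp_r i hu ht).differentiableAt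
  by_cases h0 : a₂ ((Γ i).r s) = 0
  -- At a zero of a₂ the flux always has the derivative a₂' u'. The equation F' = c then says
  -- exactly that the remaining bracket u_ν + a₀ u − g vanishes.
  · have h1 : HasDerivAt ((Γ i).tangentialFlux a₂ u) _ s := hasDerivAt_mul_of_eq_zero had h0 hvc
    simp only [h0, ne_eq, not_true_eq_false, false_imp_iff, true_and, zero_mul, sub_zero]
    constructor
    · intro h2
      convert h1 using 1
      rw [PlaneCurve.fluxRate, h2, sub_self, add_zero]
    · intro h2
      have h3 := h2.unique h1
      rw [PlaneCurve.fluxRate] at h3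
      linarith
  · simp only [ne_eq, h0, not_false_eq_true, true_imp_iff]
    constructor
    · rintro ⟨⟨-, h2⟩, h3⟩
      have h4 : HasDerivAt ((Γ i).tangentialFlux a₂ u) _ s := had.mul h2.hasDerivAt
      convert h4 using 1
      rw [PlaneCurve.fluxRate]
      linarith
    · intro h2
      -- Near s the tangential derivative is the quotient F / a₂ of functions differentiable at s.
      have h3 : DifferentiableAt ℝ (deriv fun s => u ((Γ i).r s)) s := by
        have h4 := h2.div had h0
        refine (h4.congr_of_eventuallyEq ?_).differentiableAt
        filter_upwards [had.continuousAt.eventually_ne h0] with t ht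
        simp only [Pi.div_apply, PlaneCurve.tangentialFlux]
        rw [mul_div_cancel_left₀ _ ht]
      have h4 : HasDerivAt ((Γ i).tangentialFlux a₂ u) _ s := had.mul h3.hasDerivAt
      have h5 := h2.unique h4
      rw [PlaneCurve.fluxRate] at h5
      exact ⟨⟨hdiff, h3⟩, by linarith⟩

/-- The tangential derivative of a function which is `C¹` up to the boundary. -/
lemma memH1_curve (hA : IsAdmissible Ω Γ) (i : Fin N) {u : Plane → ℝ}
    (hu : ContDiffOn ℝ 1 u (closure Ω)) :
    (Γ i).MemH1 u (deriv fun s => u ((Γ i).r s)) := by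
  obtain ⟨C, hC⟩ := hA.exists_bound_deriv_comp_r i hu
  have h1 : MemLp (fun s => u ((Γ i).r s)) 2 (Γ i).ds :=
    hA.memLp_comp_r i (hA.memLp_bdry hu.continuousOn)
  have h2 : MemLp (deriv fun s => u ((Γ i).r s)) 2 (Γ i).ds :=
    memLp_of_bounded_on (C := C) measurableSet_Ioo (by simp)
      (((hA.continuousOn_deriv_comp_r i hu).mono (Γ i).Ioo_subset_dom).aestronglyMeasurable
        measurableSet_Ioo) fun s hs => (hC s ((Γ i).Ioo_subset_dom hs)).2.1
  refine ⟨h1, h2, fun η hη => ?_⟩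
  have hηb : ∀ θ : ℝ → ℝ, Continuous θ → MemLp θ 2 (Γ i).ds := fun θ hθ => by
    obtain ⟨B, hB⟩ := isCompact_Icc.exists_bound_of_continuousOn
      (hθ.continuousOn (s := Icc 0 (Γ i).L))
    exact memLp_of_bounded_on (C := B) measurableSet_Ioo (by simp) hθ.aestronglyMeasurable
      fun s hs => hB s (Ioo_subset_Icc_self hs)
  have i1 : Integrable (fun s => u ((Γ i).r s) * deriv η s) (Γ i).ds :=
    h1.integrable_mul (hηb _ (hη.1.continuous_deriv le_rfl))
  have i2 : Integrable (fun s => deriv (fun s => u ((Γ i).r s)) s * η s) (Γ i).ds :=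
    h2.integrable_mul (hηb _ hη.1.continuous)
  have := (Γ i).integral_mul_test (b := fun s => u ((Γ i).r s))
    (b' := deriv fun s => u ((Γ i).r s))
    (fun s hs => (hA.hasDerivAt_comp_r i hu hs).differentiableAt.hasDerivAt)
    (fun h => congrArg u (Eq.symm h)) hη (i1.add i2)
  rw [integral_add i1 i2] at this
  linarith

/-- The weak tangential derivative of a function which is `C¹` on the inner part of a curve. -/
lemma ae_eq_deriv_of_memW1Infty (i : Fin N) {a : Plane → ℝ} {q : ℝ → ℝ}
    (ha : ContDiffOn ℝ 1 (fun s => a ((Γ i).r s)) (Γ i).dom) (hq : (Γ i).MemW1Infty a q) :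
    q =ᵐ[(Γ i).ds] deriv fun s => a ((Γ i).r s) := by
  set γ := Γ i
  -- A priori the classical derivative is only locally integrable on (0, L), so
  -- `ae_eq_of_integral_test` is not available and compactly supported test functions are used
  -- directly.
  have hLoc : LocallyIntegrableOn (fun s => q s - deriv (fun s => a (γ.r s)) s) (Ioo 0 γ.L)
      volume := by
    refine LocallyIntegrableOn.sub ?_ ?_
    · exact IntegrableOn.locallyIntegrableOn (hq.2.1.integrable (by simp))
    · exact ((ha.continuousOn_deriv_of_isOpen γ.isOpen_dom le_rfl).mono
        γ.Ioo_subset_dom).locallyIntegrableOn measurableSet_Ioo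
  have key := isOpen_Ioo.ae_eq_zero_of_integral_contDiff_smul_eq_zero (E := ℝ) hLoc ?_
  · rw [Filter.EventuallyEq, PlaneCurve.ds, ae_restrict_iff' measurableSet_Ioo]
    filter_upwards [key] with s hs hs'
    exact sub_eq_zero.1 (hs hs')
  · intro ζ hζ hζc hζs
    have hζ1 : ContDiff ℝ 1 ζ := hζ.of_le (by simp)
    obtain ⟨θ, hθ, heq⟩ := γ.exists_test_eqOn hζ1 hζs
    have hdeq : EqOn (deriv θ) (deriv ζ) (Ioo 0 γ.L) := fun s hs =>
      (heq.eventuallyEq_of_mem (isOpen_Ioo.mem_nhds hs)).deriv_eq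
    -- the product with a function supported in `(0, L)` is `C¹`
    have hcont : ∀ A η : ℝ → ℝ, ContinuousOn A (Ioo 0 γ.L) → Continuous η → HasCompactSupport η →
        tsupport η ⊆ Ioo 0 γ.L → Integrable fun x => A x * η x := by
      intro A η hA hη hηc hηs
      refine Continuous.integrable_of_hasCompactSupport ?_ hηc.mul_left
      rw [continuous_iff_continuousAt]
      intro x
      by_cases hx : x ∈ tsupport η
      · exact ((hA.continuousAt (isOpen_Ioo.mem_nhds (hηs hx))).mul hη.continuousAt)
      · have h1 : (fun x => A x * η x) =ᶠ[𝓝 x] fun _ => 0 := by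
          filter_upwards [(isClosed_tsupport η).isOpen_compl.mem_nhds hx] with y hy
          rw [image_eq_zero_of_notMem_tsupport hy, mul_zero]
        exact continuousAt_const.congr h1.symm
    have hac : ContinuousOn (fun s => a (γ.r s)) (Ioo 0 γ.L) :=
      ha.continuousOn.mono γ.Ioo_subset_dom
    have hadc : ContinuousOn (deriv fun s => a (γ.r s)) (Ioo 0 γ.L) :=
      (ha.continuousOn_deriv_of_isOpen γ.isOpen_dom le_rfl).mono γ.Ioo_subset_dom
    have hζ's : tsupport (deriv ζ) ⊆ Ioo 0 γ.L := tsupport_deriv_subset.trans hζs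
    have i1 := hcont _ _ hac (hζ1.continuous_deriv le_rfl) hζc.deriv hζ's
    have i2 := hcont _ _ hadc hζ1.continuous hζc hζs
    have e1 := hq.2.2 θ hθ
    have e1' : ∫ s, a (γ.r s) * deriv ζ s ∂γ.ds = -∫ s, q s * ζ s ∂γ.ds := by
      rw [PlaneCurve.ds] at e1 ⊢
      rw [setIntegral_congr_fun measurableSet_Ioo (g := fun s => a (γ.r s) * deriv θ s)
        fun s hs => by simp only [hdeq hs], e1]
      congr 1
      exact setIntegral_congr_fun measurableSet_Ioo fun s hs => by simp only [heq hs]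
    have hd : ∀ s, HasDerivAt (fun s => a (γ.r s) * ζ s)
        (a (γ.r s) * deriv ζ s + deriv (fun s => a (γ.r s)) s * ζ s) s := by
      intro s
      by_cases hs : s ∈ tsupport ζ
      · have := ((ha.contDiffAt (γ.isOpen_dom.mem_nhds (γ.Ioo_subset_dom
          (hζs hs)))).differentiableAt (by norm_num)).hasDerivAt.mul
          ((hζ1.differentiable (by norm_num)) s).hasDerivAt
        rwa [add_comm] at this
      · have h3 : (fun x => a (γ.r x) * ζ x) =ᶠ[𝓝 s] fun _ => 0 := by
          filter_upwards [(isClosed_tsupport ζ).isOpen_compl.mem_nhds hs] with y hy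
          rw [image_eq_zero_of_notMem_tsupport hy, mul_zero]
        rw [image_eq_zero_of_notMem_tsupport hs,
          image_eq_zero_of_notMem_tsupport fun h' => hs (tsupport_deriv_subset h')]
        simpa using (hasDerivAt_const s (0 : ℝ)).congr_of_eventuallyEq h3
    have e2 := integral_eq_zero_of_hasDerivAt_of_integrable hd (i1.add i2)
      (hcont _ _ hac hζ1.continuous hζc hζs)
    rw [integral_add i1 i2] at e2
    have hset : ∀ A η : ℝ → ℝ, tsupport η ⊆ Ioo 0 γ.L →
        ∫ x, A x * η x ∂γ.ds = ∫ x, A x * η x := fun A η hηs =>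
      setIntegral_eq_integral_of_forall_compl_eq_zero fun x hx => by
        rw [image_eq_zero_of_notMem_tsupport fun h' => hx (hηs h'), mul_zero]
    rw [hset _ _ hζ's, hset _ _ hζs] at e1'
    have i3 : Integrable (fun s => q s * ζ s) := by
      obtain ⟨B, hB⟩ := hζc.exists_bound_of_continuous hζ1.continuous
      have h3 : IntegrableOn (fun s => q s * ζ s) (Ioo 0 γ.L) :=
        (hq.2.1.integrable (by simp)).mul_bdd hζ1.continuous.aestronglyMeasurable
          (Eventually.of_forall hB)
      rw [integrableOn_iff_integrable_of_support_subset] at h3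
      · exact h3
      · intro x hx
        by_contra h4
        refine hx ?_
        simp only
        rw [image_eq_zero_of_notMem_tsupport fun h' => h4 (hζs h'), mul_zero]
    have e3 : ∫ s, ζ s • (q s - deriv (fun s => a (γ.r s)) s) =
        (∫ s, q s * ζ s) - ∫ s, deriv (fun s => a (γ.r s)) s * ζ s := by
      rw [← integral_sub i3 i2]
      exact integral_congr_ae (Eventually.of_forall fun s => by simp only [smul_eq_mul]; ring)
    rw [e3]
    linarith

end IsAdmissible

end Ventcel

namespace Ventcel

variable {N : ℕ} {Ω : Set Plane} {Γ : Fin N → PlaneCurve}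

namespace IsAdmissible

/-! ### Smooth test functions -/

/-- The curves are disjoint, so an end point of one of them cannot be an inner point of another. -/
lemma mem_gammaD_of_mem_trace (hA : IsAdmissible Ω Γ) {i : Fin N} {x : Plane}
    (hx : x ∈ (Γ i).trace) (hx' : x ∉ (Γ i).innerPart) : x ∈ GammaD Ω Γ := by
  refine ⟨hA.trace_subset i hx, fun h => ?_⟩
  obtain ⟨j, hj⟩ := mem_iUnion.1 h
  by_cases hij : i = j
  · exact hx' (hij ▸ hj)
  · exact Set.disjoint_left.1 (hA.disjoint i j hij) hx ((Γ j).innerPart_subset_trace hj)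

lemma r_zero_mem_gammaD (hA : IsAdmissible Ω Γ) {i : Fin N} (h : ¬ (Γ i).IsClosedCurve) :
    (Γ i).r 0 ∈ GammaD Ω Γ :=
  hA.mem_gammaD_of_mem_trace (mem_image_of_mem _ (left_mem_Icc.2 (Γ i).L_pos.le))
    fun h' => h'.2.elim h fun h2 => h2.1 rfl

lemma r_length_mem_gammaD (hA : IsAdmissible Ω Γ) {i : Fin N} (h : ¬ (Γ i).IsClosedCurve) :
    (Γ i).r (Γ i).L ∈ GammaD Ω Γ :=
  hA.mem_gammaD_of_mem_trace (mem_image_of_mem _ (right_mem_Icc.2 (Γ i).L_pos.le))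
    fun h' => h'.2.elim h fun h2 => h2.2 rfl

/-- A `C¹` function vanishing near `Γ_D` restricts to a test function on each curve. -/
lemma exists_isTest (hA : IsAdmissible Ω Γ) {w : Plane → ℝ} (hw : ContDiff ℝ 1 w)
    (hd : Disjoint (tsupport w) (GammaD Ω Γ)) (i : Fin N) :
    ∃ θ, (Γ i).IsTest θ ∧ EqOn θ (fun s => w ((Γ i).r s)) (Ioo 0 (Γ i).L) := by
  set γ := Γ i
  by_cases hc : γ.IsClosedCurve
  · refine ⟨fun s => w (γ.r s), ⟨?_, fun _ s => ?_, fun h => absurd hc h⟩, fun s _ => rfl⟩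
    · have := γ.contDiffOn_dom
      rw [γ.dom_eq_univ hc, contDiffOn_univ] at this
      exact hw.comp this
    · simp only [γ.closed_periodic hc s]
  · set θ : ℝ → ℝ := indicator (Ioo 0 γ.L) fun s => w (γ.r s)
    set K : Set ℝ := Icc 0 γ.L ∩ γ.r ⁻¹' tsupport w
    have hKc : IsClosed K := γ.contDiffOn.continuousOn.preimage_isClosed_of_isClosed isClosed_Icc
      (isClosed_tsupport w)
    -- The end points of an open curve belong to Γ_D, which the support of w avoids.
    have hKI : K ⊆ Ioo 0 γ.L := by
      rintro s ⟨hs, hsw⟩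
      refine ⟨hs.1.lt_of_ne ?_, hs.2.lt_of_ne ?_⟩ <;> rintro rfl
      · exact Set.disjoint_left.1 hd hsw (hA.r_zero_mem_gammaD hc)
      · exact Set.disjoint_left.1 hd hsw (hA.r_length_mem_gammaD hc)
    have hθK : tsupport θ ⊆ K := by
      refine closure_minimal (fun s hs => ?_) hKc
      have h1 : s ∈ Ioo 0 γ.L := by
        by_contra h
        exact hs (indicator_of_notMem h _)
      refine ⟨Ioo_subset_Icc_self h1, subset_closure fun h => hs ?_⟩
      exact (indicator_of_mem h1 _).trans h
    refine ⟨θ, ⟨?_, fun h => absurd h hc, fun _ => ⟨?_, hθK.trans hKI⟩⟩,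
      fun s hs => indicator_of_mem hs _⟩
    · rw [contDiff_iff_contDiffAt]
      intro s
      by_cases hs : s ∈ Ioo 0 γ.L
      · refine (hw.contDiffAt.comp s (γ.contDiffAt (γ.Ioo_subset_dom hs))).congr_of_eventuallyEq ?_
        filter_upwards [isOpen_Ioo.mem_nhds hs] with t ht using indicator_of_mem ht _
      · refine (contDiffAt_const (c := (0 : ℝ))).congr_of_eventuallyEq ?_
        filter_upwards [(isClosed_tsupport θ).isOpen_compl.mem_nhds
          fun h => hs (hKI (hθK h))] with t ht using image_eq_zero_of_notMem_tsupport ht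
    · exact isCompact_Icc.of_isClosed_subset (isClosed_tsupport θ) (hθK.trans inter_subset_left)

/-- Supplies the test functions for the passage from weak to pointwise. The approximating sequence
on each curve may be taken constant. -/
lemma memV0_of_contDiff (hA : IsAdmissible Ω Γ) {w : Plane → ℝ} (hw : ContDiff ℝ 1 w)
    (hd : Disjoint (tsupport w) (GammaD Ω Γ)) :
    MemV0 Ω Γ w (gradient w) w (fun i => deriv fun s => w ((Γ i).r s)) := by
  refine ⟨hA.memH1 hw.contDiffOn, hA.isTrace_self hw.contDiffOn, fun i => ?_, ?_⟩
  · obtain ⟨θ, hθ, heq⟩ := hA.exists_isTest hw hd i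
    have hz : ∀ {f : ℝ → ℝ}, (∀ s ∈ Ioo 0 (Γ i).L, f s = 0) → eLpNorm f 2 (Γ i).ds = 0 :=
      fun {f} hf => by
        rw [PlaneCurve.ds, eLpNorm_congr_ae (g := fun _ => (0 : ℝ))
          ((ae_restrict_iff' measurableSet_Ioo).2 (Eventually.of_forall hf))]
        exact eLpNorm_zero
    refine ⟨hA.memH1_curve i hw.contDiffOn, fun _ => θ, fun _ => hθ, ?_, ?_⟩
    · simp only [hz fun s hs => sub_eq_zero.2 (heq hs), tendsto_const_nhds]
    · simp only [hz fun s hs => sub_eq_zero.2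
        ((heq.eventuallyEq_of_mem (isOpen_Ioo.mem_nhds hs)).deriv_eq), tendsto_const_nhds]
  · exact ae_restrict_of_forall_mem measurableSet_gammaD fun x hx =>
      image_eq_zero_of_notMem_tsupport fun h => Set.disjoint_left.1 hd h hx

/-! ### The weak formulation -/

lemma ae_eq_deriv_of_memH1 (hA : IsAdmissible Ω Γ) (i : Fin N) {u t : Plane → ℝ} {p : ℝ → ℝ}
    (hu : ContDiffOn ℝ 1 u (closure Ω)) (h : (Γ i).MemH1 t p)
    (ht : ∀ᵐ s ∂(Γ i).ds, t ((Γ i).r s) = u ((Γ i).r s)) :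
    p =ᵐ[(Γ i).ds] deriv fun s => u ((Γ i).r s) := by
  have h' := hA.memH1_curve i hu
  refine (Γ i).ae_eq_of_integral_test (h.2.1.integrable (by norm_num))
    (h'.2.1.integrable (by norm_num)) fun η hη => ?_
  have h1 := h.2.2 η hη
  have h2 := h'.2.2 η hη
  have h3 : ∫ s, t ((Γ i).r s) * deriv η s ∂(Γ i).ds = ∫ s, u ((Γ i).r s) * deriv η s ∂(Γ i).ds :=
    integral_congr_ae (by filter_upwards [ht] with s hs; rw [hs])
  linarith

lemma memLp_normalDeriv (hA : IsAdmissible Ω Γ) (i : Fin N) {u : Plane → ℝ}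
    (hu : ContDiffOn ℝ 1 u (closure Ω)) :
    MemLp (fun s => fderivWithin ℝ u (closure Ω) ((Γ i).r s) ((Γ i).normal Ω s)) 2 (Γ i).ds := by
  obtain ⟨C, hC⟩ := hA.exists_bound_deriv_comp_r i hu
  exact memLp_of_bounded_on (C := C) measurableSet_Ioo (by simp)
    (((hA.continuousOn_normalDeriv i hu).mono (Γ i).Ioo_subset_dom).aestronglyMeasurable
      measurableSet_Ioo) fun s hs => (hC s ((Γ i).Ioo_subset_dom hs)).2.2

lemma memLp_tangentialFlux (hA : IsAdmissible Ω Γ) (i : Fin N) {a₂ u : Plane → ℝ} {q : ℝ → ℝ}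
    (hq : (Γ i).MemW1Infty a₂ q) (hu : ContDiffOn ℝ 1 u (closure Ω)) :
    MemLp ((Γ i).tangentialFlux a₂ u) 2 (Γ i).ds :=
  MemLp.mul (p := ∞) (q := 2) (hA.memH1_curve i hu).2.1 hq.1

lemma memLp_fluxRate (hA : IsAdmissible Ω Γ) (i : Fin N) {g a₂ a₀ u : Plane → ℝ} {q : ℝ → ℝ}
    (hg : MemLp (fun s => g ((Γ i).r s)) 2 (Γ i).ds)
    (ha₂ : ContDiffOn ℝ 1 (fun s => a₂ ((Γ i).r s)) (Γ i).dom)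
    (hq : (Γ i).MemW1Infty a₂ q) (ha₀ : MemLp (fun s => a₀ ((Γ i).r s)) ∞ (Γ i).ds)
    (hu : ContDiffOn ℝ 1 u (closure Ω)) :
    MemLp ((Γ i).fluxRate Ω g a₂ a₀ u) 2 (Γ i).ds :=
  (MemLp.mul (p := ∞) (q := 2) (hA.memH1_curve i hu).2.1
    (hq.2.1.ae_eq (ae_eq_deriv_of_memW1Infty i ha₂ hq))).add
    (((hA.memLp_normalDeriv i hu).add
      (MemLp.mul (p := ∞) (q := 2) (hA.memH1_curve i hu).1 ha₀)).sub hg)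

/-- The variational equality, after integration by parts in `Ω`. -/
theorem variational_iff (hA : IsAdmissible Ω Γ) {f g a₂ a₀ u : Plane → ℝ} {q : Fin N → ℝ → ℝ}
    {Du : Plane → Plane} {tu : Plane → ℝ} {pu : Fin N → ℝ → ℝ}
    (hf : MemLp f 2 (volume.restrict Ω))
    (hg : ∀ i, MemLp (fun s => g ((Γ i).r s)) 2 (Γ i).ds)
    (ha₂ : ∀ i, ContDiffOn ℝ 1 (fun s => a₂ ((Γ i).r s)) (Γ i).dom)
    (hq : ∀ i, (Γ i).MemW1Infty a₂ (q i))
    (ha₀ : ∀ i, MemLp (fun s => a₀ ((Γ i).r s)) ∞ (Γ i).ds)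
    (hu : ContDiffOn ℝ 2 u (closure Ω)) (hUV : MemV Ω Γ u Du tu pu)
    {w : Plane → ℝ} {Dw : Plane → Plane} {tw : Plane → ℝ} {pw : Fin N → ℝ → ℝ}
    (hw : MemV0 Ω Γ w Dw tw pw) :
    ((∫ x in Ω, inner ℝ (Du x) (Dw x)) +
        ∑ i, ∫ s, ((a₂ ((Γ i).r s) * pw i s + tw ((Γ i).r s) * q i s) * pu i s
          + a₀ ((Γ i).r s) * tu ((Γ i).r s) * tw ((Γ i).r s)) ∂(Γ i).ds
      = (∫ x in Ω, (f x * w x - inner ℝ ((0 : Plane → Plane) x) (Dw x))) +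
        ∑ i, ∫ s, (g ((Γ i).r s) * tw ((Γ i).r s)
          - (0 : Plane → ℝ) ((Γ i).r s) * pw i s) ∂(Γ i).ds) ↔
    (∫ x in Ω, w x * (Laplacian.laplacian u x + f x)) =
      ∑ i, ∫ s, ((Γ i).tangentialFlux a₂ u s * pw i s +
        (Γ i).fluxRate Ω g a₂ a₀ u s * tw ((Γ i).r s)) ∂(Γ i).ds := by
  have hu1 : ContDiffOn ℝ 1 u (closure Ω) := hu.of_le (by norm_num)
  have hDu := hUV.1.ae_eq hA.isOpen hA.isFiniteMeasure_volume (hA.memH1 hu1)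
  have htu := hA.trace_eq hu1 hUV.1 hUV.2.1
  have green := hA.green hu hw.1 hw.2.1 hw.2.2.2
  have e1 : ∫ x in Ω, inner ℝ (Du x) (Dw x) = ∫ x in Ω, inner ℝ (Dw x) (gradient u x) :=
    integral_congr_ae (by filter_upwards [hDu] with x hx; rw [hx, real_inner_comm])
  have e2 : ∫ x in Ω, (f x * w x - inner ℝ ((0 : Plane → Plane) x) (Dw x)) =
      ∫ x in Ω, w x * f x :=
    integral_congr_ae (Eventually.of_forall fun x => by simp [mul_comm])
  have e3 : ∫ x in Ω, w x * (Laplacian.laplacian u x + f x) =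
      (∫ x in Ω, w x * Laplacian.laplacian u x) + ∫ x in Ω, w x * f x := by
    simp only [mul_add]
    exact integral_add (hw.1.1.integrable_mul (hA.memLp_laplacian hu))
      (hw.1.1.integrable_mul hf)
  -- After the a.e. identifications tu = u, pu = u' and q = a₂', the curve terms and the normal
  -- derivative from Green's formula combine into F p_w + c t_w.
  have e4 : ∀ i, (∫ s, ((Γ i).tangentialFlux a₂ u s * pw i s +
        (Γ i).fluxRate Ω g a₂ a₀ u s * tw ((Γ i).r s)) ∂(Γ i).ds) =
      (∫ s, ((a₂ ((Γ i).r s) * pw i s + tw ((Γ i).r s) * q i s) * pu i s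
          + a₀ ((Γ i).r s) * tu ((Γ i).r s) * tw ((Γ i).r s)) ∂(Γ i).ds) +
        (∫ s, tw ((Γ i).r s) * fderivWithin ℝ u (closure Ω) ((Γ i).r s) ((Γ i).normal Ω s)
          ∂(Γ i).ds) -
        ∫ s, (g ((Γ i).r s) * tw ((Γ i).r s)
          - (0 : Plane → ℝ) ((Γ i).r s) * pw i s) ∂(Γ i).ds := by
    intro i
    have hti := hA.ae_ds_of_ae_bdry i htu
    have hpi := hA.ae_eq_deriv_of_memH1 i hu1 (hUV.2.2 i) hti
    have hqi := ae_eq_deriv_of_memW1Infty i (ha₂ i) (hq i)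
    have hV := hA.memH1_curve i hu1
    obtain ⟨⟨ht, hp, -⟩, -⟩ := hw.2.2.1 i
    have i1 : Integrable (fun s => (a₂ ((Γ i).r s) * pw i s + tw ((Γ i).r s) * q i s) * pu i s
          + a₀ ((Γ i).r s) * tu ((Γ i).r s) * tw ((Γ i).r s)) (Γ i).ds :=
      (MemLp.integrable_mul (p := 2) (q := 2) ((MemLp.mul (p := ∞) (q := 2) hp (hq i).1).add
        (MemLp.mul (p := 2) (q := ∞) (hq i).2.1 ht)) (hUV.2.2 i).2.1).add
        (MemLp.integrable_mul (p := 2) (q := 2)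
          (MemLp.mul (p := ∞) (q := 2) (hUV.2.2 i).1 (ha₀ i)) ht)
    have i2 : Integrable (fun s => tw ((Γ i).r s) *
        fderivWithin ℝ u (closure Ω) ((Γ i).r s) ((Γ i).normal Ω s)) (Γ i).ds :=
      ht.integrable_mul (hA.memLp_normalDeriv i hu1)
    have i3 : Integrable (fun s => g ((Γ i).r s) * tw ((Γ i).r s)
          - (0 : Plane → ℝ) ((Γ i).r s) * pw i s) (Γ i).ds := by
      simp only [Pi.zero_apply, zero_mul, sub_zero]
      exact (hg i).integrable_mul ht
    rw [← integral_add i1 i2]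
    refine Eq.trans (integral_congr_ae ?_) (integral_sub (i1.add i2) i3)
    filter_upwards [hti, hpi, hqi] with s h1 h2 h3
    simp only [PlaneCurve.tangentialFlux, PlaneCurve.fluxRate,
      Pi.zero_apply, h1, h2, h3]
    ring
  rw [e1, e2, e3]
  simp only [e4, Finset.sum_sub_distrib, Finset.sum_add_distrib]
  rw [← green]
  constructor <;> intro h <;> linarith

end IsAdmissible

end Ventcel

namespace Ventcel

variable {N : ℕ} {Ω : Set Plane} {Γ : Fin N → PlaneCurve}

/-! ### The boundary equation from the variational equality -/

namespace PlaneCurve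

variable {γ : PlaneCurve}

lemma injOn_Ico : InjOn γ.r (Ico 0 γ.L) := by
  have key : ∀ s ∈ Ico 0 γ.L, ∀ t ∈ Ico 0 γ.L, s < t → γ.r s ≠ γ.r t := fun s hs t ht hst h =>
    ht.2.ne (γ.simple s ⟨hs.1, hs.2.le⟩ t ⟨ht.1, ht.2.le⟩ hst h).2
  intro s hs t ht h
  rcases lt_trichotomy s t with hst | hst | hst
  · exact absurd h (key s hs t ht hst)
  · exact hst
  · exact absurd h.symm (key t ht s hs hst)

lemma eq_of_r_eq (h : γ.IsClosedCurve) {s t : ℝ} (hst : γ.r s = γ.r t) (hlt : |s - t| < γ.L) :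
    s = t := by
  obtain ⟨m, hm⟩ := γ.exists_shift_mem_Ico s
  obtain ⟨n, hn⟩ := γ.exists_shift_mem_Ico t
  have h1 : s + m * γ.L = t + n * γ.L :=
    γ.injOn_Ico hm hn (by rw [γ.r_add_int_mul h, γ.r_add_int_mul h, hst])
  have h2 : s - t = (n - m : ℤ) * γ.L := by push_cast; linarith
  have h3 : |((n - m : ℤ) : ℝ)| < 1 := by
    rw [h2, abs_mul, abs_of_pos γ.L_pos] at hlt
    by_contra h4
    nlinarith [γ.L_pos]
  have h4 : n - m = 0 := Int.abs_lt_one_iff.1 (by exact_mod_cast h3)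
  rw [h4] at h2
  simp at h2
  linarith

/-- A point of the domain lies in an interval of length `L` on which the curve is injective. -/
lemma exists_window {s : ℝ} (hs : s ∈ γ.dom) : ∃ A, s ∈ Ioo A (A + γ.L) ∧
    Ioo A (A + γ.L) ⊆ γ.dom ∧ InjOn γ.r (Ioo A (A + γ.L)) ∧ (γ.IsClosedCurve ∨ A = 0) := by
  by_cases h : γ.IsClosedCurve
  · refine ⟨s - γ.L / 2, ⟨by linarith [γ.L_pos], by linarith [γ.L_pos]⟩, ?_, ?_, Or.inl h⟩
    · rw [γ.dom_eq_univ h]; exact subset_univ _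
    · intro x hx y hy hxy
      exact eq_of_r_eq h hxy (abs_lt.2 ⟨by linarith [hx.1, hy.2], by linarith [hx.2, hy.1]⟩)
  · refine ⟨0, ?_, ?_, ?_, Or.inr rfl⟩ <;> rw [zero_add]
    · rwa [γ.dom_eq_Ioo h] at hs
    · exact γ.Ioo_subset_dom
    · exact γ.injOn_Ioo

/-- On a closed curve the period of integration is shifted, so that any given point, even the base
point, becomes interior. -/
lemma integral_ds_eq_window {G : ℝ → ℝ} {A : ℝ} (hA : γ.IsClosedCurve ∨ A = 0)
    (hG : γ.IsClosedCurve → Function.Periodic G γ.L) :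
    ∫ s, G s ∂γ.ds = ∫ s in Ioo A (A + γ.L), G s := by
  rcases hA with h | rfl
  · have := (hG h).intervalIntegral_add_eq 0 A
    rw [intervalIntegral.integral_of_le (by linarith [γ.L_pos]),
      intervalIntegral.integral_of_le (by linarith [γ.L_pos]), integral_Ioc_eq_integral_Ioo,
      integral_Ioc_eq_integral_Ioo, zero_add] at this
    exact this
  · rw [zero_add, PlaneCurve.ds]

end PlaneCurve

namespace IsAdmissible

/-- A test function of the arc length supported near a given point extends to a `C¹` function on
the plane which vanishes near `Γ_D` and on all other curves. -/
lemma exists_extension (hA : IsAdmissible Ω Γ) (i : Fin N) {s A : ℝ}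
    (hsA : s ∈ Ioo A (A + (Γ i).L)) (hAd : Ioo A (A + (Γ i).L) ⊆ (Γ i).dom)
    (hinj : InjOn (Γ i).r (Ioo A (A + (Γ i).L))) :
    ∃ ε > 0, Ioo (s - ε) (s + ε) ⊆ Ioo A (A + (Γ i).L) ∧ ∀ η : ℝ → ℝ, ContDiff ℝ 1 η →
      tsupport η ⊆ Ioo (s - ε) (s + ε) → ∃ w : Plane → ℝ, ContDiff ℝ 1 w ∧
        Disjoint (tsupport w) (GammaD Ω Γ) ∧ (∀ j ≠ i, ∀ t ∈ (Γ j).dom, w ((Γ j).r t) = 0) ∧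
        ∀ t ∈ Ioo A (A + (Γ i).L), w ((Γ i).r t) = η t := by
  set γ := Γ i
  have hs : s ∈ γ.dom := hAd hsA
  have hγ := hA.trace_subset i
  obtain ⟨T, h, K, U, H, hsU⟩ := hA.lipschitz.exists_chart (PlaneCurve.r_mem_frontier hγ hs)
  obtain ⟨ρ, hρ, -, hρσ, -⟩ := PlaneCurve.exists_inverse hA.isOpen hγ H hs hsU
  obtain ⟨ε₀, hε₀, hN⟩ := Metric.eventually_nhds_iff_ball.1
    (hρσ.and (isOpen_Ioo.mem_nhds hsA : Ioo A (A + γ.L) ∈ 𝓝 s))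
  have hfr := PlaneCurve.eventually_frontier hA.lipschitz hA.isOpen hγ hs (Metric.ball_mem_nhds s hε₀)
  have hcoord : Continuous fun x : Plane => (T x) 0 := (lipschitzWith_coord T 0).continuous
  have hρ' : ∀ᶠ x in 𝓝 (γ.r s), ContDiffAt ℝ 1 ρ ((T x) 0) :=
    hcoord.continuousAt.eventually (hρ.eventually (by simp))
  obtain ⟨δ, hδ, hball⟩ := Metric.eventually_nhds_iff_ball.1 (hfr.and hρ')
  -- A cutoff supported in the ball of radius δ, where every boundary point comes from a parameter
  -- near s and ρ is C¹.
  let χ : ContDiffBump (γ.r s) := ⟨δ / 3, δ / 2, by linarith, by linarith⟩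
  obtain ⟨ε₁, hε₁, hI⟩ := Metric.eventually_nhds_iff_ball.1
    ((γ.contDiffAt hs).continuousAt.eventually (Metric.closedBall_mem_nhds (γ.r s) χ.rIn_pos))
  have hχs : tsupport χ ⊆ Metric.ball (γ.r s) δ := by
    rw [χ.tsupport_eq]
    exact Metric.closedBall_subset_ball (by change δ / 2 < δ; linarith)
  refine ⟨min ε₀ ε₁, lt_min hε₀ hε₁, fun t ht => (hN t ?_).2, fun η hη hηs => ?_⟩
  · rw [Real.ball_eq_Ioo]
    exact Ioo_subset_Ioo (by linarith [min_le_left ε₀ ε₁]) (by linarith [min_le_left ε₀ ε₁]) ht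
  -- The extension is constant in the vertical direction of the chart, with ρ recovering the arc
  -- length from the first coordinate, and is then cut off by χ.
  set w : Plane → ℝ := fun x => η (ρ ((T x) 0)) * χ x
  have hws : tsupport w ⊆ tsupport χ := tsupport_mul_subset_right
  have hfront : ∀ x ∈ tsupport χ, x ∈ frontier Ω → ∃ t ∈ Metric.ball s ε₀, t ∈ γ.dom ∧ γ.r t = x :=
    fun x hx => (hball x (hχs hx)).1
  refine ⟨w, ?_, ?_, fun j hj t ht => ?_, fun t ht => ?_⟩
  · rw [contDiff_iff_contDiffAt]
    intro x
    by_cases hx : x ∈ tsupport χ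
    · have h1 : ContDiffAt ℝ 1 (fun x : Plane => (T x) 0) x := by
        have : ContDiff ℝ 1 fun x : Plane => (T x) 0 := by fun_prop
        exact this.contDiffAt
      exact ((hη.contDiffAt.comp _ (hball x (hχs hx)).2).comp x h1).mul χ.contDiffAt
    · refine (contDiffAt_const (c := (0 : ℝ))).congr_of_eventuallyEq ?_
      filter_upwards [(isClosed_tsupport χ).isOpen_compl.mem_nhds hx] with y hy
      exact image_eq_zero_of_notMem_tsupport fun h' => hy (hws h')
  · refine Set.disjoint_left.2 fun x hx hxD => ?_
    obtain ⟨t, -, htd, rfl⟩ := hfront x (hws hx) hxD.1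
    exact hxD.2 (mem_iUnion.2 ⟨i, γ.r_mem_innerPart htd⟩)
  · by_contra h0
    obtain ⟨t', -, htd, ht'⟩ := hfront _ (hws (subset_closure h0))
      (PlaneCurve.r_mem_frontier (hA.trace_subset j) ht)
    refine Set.disjoint_left.1 (hA.disjoint j i hj)
      ((Γ j).innerPart_subset_trace ((Γ j).r_mem_innerPart ht)) ?_
    rw [← ht']
    exact γ.innerPart_subset_trace (γ.r_mem_innerPart htd)
  · by_cases htN : t ∈ Metric.ball s ε₀
    · change η (ρ ((T (γ.r t)) 0)) * χ (γ.r t) = η t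
      rw [(hN t htN).1]
      by_cases hη0 : t ∈ tsupport η
      -- The bound by ε₁ keeps the support of η where χ = 1 along the curve.
      · rw [χ.one_of_mem_closedBall (hI t ?_), mul_one]
        rw [Real.ball_eq_Ioo]
        exact Ioo_subset_Ioo (by linarith [min_le_right ε₀ ε₁]) (by linarith [min_le_right ε₀ ε₁])
          (hηs hη0)
      · rw [image_eq_zero_of_notMem_tsupport hη0, zero_mul]
    -- For a parameter far from s both sides vanish: a curve point in the support of w has a
    -- parameter near s, which equals t by injectivity on the window.
    · rw [image_eq_zero_of_notMem_tsupport (f := η)]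
      · by_contra h0
        obtain ⟨t', ht'N, -, ht'⟩ := hfront _ (hws (subset_closure h0))
          (PlaneCurve.r_mem_frontier hγ (hAd ht))
        exact htN (hinj (hN t' ht'N).2 ht ht' ▸ ht'N)
      · refine fun h' => htN ?_
        rw [Real.ball_eq_Ioo]
        exact Ioo_subset_Ioo (by linarith [min_le_left ε₀ ε₁]) (by linarith [min_le_left ε₀ ε₁])
          (hηs h')

/-- Extended test functions isolate a single curve and a short parameter interval in the sum, and du
Bois-Reymond's lemma does the rest. Periodicity lets the base point of a closed curve be treated
like any other. -/
theorem hasDerivAt_of_variational (hA : IsAdmissible Ω Γ) {F c : Fin N → ℝ → ℝ}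
    (hF : ∀ i, ContinuousOn (F i) (Γ i).dom) (hc : ∀ i, ContinuousOn (c i) (Γ i).dom)
    (hFp : ∀ i, (Γ i).IsClosedCurve → Function.Periodic (F i) (Γ i).L)
    (hcp : ∀ i, (Γ i).IsClosedCurve → Function.Periodic (c i) (Γ i).L)
    (h : ∀ w : Plane → ℝ, ContDiff ℝ 1 w → Disjoint (tsupport w) (GammaD Ω Γ) →
      ∑ i, ∫ s, (F i s * deriv (fun s => w ((Γ i).r s)) s + c i s * w ((Γ i).r s)) ∂(Γ i).ds = 0)
    (i : Fin N) {s : ℝ} (hs : s ∈ (Γ i).dom) : HasDerivAt (F i) (c i s) s := by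
  obtain ⟨A, hsA, hAd, hinj, hA0⟩ := PlaneCurve.exists_window hs
  obtain ⟨ε, hε, hεA, hext⟩ := hA.exists_extension i hsA hAd hinj
  refine hasDerivAt_of_weak (a := s - ε) (b := s + ε) ((hF i).mono (hεA.trans hAd))
    ((hc i).mono (hεA.trans hAd)) (fun η hη _ hηs => ?_) ⟨by linarith, by linarith⟩
  obtain ⟨w, hw, hwD, hwj, hwi⟩ := hext η hη hηs
  have h1 := h w hw hwD
  rw [Finset.sum_eq_single i] at h1
  · rw [PlaneCurve.integral_ds_eq_window hA0] at h1
    · rw [setIntegral_congr_fun measurableSet_Ioo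
        (g := fun s => F i s * deriv η s + c i s * η s)] at h1
      · rw [← h1]
        refine (setIntegral_eq_of_subset_of_forall_sdiff_eq_zero measurableSet_Ioo hεA
          fun t ht => ?_).symm
        rw [image_eq_zero_of_notMem_tsupport fun h' => ht.2 (hηs h'),
          image_eq_zero_of_notMem_tsupport (f := deriv η)
            fun h' => ht.2 (hηs (tsupport_deriv_subset h'))]
        simp
      · intro t ht
        have h2 : (fun s => w ((Γ i).r s)) =ᶠ[𝓝 t] η := by
          filter_upwards [isOpen_Ioo.mem_nhds ht] with x hx using hwi x hx
        simp only [h2.deriv_eq, hwi t ht]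
    · intro hcl t
      have h3 := PlaneCurve.deriv_comp_add_int_mul hcl w 1 t
      rw [Int.cast_one, one_mul] at h3
      simp only [h3, hFp i hcl t, hcp i hcl t, (Γ i).closed_periodic hcl t]
  · intro j _ hj
    refine (setIntegral_congr_fun measurableSet_Ioo (g := fun _ => (0 : ℝ)) fun t ht => ?_).trans
      (by simp)
    have h2 : (fun s => w ((Γ j).r s)) =ᶠ[𝓝 t] fun _ => 0 := by
      filter_upwards [(Γ j).isOpen_dom.mem_nhds ((Γ j).Ioo_subset_dom ht)] with x hx
        using hwj j hj x hx
    simp only [h2.deriv_eq, deriv_const, hwj j hj t ((Γ j).Ioo_subset_dom ht), mul_zero, add_zero]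
  · simp

end IsAdmissible

end Ventcel

namespace Ventcel

variable {N : ℕ} {Ω : Set Plane} {Γ : Fin N → PlaneCurve}

namespace PlaneCurve

variable {γ : PlaneCurve}

/-! ### Integration by parts against H¹₀ on a curve. -/

lemma injOn_Icc (h : ¬ γ.IsClosedCurve) : InjOn γ.r (Icc 0 γ.L) := by
  have key : ∀ s ∈ Icc 0 γ.L, ∀ t ∈ Icc 0 γ.L, s < t → γ.r s ≠ γ.r t := fun s hs t ht hst hr => by
    obtain ⟨rfl, rfl⟩ := γ.simple s hs t ht hst hr
    exact h hr
  intro s hs t ht hr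
  rcases lt_trichotomy s t with hst | hst | hst
  · exact absurd hr (key s hs t ht hst)
  · exact hst
  · exact absurd hr.symm (key t ht s hs hst)

/-- Integration by parts on a curve against functions in `H¹₀`. -/
lemma integral_mul_memH10 {F c : ℝ → ℝ} (hF : ∀ s ∈ γ.dom, HasDerivAt F (c s) s)
    (hper : γ.IsClosedCurve → F γ.L = F 0) (hFL : MemLp F 2 γ.ds) (hcL : MemLp c 2 γ.ds)
    {t : Plane → ℝ} {p : ℝ → ℝ} (h : γ.MemH10 t p) :
    ∫ s, (F s * p s + c s * t (γ.r s)) ∂γ.ds = 0 := by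
  obtain ⟨⟨ht, hp, -⟩, η, hη, h1, h2⟩ := h
  have hmem : ∀ θ : ℝ → ℝ, Continuous θ → MemLp θ 2 γ.ds := fun θ hθ => by
    obtain ⟨B, hB⟩ := isCompact_Icc.exists_bound_of_continuousOn (hθ.continuousOn (s := Icc 0 γ.L))
    exact memLp_of_bounded_on (C := B) measurableSet_Ioo (by simp) hθ.aestronglyMeasurable
      fun s hs => hB s (Ioo_subset_Icc_self hs)
  have m1 : ∀ n, MemLp (η n) 2 γ.ds := fun n => hmem _ (hη n).1.continuous
  have m2 : ∀ n, MemLp (deriv (η n)) 2 γ.ds := fun n => hmem _ ((hη n).1.continuous_deriv le_rfl)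
  -- The identity holds for the approximating test functions, and both of its terms pass to the
  -- limit by L² convergence.
  have l := (tendsto_integral_mul (fun n => (m2 n).1) hp hFL h2).add
    (tendsto_integral_mul (fun n => (m1 n).1) ht hcL h1)
  have e : ∀ n, (∫ s, deriv (η n) s * F s ∂γ.ds) + ∫ s, η n s * c s ∂γ.ds = 0 := fun n => by
    have i1 : Integrable (fun s => F s * deriv (η n) s) γ.ds := hFL.integrable_mul (m2 n)
    have i2 : Integrable (fun s => c s * η n s) γ.ds := hcL.integrable_mul (m1 n)
    have := γ.integral_mul_test hF hper (hη n) (i1.add i2)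
    rw [integral_add i1 i2] at this
    simpa only [mul_comm] using this
  simp only [e] at l
  have i1 : Integrable (fun s => F s * p s) γ.ds := hFL.integrable_mul hp
  have i2 : Integrable (fun s => c s * t (γ.r s)) γ.ds := hcL.integrable_mul ht
  rw [integral_add i1 i2]
  simpa only [mul_comm] using tendsto_nhds_unique l tendsto_const_nhds

end PlaneCurve

namespace IsAdmissible

/-! ### The equation in the domain -/

lemma continuousOn_laplacian (hA : IsAdmissible Ω Γ) {u : Plane → ℝ}
    (hu : ContDiffOn ℝ 2 u (closure Ω)) : ContinuousOn (Laplacian.laplacian u) Ω :=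
  (continuous_trace.comp_continuousOn (hA.continuousOn_fderiv
    (hA.contDiffOn_gradientOn hu (m := 1) (by norm_num)))).congr
    fun _ hx => (hA.divergence_gradientOn hu hx).symm

/-- The fundamental lemma gives the equation almost everywhere in Ω; continuity of both sides gives
it everywhere. -/
lemma neg_laplacian_eq_of_variational (hA : IsAdmissible Ω Γ) {f u : Plane → ℝ}
    (hf : ContinuousOn f Ω) (hu : ContDiffOn ℝ 2 u (closure Ω))
    (h : ∀ w : Plane → ℝ, ContDiff ℝ 1 w → tsupport w ⊆ Ω →
      ∫ x in Ω, w x * (Laplacian.laplacian u x + f x) = 0) {x : Plane} (hx : x ∈ Ω) :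
    - Laplacian.laplacian u x = f x := by
  have hc : ContinuousOn (fun x => Laplacian.laplacian u x + f x) Ω :=
    (hA.continuousOn_laplacian hu).add hf
  have hae := hA.isOpen.ae_eq_zero_of_integral_contDiff_smul_eq_zero (E := Plane) (F := ℝ) (μ := volume)
    (hc.locallyIntegrableOn hA.isOpen.measurableSet) fun w hw _ hws => by
      rw [← h w (hw.of_le (by simp)) hws]
      refine (setIntegral_eq_integral_of_forall_compl_eq_zero fun y hy => ?_).symm
      rw [image_eq_zero_of_notMem_tsupport fun h' => hy (hws h'), zero_smul]
  have h1 : (fun x => Laplacian.laplacian u x + f x) =ᵐ[volume.restrict Ω] fun _ => 0 :=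
    (ae_restrict_iff' hA.isOpen.measurableSet).2 hae
  have h2 := Measure.eqOn_open_of_ae_eq h1 hA.isOpen hc continuousOn_const hx
  simp only at h2
  linarith

/-! ### The Dirichlet condition -/

/-- One side suffices because, near an end point of an open curve, the curve may occupy the other
side of the graph. -/
lemma hausdorffMeasure_pos_of_graphMap {T : Plane ≃ₗᵢ[ℝ] Plane} {h : ℝ → ℝ} {A : Set Plane} {x : ℝ}
    (hx : (∀ᶠ y in 𝓝[<] x, graphMap T h y ∈ A) ∨ ∀ᶠ y in 𝓝[>] x, graphMap T h y ∈ A) :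
    0 < μH[1] A := by
  refine lt_of_lt_of_le ?_ (volume_graphMap_preimage_le T h A)
  rcases hx with hx | hx
  · obtain ⟨l, hl, hsub⟩ := mem_nhdsLT_iff_exists_Ioo_subset.1 hx
    exact lt_of_lt_of_le (by simpa using hl) (measure_mono hsub)
  · obtain ⟨l, hl, hsub⟩ := mem_nhdsGT_iff_exists_Ioo_subset.1 hx
    exact lt_of_lt_of_le (by simpa using hl) (measure_mono hsub)

/-- Every relatively open part of `Γ_D` has positive length. -/
theorem hausdorffMeasure_gammaD_inter_pos (hA : IsAdmissible Ω Γ) {p : Plane}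
    (hp : p ∈ GammaD Ω Γ) {V : Set Plane} (hV : V ∈ 𝓝 p) : 0 < μH[1] (GammaD Ω Γ ∩ V) := by
  obtain ⟨T, h, K, U, H, hpU⟩ := hA.lipschitz.exists_chart hp.1
  set x₀ := (T p) 0 with hx₀
  have hgp : graphMap T h x₀ = p := H.eq_graphMap hA.isOpen hpU hp.1
  have hev : ∀ {W : Set Plane}, W ∈ 𝓝 p → ∀ᶠ x in 𝓝 x₀, graphMap T h x ∈ W := fun {W} hW =>
    H.continuous_graphMap.continuousAt.eventually (by rwa [hgp])
  have hU : U ∈ 𝓝 p := H.isOpen.mem_nhds hpU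
  -- Either p is an end point of an open curve, or p is away from all curves and a whole boundary
  -- neighbourhood lies in Γ_D.
  by_cases hpt : ∃ i, p ∈ (Γ i).trace
  · obtain ⟨i, hpi⟩ := hpt
    set γ := Γ i
    have hpn : p ∉ γ.innerPart := fun h' => hp.2 (mem_iUnion.2 ⟨i, h'⟩)
    have hcl : ¬ γ.IsClosedCurve := fun h' => hpn (by rwa [γ.innerPart_eq_of_closed h'])
    obtain ⟨e, he, hre⟩ : ∃ e, (e = 0 ∨ e = γ.L) ∧ γ.r e = p := by
      by_contra! hne
      exact hpn ⟨hpi, Or.inr ⟨(hne 0 (Or.inl rfl)).symm, (hne γ.L (Or.inr rfl)).symm⟩⟩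
    have heI : e ∈ Icc 0 γ.L := by
      rcases he with rfl | rfl
      · exact left_mem_Icc.2 γ.L_pos.le
      · exact right_mem_Icc.2 γ.L_pos.le
    have hcont := γ.contDiffOn.continuousOn
    obtain ⟨δ₀, hδ₀, hδU⟩ := Metric.mem_nhdsWithin_iff.1
      ((hcont e heI).preimage_mem_nhdsWithin (by rwa [hre]) : γ.r ⁻¹' U ∈ 𝓝[Icc 0 γ.L] e)
    -- Halving the radius keeps the closed parameter interval [a, b] around e inside the chart; e is
    -- one of its end points.
    set δ := δ₀ / 2
    have hδ : 0 < δ := half_pos hδ₀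
    set a := max 0 (e - δ)
    set b := min γ.L (e + δ)
    have hQ : ∀ t ∈ Icc a b, t ∈ Icc 0 γ.L ∧ γ.r t ∈ U := fun t ht => by
      have h1 : t ∈ Icc 0 γ.L := ⟨(le_max_left _ _).trans ht.1, ht.2.trans (min_le_left _ _)⟩
      refine ⟨h1, hδU ⟨?_, h1⟩⟩
      rw [Real.ball_eq_Ioo]
      have h2 := (le_max_right 0 (e - δ)).trans ht.1
      have h3 := ht.2.trans (min_le_right γ.L (e + δ))
      exact ⟨by simp only [δ] at h2; linarith, by simp only [δ] at h3; linarith⟩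
    have hab : e ∈ Icc a b := ⟨max_le heI.1 (by linarith), le_min heI.2 (by linarith)⟩
    have hend : e = a ∨ e = b := by
      rcases he with h0 | h0
      · left
        simp only [a, h0]
        rw [max_eq_left (by linarith)]
      · right
        simp only [b, h0]
        rw [min_eq_left (by linarith)]
    have hgr : ∀ t ∈ Icc a b, graphMap T h ((T (γ.r t)) 0) = γ.r t := fun t ht =>
      H.eq_graphMap hA.isOpen (hQ t ht).2 (hA.trace_subset i (mem_image_of_mem _ (hQ t ht).1))
    have hσc : ContinuousOn (fun t => (T (γ.r t)) 0) (Icc a b) :=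
      (lipschitzWith_coord T 0).continuous.comp_continuousOn (hcont.mono fun t ht => (hQ t ht).1)
    have hσi : InjOn (fun t => (T (γ.r t)) 0) (Icc a b) := fun s hs t ht hst => by
      refine γ.injOn_Icc hcl (hQ s hs).1 (hQ t ht).1 ?_
      rw [← hgr s hs, ← hgr t ht]
      exact congrArg _ hst
    -- A continuous injective coordinate is strictly monotone, so the short arc stays on one side of
    -- its end point.
    have hside : (∀ t ∈ Icc a b, x₀ ≤ (T (γ.r t)) 0) ∨ ∀ t ∈ Icc a b, (T (γ.r t)) 0 ≤ x₀ := by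
      rw [hx₀, ← hre]
      rcases hσc.strictMonoOn_of_injOn_Icc' (hab.1.trans hab.2) hσi with hm | hm <;>
        rcases hend with h0 | h0
      · exact Or.inl fun t ht => hm.monotoneOn hab ht (h0 ▸ ht.1)
      · exact Or.inr fun t ht => hm.monotoneOn ht hab (h0 ▸ ht.2)
      · exact Or.inr fun t ht => hm.antitoneOn hab ht (h0 ▸ ht.1)
      · exact Or.inl fun t ht => hm.antitoneOn ht hab (h0 ▸ ht.2)
    -- The rest of the curve is compact and misses p by injectivity, so it does not return near p.
    have hfar : (γ.r '' (Icc 0 γ.L \ Ioo (e - δ) (e + δ)))ᶜ ∈ 𝓝 p := by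
      refine ((isCompact_Icc.diff isOpen_Ioo).image_of_continuousOn
        (hcont.mono sdiff_subset)).isClosed.isOpen_compl.mem_nhds ?_
      rintro ⟨t, ht, htp⟩
      have := γ.injOn_Icc hcl ht.1 heI (htp.trans hre.symm)
      exact ht.2 (this ▸ ⟨by linarith, by linarith⟩)
    have hoth : (⋃ j ∈ {j | j ≠ i}, (Γ j).trace)ᶜ ∈ 𝓝 p := by
      refine ((Set.toFinite _).isClosed_biUnion
        fun j _ => (Γ j).isCompact_trace.isClosed).isOpen_compl.mem_nhds ?_
      simp only [mem_compl_iff, mem_iUnion, not_exists]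
      exact fun j hj hpj => Set.disjoint_left.1 (hA.disjoint j i hj) hpj hpi
    have hgood : ∀ᶠ x in 𝓝 x₀, (∀ t ∈ Icc a b, (T (γ.r t)) 0 ≠ x) →
        graphMap T h x ∈ GammaD Ω Γ ∩ V := by
      filter_upwards [hev hV, hev hU, hev hfar, hev hoth] with x hxV hxU hxf hxo hx
      refine ⟨⟨H.graphMap_mem_frontier hA.isOpen hxU, fun hν => ?_⟩, hxV⟩
      obtain ⟨j, hj⟩ := mem_iUnion.1 hν
      by_cases hji : j = i
      · subst hji
        obtain ⟨t, htI, ht⟩ := hj.1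
        have htQ : t ∈ Ioo (e - δ) (e + δ) := by
          by_contra h'
          exact hxf ⟨t, ⟨htI, h'⟩, ht⟩
        refine hx t ⟨max_le htI.1 htQ.1.le, le_min htI.2 htQ.2.le⟩ ?_
        rw [ht, graphMap_coord_zero]
      · exact hxo (mem_biUnion (show j ∈ {j | j ≠ i} from hji) hj.1)
    rcases hside with hs | hs
    · refine hausdorffMeasure_pos_of_graphMap (T := T) (h := h) (x := x₀) (Or.inl ?_)
      filter_upwards [nhdsWithin_le_nhds hgood, self_mem_nhdsWithin] with x hx hlt
      exact hx fun t ht => (lt_of_lt_of_le hlt (hs t ht)).ne'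
    · refine hausdorffMeasure_pos_of_graphMap (T := T) (h := h) (x := x₀) (Or.inr ?_)
      filter_upwards [nhdsWithin_le_nhds hgood, self_mem_nhdsWithin] with x hx hlt
      exact hx fun t ht => (lt_of_le_of_lt (hs t ht) hlt).ne
  · push Not at hpt
    have hoth : (⋃ j, (Γ j).trace)ᶜ ∈ 𝓝 p := by
      refine (isClosed_iUnion_of_finite
        fun j => (Γ j).isCompact_trace.isClosed).isOpen_compl.mem_nhds ?_
      simpa using hpt
    refine hausdorffMeasure_pos_of_graphMap (T := T) (h := h) (x := x₀) (Or.inl (nhdsWithin_le_nhds ?_))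
    filter_upwards [hev hV, hev hU, hev hoth] with x hxV hxU hxo
    refine ⟨⟨H.graphMap_mem_frontier hA.isOpen hxU, fun hν => hxo ?_⟩, hxV⟩
    obtain ⟨j, hj⟩ := mem_iUnion.1 hν
    exact mem_iUnion.2 ⟨j, hj.1⟩

/-- Traces add, so u = (u − φ') + φ' has trace 0 + φ on Γ_D, and its trace is its restriction.
Equality almost everywhere becomes equality everywhere, since a failure would persist on a
relatively open part of Γ_D, which has positive length. -/
theorem eq_on_gammaD_of_memVphi (hA : IsAdmissible Ω Γ) {φ u : Plane → ℝ}
    (hφ : ContinuousOn φ (GammaD Ω Γ)) (hu : ContDiffOn ℝ 1 u (closure Ω))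
    (h : MemVphi Ω Γ φ u) {x : Plane} (hx : x ∈ GammaD Ω Γ) : u x = φ x := by
  obtain ⟨-, φ', ⟨D₁, t₁, p₁, h1, e1⟩, D₂, t₂, p₂, h2, ht2, -, e2⟩ := h
  have hsum : (fun x => u x - φ' x + φ' x) = u := by simp
  have ht := IsTrace.add hA.isOpen h2 h1.1 ht2 h1.2.1
  have hm := Ventcel.MemH1.add hA.isFiniteMeasure_volume h2 h1.1
  rw [hsum] at ht hm
  have e3 : ∀ᵐ x ∂(μH[1].restrict (GammaD Ω Γ)), t₂ x + t₁ x = u x :=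
    Measure.absolutelyContinuous_of_le gammaD_le_bdry (hA.trace_eq hu hm ht)
  have e4 : ∀ᵐ x ∂(μH[1].restrict (GammaD Ω Γ)), u x = φ x := by
    filter_upwards [e1, e2, e3] with y y1 y2 y3
    rw [← y3, y1, y2, zero_add]
  by_contra hne
  have hu' := (hu.continuousOn.mono
    (gammaD_subset_frontier.trans frontier_subset_closure)) x hx
  obtain ⟨V, hV, hsub⟩ := mem_nhdsWithin_iff_exists_mem_nhds_inter.1
    ((hu'.prodMk (hφ x hx)).eventually (isOpen_ne_fun continuous_fst continuous_snd |>.mem_nhds hne))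
  refine (hA.hausdorffMeasure_gammaD_inter_pos hx hV).ne' ?_
  refine measure_mono_null (fun y hy => ?_) (ae_iff.1 ((ae_restrict_iff' measurableSet_gammaD).1 e4))
  exact fun h' => hsub ⟨hy.2, hy.1⟩ (h' hy.1)

end IsAdmissible

end Ventcel

namespace Ventcel

variable {N : ℕ} {Ω : Set Plane} {Γ : Fin N → PlaneCurve}

namespace IsAdmissible

/-! ### Equivalence of the weak and the pointwise formulation -/

theorem holdsPointwise_of_isWeakSolution (hA : IsAdmissible Ω Γ) {f φ g a₂ a₀ u : Plane → ℝ}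
    (hf : ContinuousOn f Ω) (hφ : ContinuousOn φ (GammaD Ω Γ)) (hg : ContinuousOn g (GammaNu Γ))
    (ha₂ : ∀ i, ContDiffOn ℝ 1 (fun s => a₂ ((Γ i).r s)) (Γ i).dom)
    (ha₀ : ContinuousOn a₀ (GammaNu Γ)) (hu : ContDiffOn ℝ 2 u (closure Ω))
    (h : IsWeakSolution Ω Γ f 0 φ g 0 a₂ a₀ u) : HoldsPointwise Ω Γ f φ g a₂ a₀ u := by
  obtain ⟨hfL, -, hgL, -, ha₀L, hVφ, q, Du, tu, pu, hq, hV, hvar⟩ := h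
  have hu1 : ContDiffOn ℝ 1 u (closure Ω) := hu.of_le (by norm_num)
  have key : ∀ w : Plane → ℝ, ContDiff ℝ 1 w → Disjoint (tsupport w) (GammaD Ω Γ) →
      (∫ x in Ω, w x * (Laplacian.laplacian u x + f x)) =
      ∑ i, ∫ s, ((Γ i).tangentialFlux a₂ u s * deriv (fun s => w ((Γ i).r s)) s +
        (Γ i).fluxRate Ω g a₂ a₀ u s * w ((Γ i).r s)) ∂(Γ i).ds := fun w hw hd =>
    (hA.variational_iff hfL hgL ha₂ hq ha₀L hu hV (hA.memV0_of_contDiff hw hd)).1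
      (hvar _ _ _ _ (hA.memV0_of_contDiff hw hd))
  have hint : ∀ x ∈ Ω, - Laplacian.laplacian u x = f x := fun x hx => by
    -- A test function supported in Ω vanishes along all curves, together with its tangential
    -- derivative.
    refine hA.neg_laplacian_eq_of_variational hf hu (fun w hw hws => ?_) hx
    have hfr : Disjoint (tsupport w) (frontier Ω) :=
      (disjoint_frontier_iff_isOpen.2 hA.isOpen).symm.mono_left hws
    rw [key w hw (hfr.mono_right gammaD_subset_frontier)]
    refine Finset.sum_eq_zero fun i _ => ?_
    have hz : ∀ s ∈ (Γ i).dom, w ((Γ i).r s) = 0 := fun s hs =>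
      image_eq_zero_of_notMem_tsupport fun h' => Set.disjoint_left.1 hfr h'
        (PlaneCurve.r_mem_frontier (hA.trace_subset i) hs)
    refine (setIntegral_congr_fun measurableSet_Ioo (g := fun _ => (0 : ℝ)) fun t ht => ?_).trans
      (by simp)
    have htd := (Γ i).Ioo_subset_dom ht
    have h2 : (fun s => w ((Γ i).r s)) =ᶠ[𝓝 t] fun _ => 0 := by
      filter_upwards [(Γ i).isOpen_dom.mem_nhds htd] with x hx using hz x hx
    simp only [h2.deriv_eq, deriv_const, hz t htd, mul_zero, add_zero]
  refine ⟨hint, fun x hx => hA.eq_on_gammaD_of_memVphi hφ hu1 hVφ hx, fun i s hs => ?_⟩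
  rw [hA.ventcel_iff i (ha₂ i) hu1 hs]
  refine hA.hasDerivAt_of_variational
    (F := fun i => (Γ i).tangentialFlux a₂ u) (c := fun i => (Γ i).fluxRate Ω g a₂ a₀ u)
    (fun i => hA.continuousOn_tangentialFlux i (ha₂ i) hu1)
    (fun i => hA.continuousOn_fluxRate i hg (ha₂ i) ha₀ hu1)
    (fun i hc t => by
      simpa using PlaneCurve.tangentialFlux_add_int_mul hc a₂ u 1 t)
    (fun i hc t => by
      simpa using PlaneCurve.fluxRate_add_int_mul (Ω := Ω) hc g a₂ a₀ u 1 t)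
    (fun w hw hd => ?_) i hs
  -- With −Δu = f established, the interior term is zero and only the curve integrals remain.
  rw [← key w hw hd]
  refine (setIntegral_congr_fun hA.isOpen.measurableSet (g := fun _ => (0 : ℝ))
    fun x hx => ?_).trans (by simp)
  simp only [← hint x hx, add_neg_cancel, mul_zero]

theorem isWeakSolution_of_holdsPointwise (hA : IsAdmissible Ω Γ) {f φ g a₂ a₀ u : Plane → ℝ}
    (hg : ∀ i, MemLp (fun s => g ((Γ i).r s)) 2 (Γ i).ds)
    (ha₂ : ∀ i, ContDiffOn ℝ 1 (fun s => a₂ ((Γ i).r s)) (Γ i).dom)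
    (ha₂W : ∀ i, ∃ q : ℝ → ℝ, (Γ i).MemW1Infty a₂ q)
    (ha₀ : ∀ i, MemLp (fun s => a₀ ((Γ i).r s)) ∞ (Γ i).ds)
    (hu : ContDiffOn ℝ 2 u (closure Ω)) (h : HoldsPointwise Ω Γ f φ g a₂ a₀ u) :
    IsWeakSolution Ω Γ f 0 φ g 0 a₂ a₀ u := by
  have hu1 : ContDiffOn ℝ 1 u (closure Ω) := hu.of_le (by norm_num)
  choose q hq using ha₂W
  have hfL : MemLp f 2 (volume.restrict Ω) :=
    (hA.memLp_laplacian hu).neg.ae_eq ((ae_restrict_iff' hA.isOpen.measurableSet).2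
      (Eventually.of_forall fun x hx => h.interior x hx))
  have hV : MemV Ω Γ u (gradient u) u (fun i => deriv fun s => u ((Γ i).r s)) :=
    ⟨hA.memH1 hu1, hA.isTrace_self hu1, fun i => hA.memH1_curve i hu1⟩
  -- u serves as its own lifting of φ, so the difference required to be in V₀ is zero.
  have h0 : MemV0 Ω Γ (fun x => u x - u x) (gradient fun _ : Plane => (0 : ℝ))
      (fun _ => 0) (fun _ => deriv fun _ : ℝ => (0 : ℝ)) := by
    simp only [sub_self]
    exact hA.memV0_of_contDiff (w := fun _ => (0 : ℝ)) contDiff_const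
      (by simp [tsupport])
  refine ⟨hfL, MemLp.zero, hg, fun i => MemLp.zero, ha₀, ⟨⟨_, hV.1⟩, u, ⟨_, _, _, hV,
    ae_restrict_of_forall_mem measurableSet_gammaD h.dirichlet⟩, _, _, _, h0⟩,
    q, _, _, _, hq, hV, fun w Dw tw pw hw => ?_⟩
  rw [hA.variational_iff hfL hg ha₂ hq ha₀ hu hV hw]
  rw [Finset.sum_eq_zero fun i _ => PlaneCurve.integral_mul_memH10
    (fun s hs => (hA.ventcel_iff i (ha₂ i) hu1 hs).1 (h.ventcel i s hs))
    (fun hc => by simpa using PlaneCurve.tangentialFlux_add_int_mul hc a₂ u 1 0)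
    (hA.memLp_tangentialFlux i (hq i) hu1) (hA.memLp_fluxRate i (hg i) (ha₂ i) (hq i) (ha₀ i) hu1)
    (hw.2.2.1 i)]
  refine (setIntegral_congr_fun hA.isOpen.measurableSet (g := fun _ => (0 : ℝ))
    fun x hx => ?_).trans (by simp)
  simp only [← h.interior x hx, add_neg_cancel, mul_zero]

end IsAdmissible

end Ventcel

theorem mainTheorem5 {N : ℕ} (Ω : Set Ventcel.Plane) (Γ : Fin N → Ventcel.PlaneCurve)
    (hΩ : Ventcel.IsAdmissible Ω Γ)
    (f φ g a₂ a₀ : Ventcel.Plane → ℝ)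
    (hf : ContinuousOn f Ω)
    (hφ : ContinuousOn φ (Ventcel.GammaD Ω Γ))
    (hg : ContinuousOn g (Ventcel.GammaNu Γ))
    (hg2 : ∀ i, MemLp (fun s => g ((Γ i).r s)) 2 (Γ i).ds)
    (ha₂ : ∀ i, ContDiffOn ℝ 1 (fun s => a₂ ((Γ i).r s)) (Γ i).dom)
    (ha₂W : ∀ i, ∃ q : ℝ → ℝ, (Γ i).MemW1Infty a₂ q)
    (ha₀ : ContinuousOn a₀ (Ventcel.GammaNu Γ))
    (ha₀b : ∀ i, MemLp (fun s => a₀ ((Γ i).r s)) ∞ (Γ i).ds)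
    (u : Ventcel.Plane → ℝ) (hu : ContDiffOn ℝ 2 u (closure Ω)) :
    Ventcel.IsWeakSolution Ω Γ f 0 φ g 0 a₂ a₀ u ↔
      Ventcel.HoldsPointwise Ω Γ f φ g a₂ a₀ u :=
  ⟨hΩ.holdsPointwise_of_isWeakSolution hf hφ hg ha₂ ha₀ hu,
    hΩ.isWeakSolution_of_holdsPointwise hg2 ha₂ ha₂W ha₀b hu⟩
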